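/- Let $n\ge 3$, let $e_1,\dots,e_n$ be the standard basis of $\mathbb{R}^n$, and let $Cl_n$ be the real Clifford algebra with $e_ie_j+e_je_i=-2\delta_{ij}$, so that a vector $x\ne 0$ has the inverse $x^{-1}=-x/\|x\|^2$. Let $a\mapsto a^*$ be the automorphism of $Cl_n$ with $e_n^*=-e_n$ and $e_i^*=e_i$ for $i<n$. Write $a\in Cl_n$ as $a=P+e_nQ$ with $P,Q\in Cl_{n-1}$ (the subalgebra generated by $e_1,\dots,e_{n-1}$), and put $Qa:=Q$. A real differentiable function $f:U\to Cl_n$ on an open set $U\subseteq\{x\in\mathbb{R}^n: x_n\neq 0\}$ is called left hypermonogenic if $$x_n\,Df(x)+(n-2)\,Qf(x)=0\quad\text{on }U,\qquad D=\sum_{i=1}^n e_i\,\frac{\partial}{\partial x_i}.$$ The hypermonogenic kernels are $$p_1(x,y)=\frac{(x-y)^{-1}}{\|x-y\|^{n-2}\|x-y^*\|^{n-2}},\qquad p_2(x,y)=\frac{(x^*-y)^{-1}}{\|x-y\|^{n-2}\|x^*-y\|^{n-2}}.$$ Let $\omega_1,\dots,\omega_k$ be $\mathbb{R}$-linearly independent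 vectors in $\mathrm{span}_{\mathbb{R}}\{e_1,\dots,e_{n-1}\}$ (so $k<n$), let $\Omega_k=\mathbb{Z}\omega_1+\dots+\mathbb{Z}\omega_k$, let $C_k=\mathbb{R}^n/\Omega_k$ with its flat metric, and let $p:\mathbb{R}^n\to C_k$ be the projection. For $0\le l\le k$ let $E^{(l)}$ be the spinor bundle on $C_k$ obtained from $\mathbb{R}^n\times Cl_n$ by identifying $(x,X)$ with $\big(x+\sum_i m_i\omega_i,\ (-1)^{m_1+\dots+m_l}X\big)$ for $m\in\mathbb{Z}^k$. A section of $E^{(l)}$ over an open set $U'\subseteq C_k$ is a function $f$ on $p^{-1}(U')$ with $f(x+\sum_i m_i\omega_i)=(-1)^{m_1+\dots+m_l}f(x)$; it is called left hypermonogenic if $f$ is. Put, for $j=1,2$, $$c_j(x,y)=\sum_{m\in\mathbb{Z}^k}(-1)^{m_1+\dots+m_l}\,p_j\Big(x+\sum_{i=1}^k m_i\omega_i,\;y\Big).$$ Theorem. Let $U'\subseteq C_k$ be open with $x_n\ne 0$ on $p^{-1}(U')$, let $K'\subseteq C_k$ be a domain (open and connected) with Lipschitz boundary $S'=\partial K'$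 whose closure is compact and contained in $U'$, and let $f$ be a left hypermonogenic section of $E^{(l)}$ over $U'$. Let $n(x)$ be the unit outer normal of $p^{-1}(K')$ at $x$ (it exists at almost every boundary point), let $\sigma'$ be the surface measure on $S'$, and let $\omega_n$ be the surface area of the unit sphere of $\mathbb{R}^n$. Let $y$ be a point with $p(y)\in K'$. Then for every $x\in p^{-1}(S')$ the series $c_1(x,y)$ and $c_2(x,y)$ converge absolutely, the products $c_1(x,y)\,n(x)\,f(x)$ and $c_2(x,y)\,n(x)^*f(x)^*$ are integrable over $S'$, and $$f(y)=\frac{2^{n-2}|y_n|^{n-2}}{\omega_n}\left[\int_{S'}c_1(x,y)\,n(x)\,f(x)\,d\sigma'(x')-\int_{S'}c_2(x,y)\,n(x)^*\,f(x)^*\,d\sigma'(x')\right],\qquad x'=p(x).$$ -/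

import Mathlib

open MeasureTheory Set
open scoped NNReal

noncomputable section

namespace HyperCyl

/-! ### The Clifford algebra of Euclidean space -/

/-- Euclidean space `ℝⁿ`. -/
abbrev E (n : ℕ) : Type := EuclideanSpace ℝ (Fin n)

/-- The quadratic form `x ↦ -‖x‖²`. -/
def cliffordForm (n : ℕ) : QuadraticForm ℝ (E n) :=
  -(LinearMap.BilinMap.toQuadraticMap (innerₗ (E n)))

theorem cliffordForm_apply (n : ℕ) (x : E n) : cliffordForm n x = -‖x‖ ^ 2 := by
  simp [cliffordForm]

/-- The real Clifford algebra `Cl_n`, with `e_i e_j + e_j e_i = -2 δ_ij`. -/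
abbrev Cl (n : ℕ) : Type := CliffordAlgebra (cliffordForm n)

/-- The inclusion of vectors `ℝⁿ ⊆ Cl_n`. -/
def vec {n : ℕ} (x : E n) : Cl n := CliffordAlgebra.ι (cliffordForm n) x

theorem vec_mul_self {n : ℕ} (x : E n) :
    vec x * vec x = algebraMap ℝ (Cl n) (-‖x‖ ^ 2) := by
  rw [vec, CliffordAlgebra.ι_sq_scalar, cliffordForm_apply]

/-- The `2ⁿ`-element basis of `Cl_n` given by the products `e_A`, `A ⊆ {1, …, n}`. -/
def clBasis (n : ℕ) : Module.Basis (Finset (Fin n)) ℝ (Cl n) :=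
  ((EuclideanSpace.basisFun (Fin n) ℝ).toBasis.ExteriorAlgebra).map
    (CliffordAlgebra.equivExterior (cliffordForm n)).symm

/-- Coordinates in that basis, as a point of a Euclidean space. -/
def clCoord (n : ℕ) : Cl n ≃ₗ[ℝ] EuclideanSpace ℝ (Finset (Fin n)) :=
  (clBasis n).equivFun ≪≫ₗ (WithLp.linearEquiv 2 ℝ (Finset (Fin n) → ℝ)).symm

/-- The Euclidean norm `‖a‖² = ∑ a_A²` on the finite-dimensional space `Cl_n`. -/
instance instNormedAddCommGroupCl (n : ℕ) : NormedAddCommGroup (Cl n) :=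
  NormedAddCommGroup.induced (Cl n) (EuclideanSpace ℝ (Finset (Fin n))) (clCoord n)
    (clCoord n).injective

instance instNormedSpaceCl (n : ℕ) : NormedSpace ℝ (Cl n) :=
  NormedSpace.induced ℝ (Cl n) (EuclideanSpace ℝ (Finset (Fin n))) (clCoord n)

instance instFiniteDimensionalCl (n : ℕ) : FiniteDimensional ℝ (Cl n) :=
  Module.Basis.finiteDimensional_of_finite (clBasis n)

/-- The standard basis vector `e_i`. -/
def e {n : ℕ} (i : Fin n) : E n := EuclideanSpace.single i 1

/-- `x ↦ x*` on vectors: the reflection that changes the sign of the last coordinate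
(`⊤ : Fin n` is the last index). -/
def conjVec {n : ℕ} [NeZero n] : E n ≃ₗᵢ[ℝ] E n := (ℝ ∙ (e (⊤ : Fin n)))ᗮ.reflection

/-- The automorphism `a ↦ a*` of `Cl_n` with `e_n* = -e_n`, `e_i* = e_i` for `i < n`. -/
def conjCl {n : ℕ} [NeZero n] : Cl n →ₐ[ℝ] Cl n :=
  CliffordAlgebra.map
    { toLinearMap := (conjVec (n := n)).toLinearEquiv.toLinearMap
      map_app' := fun x => by
        rw [cliffordForm_apply, cliffordForm_apply]
        simp }

theorem conjCl_vec {n : ℕ} [NeZero n] (x : E n) : conjCl (vec x) = vec (conjVec x) :=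
  CliffordAlgebra.map_apply_ι _ _

/-! ### Hypermonogenic functions -/

/-- The Dirac operator `D f = ∑ e_i ∂f/∂x_i`. -/
def dirac {n : ℕ} (f : E n → Cl n) (x : E n) : Cl n :=
  ∑ i : Fin n, vec (e i) * fderiv ℝ f x (e i)

/-- For `a = P + e_n Q` with `P, Q` in the subalgebra `Cl_{n-1}` generated by
`e_1, …, e_{n-1}` (the fixed algebra of `*`), this is `Q`, i.e. the `Cl_{n-1}`-component
`(b + b*) / 2` of `b = -e_n a`. For a vector `a` it is the scalar part of `-e_n a`. -/
def qPart {n : ℕ} [NeZero n] (a : Cl n) : Cl n :=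
  (1 / 2 : ℝ) • (-(vec (e ⊤) * a) + conjCl (-(vec (e ⊤) * a)))

/-- `f` is left hypermonogenic on `U`: it is real differentiable on `U` and
`x_n D f + (n - 2) Q f = 0` there. -/
def LeftHypermonogenicOn {n : ℕ} [NeZero n] (f : E n → Cl n) (U : Set (E n)) : Prop :=
  DifferentiableOn ℝ f U ∧
    ∀ x ∈ U, x ⊤ • dirac f x + ((n : ℝ) - 2) • qPart (f x) = 0

/-! ### Kernels -/

/-- The inverse `x⁻¹ = -x / ‖x‖²` of a nonzero vector. -/
def vecInv {n : ℕ} (x : E n) : Cl n := vec (-((‖x‖ ^ 2)⁻¹ • x))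

/-- `p₁(x, y) = (x - y)⁻¹ / (‖x - y‖ⁿ⁻² ‖x - y*‖ⁿ⁻²)`. -/
def p₁ {n : ℕ} [NeZero n] (x y : E n) : Cl n :=
  (‖x - y‖ ^ (n - 2) * ‖x - conjVec y‖ ^ (n - 2))⁻¹ • vecInv (x - y)

/-- `p₂(x, y) = (x* - y)⁻¹ / (‖x - y‖ⁿ⁻² ‖x* - y‖ⁿ⁻²)`. -/
def p₂ {n : ℕ} [NeZero n] (x y : E n) : Cl n :=
  (‖x - y‖ ^ (n - 2) * ‖conjVec x - y‖ ^ (n - 2))⁻¹ • vecInv (conjVec x - y)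

/-! ### Cylinders, their spinor bundles, and periodised kernels -/

/-- The lattice `ℤ ω_1 + ⋯ + ℤ ω_k`. -/
def lattice {n k : ℕ} (ω : Fin k → E n) : AddSubgroup (E n) :=
  AddSubgroup.closure (range ω)

/-- The cylinder `C_k = ℝⁿ / Ω_k`. -/
abbrev Cylinder {n k : ℕ} (ω : Fin k → E n) : Type := E n ⧸ lattice ω

/-- The projection `p : ℝⁿ → C_k`. -/
def proj {n k : ℕ} (ω : Fin k → E n) (x : E n) : Cylinder ω := QuotientAddGroup.mk x

/-- The lattice point `m_1 ω_1 + ⋯ + m_k ω_k`. -/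
def latticePoint {n k : ℕ} (ω : Fin k → E n) (m : Fin k → ℤ) : E n := ∑ i, m i • ω i

/-- The sign `(-1)^(m_1 + ⋯ + m_l)`. -/
def latticeSign {k : ℕ} (l : ℕ) (m : Fin k → ℤ) : ℝ :=
  (-1) ^ (∑ i ∈ Finset.univ.filter (fun i : Fin k => i.val < l), m i)

/-- `f` represents a section over `U' ⊆ C_k` of the spinor bundle `E^(l)`, the quotient of
`ℝⁿ × Cl_n` by `(x, X) ∼ (x + ∑ m_i ω_i, (-1)^(m_1 + ⋯ + m_l) X)`: on the preimage of `U'`,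
`x ↦ (x, f x)` respects this identification. -/
def IsSpinorSection {n k : ℕ} (ω : Fin k → E n) (l : ℕ) (U' : Set (Cylinder ω))
    (f : E n → Cl n) : Prop :=
  ∀ x, proj ω x ∈ U' → ∀ m : Fin k → ℤ, f (x + latticePoint ω m) = latticeSign l m • f x

/-- The terms of the series `c₁(x, y)`, indexed by the lattice. -/
def c₁Term {n k : ℕ} [NeZero n] (ω : Fin k → E n) (l : ℕ) (x y : E n) (m : Fin k → ℤ) : Cl n :=
  latticeSign l m • p₁ (x + latticePoint ω m) y

/-- The terms of the series `c₂(x, y)`, indexed by the lattice. -/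
def c₂Term {n k : ℕ} [NeZero n] (ω : Fin k → E n) (l : ℕ) (x y : E n) (m : Fin k → ℤ) : Cl n :=
  latticeSign l m • p₂ (x + latticePoint ω m) y

/-- `c₁(x, y) = ∑ (-1)^(m_1 + ⋯ + m_l) p₁(x + m_1 ω_1 + ⋯ + m_k ω_k, y)`. -/
def c₁ {n k : ℕ} [NeZero n] (ω : Fin k → E n) (l : ℕ) (x y : E n) : Cl n :=
  ∑' m, c₁Term ω l x y m

/-- `c₂(x, y) = ∑ (-1)^(m_1 + ⋯ + m_l) p₂(x + m_1 ω_1 + ⋯ + m_k ω_k, y)`. -/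
def c₂ {n k : ℕ} [NeZero n] (ω : Fin k → E n) (l : ℕ) (x y : E n) : Cl n :=
  ∑' m, c₂Term ω l x y m

/-! ### Lipschitz boundary, normal, surface measure -/

/-- `K` has Lipschitz boundary: near each boundary point it is, in suitable orthonormal
coordinates, the region above the graph of a Lipschitz function on a hyperplane `uᗮ`. -/
def HasLipschitzBoundary {n : ℕ} (K : Set (E n)) : Prop :=
  ∀ x₀ ∈ frontier K, ∃ (u : E n) (L : ℝ≥0) (φ : (ℝ ∙ u)ᗮ → ℝ) (r : ℝ),
    ‖u‖ = 1 ∧ LipschitzWith L φ ∧ 0 < r ∧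
      ∀ x ∈ Metric.ball x₀ r, x ∈ K ↔ φ ((ℝ ∙ u)ᗮ.orthogonalProjectionOnto x) < inner ℝ u x

/-- `ν` is the unit outer normal of `K` at `x`: inside any two-sided cone around the axis `ν`,
`K` contains the points near `x` on the side of `-ν` and none on the side of `ν`. -/
def IsOuterNormal {n : ℕ} (K : Set (E n)) (x ν : E n) : Prop :=
  ‖ν‖ = 1 ∧ ∀ ε > 0, ∃ δ > 0, ∀ z, ‖z - x‖ < δ →
    (inner ℝ (z - x) ν < -ε * ‖z - x‖ → z ∈ K) ∧ (ε * ‖z - x‖ < inner ℝ (z - x) ν → z ∉ K)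

open Classical in
/-- The unit outer normal; `0` at the boundary points where there is none. -/
def outerNormal {n : ℕ} (K : Set (E n)) (x : E n) : E n :=
  if h : ∃ ν, IsOuterNormal K x ν then h.choose else 0

/-- The half-open fundamental cell `{∑ t_i ω_i + v : 0 ≤ t_i < 1, v ⟂ ω_1, …, ω_k}`. -/
def fundamentalCell {n k : ℕ} (ω : Fin k → E n) : Set (E n) :=
  {x | ∃ (t : Fin k → ℝ) (v : E n), (∀ i, 0 ≤ t i ∧ t i < 1) ∧ (∀ i, inner ℝ v (ω i) = 0) ∧
    x = ∑ i, t i • ω i + v}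

/-- The `(n-1)`-dimensional surface measure `σ'` on the flat manifold `C_k`: the
`(n-1)`-dimensional Hausdorff measure of `ℝⁿ` (normalised as area), restricted to a fundamental
cell and projected down. -/
def surfaceMeasure {n k : ℕ} (ω : Fin k → E n) : Measure (Cylinder ω) :=
  ((Measure.euclideanHausdorffMeasure (n - 1) : Measure (E n)).restrict
    (fundamentalCell ω)).map (proj ω)

/-- The surface area of the unit sphere of `ℝⁿ`. -/
def sphereArea (n : ℕ) : ℝ :=
  ((Measure.euclideanHausdorffMeasure (n - 1) : Measure (E n))
    (Metric.sphere (0 : E n) 1)).toReal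

/-- The integrand `c₁'(x', y') dp(n(x)) f'(x')` on `∂K'`, computed at a representative `x` of
`x'`; the product does not depend on it. -/
def integrand₁ {n k : ℕ} [NeZero n] (ω : Fin k → E n) (l : ℕ) (K' : Set (Cylinder ω))
    (f : E n → Cl n) (y : E n) (x' : Cylinder ω) : Cl n :=
  c₁ ω l x'.out y * vec (outerNormal (proj ω ⁻¹' K') x'.out) * f x'.out

/-- The integrand `c₂'(x', y') dp(n(x))* f*(x')` on `∂K'`. -/
def integrand₂ {n k : ℕ} [NeZero n] (ω : Fin k → E n) (l : ℕ) (K' : Set (Cylinder ω))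
    (f : E n → Cl n) (y : E n) (x' : Cylinder ω) : Cl n :=
  c₂ ω l x'.out y * conjCl (vec (outerNormal (proj ω ⁻¹' K') x'.out)) * conjCl (f x'.out)

end HyperCyl

end

open HyperCyl

/-! The proof works upstairs, on the unbounded periodic region K = p⁻¹(K') in ℝⁿ. The central object
is the Clifford-valued linear form V(x)v = p₁(x,y) v f(x) - p₂(x,y) v* f(x)*, called `kernelForm`.
Away from y and y* it is divergence-free, i.e. ∑ ∂ᵢV(eᵢ) = 0 (`sum_fderiv_kernelForm`). The
conjugate f* is what reveals Q: f - f* = 2 eₙ Qf. With R = ∑ (∂ᵢp₁) eᵢ one has R = ∑ (∂ᵢp₂) eᵢ* and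
2 R eₙ = ((n-2)/xₙ)(p₁ - p₂). Hence the terms with differentiated kernels give R(f - f*) =
((n-2)/xₙ)(p₁ - p₂) Qf, while the equation for f and (Qf)* = Qf turn p₁ Df - p₂ (Df)* into the
negative of this.

A hypermonogenic f is only assumed differentiable, and the boundary is only Lipschitz, so a
divergence theorem of matching generality is needed: differentiable compactly supported fields with
continuous divergence on Lipschitz regions (`integral_inner_outerNormal`,
`integral_apply_outerNormal`). It rests on the box divergence theorem for differentiable fields,
mollification, Rademacher's theorem, the area formula for Lipschitz graphs, and a partition of
unity. A cutoff ψ times V qualifies: its divergence contains only ∇ψ and V, hence is continuous.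

Taking for ψ the difference of a large and a small radial cutoff gives Cauchy's formula on K. The
large one is removed by integrability of V. The small one, concentrated on a shell about y, gives a
multiple of f(y): p₁(x,y)(x - y) is the scalar ‖x - y‖^(2-n) ‖x - y*‖^(2-n), the factor ‖x - y*‖
tends to 2|yₙ|, and p₂ is less singular by one order
(`tendsto_integral_cutoffSlope_smul_kernelForm`). The shell produces n times the volume of the unit
ball, which `sphereArea_eq` identifies with the sphere area.

The passage to the cylinder is unfolding (`integral_periodized_mul`). The signs of the kernel series
cancel those of the section, so the integral of a periodised kernel over S' is the integral of pⱼ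
over the whole of p⁻¹(S'). Convergence comes from decay: K' is connected and xₙ descends to the
cylinder, so xₙ keeps the sign of yₙ on K; there ‖x - y*‖ ≥ ‖x - y‖, and the kernels decay like
‖x‖^-(2n-3). Since k ≤ n-1 and n ≥ 3, this exponent exceeds the lattice rank k. -/

noncomputable section
namespace HyperCyl
open Filter Topology

/-! ### Vanishing integral of a compactly supported divergence. -/

/-- The divergence of a vector field on `ℝⁿ`. -/
def divergence {n : ℕ} (F : E n → E n) (x : E n) : ℝ := ∑ i, (fderiv ℝ F x (e i)) i

/-- The box divergence theorem is applied on a cube whose faces lie where F vanishes. That theorem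
asks only for differentiability and an integrable divergence, not for a C¹ field. -/
theorem integral_divergence_eq_zero {d : ℕ} {F : E (d + 1) → E (d + 1)}
    (hF : Differentiable ℝ F) (hc : HasCompactSupport F) (hdiv : Integrable (divergence F)) :
    ∫ x, divergence F x = 0 := by
  obtain ⟨R, hR⟩ := hc.isCompact.isBounded.subset_ball 0
  have hzero : ∀ x : E (d + 1), R ≤ ‖x‖ → F x = 0 := by
    intro x hx
    by_contra h
    have := hR (subset_tsupport F h)
    simp at this
    linarith
  have hzero' : ∀ x : E (d + 1), R ≤ ‖x‖ → divergence F x = 0 := by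
    intro x hx
    have : x ∉ tsupport F := fun h => by
      have := hR h
      simp at this
      linarith
    have h0 : fderiv ℝ F x = 0 := by
      by_contra h
      exact this (support_fderiv_subset ℝ (f := F) h)
    simp [divergence, h0]
  have hcoord : ∀ (x : Fin (d + 1) → ℝ) (i : Fin (d + 1)), R ≤ |x i| → R ≤ ‖WithLp.toLp 2 x‖ := by
    intro x i hi
    have := PiLp.norm_apply_le (WithLp.toLp 2 x) i
    simp at this
    linarith
  let T : (Fin (d + 1) → ℝ) ≃L[ℝ] E (d + 1) := (EuclideanSpace.equiv (Fin (d + 1)) ℝ).symm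
  let S : E (d + 1) ≃L[ℝ] (Fin (d + 1) → ℝ) := EuclideanSpace.equiv (Fin (d + 1)) ℝ
  -- R can be negative when the support is empty; the maximum keeps the corners of the cube in
  -- order.
  let R' := max R 1
  have hmp := (EuclideanSpace.volume_preserving_symm_measurableEquiv_toLp (Fin (d + 1))).symm
  have hemb := (MeasurableEquiv.toLp 2 (Fin (d + 1) → ℝ)).measurableEmbedding
  have hsum : ∀ x : Fin (d + 1) → ℝ, divergence F (WithLp.toLp 2 x) =
      ∑ i, ((S : E (d + 1) →L[ℝ] (Fin (d + 1) → ℝ)).comp ((fderiv ℝ F (T x)).comp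
        (T : (Fin (d + 1) → ℝ) →L[ℝ] E (d + 1)))) (Pi.single i 1) i := by
    intro x
    rfl
  have hint : Integrable (fun x : Fin (d + 1) → ℝ => divergence F (WithLp.toLp 2 x)) :=
    (hmp.integrable_comp_emb hemb).2 hdiv
  have hkey := integral_divergence_of_hasFDerivAt_off_countable (n := d) (a := fun _ => -R')
    (b := fun _ => R') (fun i => by simp only [R']; linarith [le_max_right R 1])
    (fun x => S (F (T x))) (fun x => (S : E (d + 1) →L[ℝ] (Fin (d + 1) → ℝ)).comp
      ((fderiv ℝ F (T x)).comp (T : (Fin (d + 1) → ℝ) →L[ℝ] E (d + 1)))) ∅ countable_empty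
    (S.continuous.comp (hF.continuous.comp T.continuous)).continuousOn
    (fun x _ => S.hasFDerivAt.comp x
      ((hF (T x)).hasFDerivAt.comp x T.hasFDerivAt))
    (by
      refine (hint.congr (Eventually.of_forall fun x => hsum x)).integrableOn)
  calc ∫ x, divergence F x = ∫ x : Fin (d + 1) → ℝ, divergence F (WithLp.toLp 2 x) :=
        (hmp.integral_comp hemb _).symm
    _ = ∫ x in Icc (fun _ : Fin (d + 1) => -R') (fun _ => R'), divergence F (WithLp.toLp 2 x) := by
        symm
        apply setIntegral_eq_integral_of_forall_compl_eq_zero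
        intro x hx
        apply hzero'
        have : ∃ i, R' ≤ |x i| := by
          by_contra! hcon
          apply hx
          exact ⟨fun i => (abs_le.1 (hcon i).le).1, fun i => (abs_le.1 (hcon i).le).2⟩
        obtain ⟨i, hi⟩ := this
        exact hcoord x i ((le_max_left _ _).trans hi)
    _ = 0 := by
        refine hkey.trans ?_
        refine Finset.sum_eq_zero fun i _ => ?_
        have hR'pos : 0 < R' := lt_of_lt_of_le one_pos (le_max_right _ _)
        have h1 : ∀ (c : ℝ) (_ : |c| = R') (x : Fin d → ℝ), S (F (T (i.insertNth c x))) i = 0 := by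
          intro c hc x
          have : F (T (i.insertNth c x)) = 0 := by
            apply hzero
            apply hcoord _ i
            simp only [Fin.insertNth_apply_same, hc]
            exact le_max_left _ _
          rw [this]; simp
        simp only [h1 R' (abs_of_pos hR'pos), h1 (-R') (by rw [abs_neg, abs_of_pos hR'pos])]
        simp

theorem divergence_smul {n : ℕ} {F : E n → E n} {ψ : E n → ℝ} {x : E n}
    (hψ : DifferentiableAt ℝ ψ x) (hF : DifferentiableAt ℝ F x) :
    divergence (fun x => ψ x • F x) x = ψ x * divergence F x + fderiv ℝ ψ x (F x) := by
  have h1 : fderiv ℝ ψ x (F x) = ∑ i, fderiv ℝ ψ x (e i) * F x i := by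
    conv_lhs => rw [← (EuclideanSpace.basisFun (Fin n) ℝ).sum_repr (F x)]
    simp [map_sum, e, mul_comm]
  unfold divergence
  rw [fderiv_fun_smul hψ hF, h1, Finset.mul_sum, ← Finset.sum_add_distrib]
  simp

theorem divergence_eq_zero_of_notMem_tsupport {n : ℕ} {F : E n → E n} {x : E n}
    (h : x ∉ tsupport F) : divergence F x = 0 := by
  have h0 : fderiv ℝ F x = 0 := by
    by_contra hne
    exact h (support_fderiv_subset ℝ (f := F) hne)
  simp [divergence, h0]

theorem hasCompactSupport_divergence {n : ℕ} {F : E n → E n} (hc : HasCompactSupport F) :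
    HasCompactSupport (divergence F) :=
  HasCompactSupport.intro hc fun _ hx => divergence_eq_zero_of_notMem_tsupport hx

end HyperCyl
end

/-! ### Mollification and integration by parts against Lipschitz functions. -/

noncomputable section
namespace HyperCyl
open Filter Topology
open scoped Convolution

/-- The convolution of a function on `ℝⁿ` with a normalised bump function. -/
def mollify {n : ℕ} (ρ : ContDiffBump (0 : E n)) (g : E n → ℝ) : E n → ℝ :=
  g ⋆[ContinuousLinearMap.lsmul ℝ ℝ, volume] (ρ.normed volume)

theorem mollify_apply {n : ℕ} (ρ : ContDiffBump (0 : E n)) (g : E n → ℝ) (x : E n) :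
    mollify ρ g x = ∫ t, g t * ρ.normed volume (x - t) := rfl

theorem mollify_eq {n : ℕ} (ρ : ContDiffBump (0 : E n)) (g : E n → ℝ) :
    mollify ρ g = (ρ.normed volume) ⋆[ContinuousLinearMap.lsmul ℝ ℝ, volume] g := by
  ext x
  rw [mollify_apply, convolution_eq_swap]
  simp [mul_comm]

theorem contDiff_mollify {n : ℕ} (ρ : ContDiffBump (0 : E n)) {g : E n → ℝ} (hg : Continuous g) :
    ContDiff ℝ 1 (mollify ρ g) :=
  ρ.hasCompactSupport_normed.contDiff_convolution_right _ hg.locallyIntegrable ρ.contDiff_normed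

theorem hasCompactSupport_mollify {n : ℕ} (ρ : ContDiffBump (0 : E n)) {g : E n → ℝ}
    (hg : HasCompactSupport g) : HasCompactSupport (mollify ρ g) :=
  hg.convolution (ContinuousLinearMap.lsmul ℝ ℝ) ρ.hasCompactSupport_normed

theorem fderiv_mollify {n : ℕ} (ρ : ContDiffBump (0 : E n)) {g : E n → ℝ} (hg : Continuous g)
    (x v : E n) :
    fderiv ℝ (mollify ρ g) x v = ∫ t, g t * fderiv ℝ (ρ.normed volume) (x - t) v := by
  have h := ρ.hasCompactSupport_normed.hasFDerivAt_convolution_right (μ := volume)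
    (ContinuousLinearMap.lsmul ℝ ℝ) hg.locallyIntegrable (ρ.contDiff_normed (μ := volume)) x
  unfold mollify
  rw [h.fderiv, convolution_precompR_apply]
  · rfl
  · exact hg.locallyIntegrable
  · exact ρ.hasCompactSupport_normed.fderiv ℝ
  · exact (ρ.contDiff_normed (n := 1)).continuous_fderiv one_ne_zero

theorem abs_mollify_le {n : ℕ} (ρ : ContDiffBump (0 : E n)) {g : E n → ℝ} {C : ℝ}
    (hC : ∀ x, |g x| ≤ C) (x : E n) : |mollify ρ g x| ≤ C := by
  have hint : Integrable (fun t => C * ρ.normed volume (x - t)) :=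
    (ρ.integrable_normed.comp_sub_left x).const_mul C
  have h1 : ∫ t, C * ρ.normed volume (x - t) = C := by
    rw [integral_const_mul, integral_sub_left_eq_self (fun t => ρ.normed volume t) volume x,
      ρ.integral_normed, mul_one]
  rw [← h1, mollify_apply, ← Real.norm_eq_abs]
  refine norm_integral_le_of_norm_le hint (Eventually.of_forall fun t => ?_)
  rw [norm_mul, Real.norm_eq_abs, Real.norm_eq_abs, abs_of_nonneg (ρ.nonneg_normed _)]
  gcongr
  · exact ρ.nonneg_normed _
  · exact hC t

theorem mollify_eq_zero {n : ℕ} (ρ : ContDiffBump (0 : E n)) {g : E n → ℝ} {R : ℝ}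
    (hR : ∀ x, R ≤ ‖x‖ → g x = 0) (hρ : ρ.rOut ≤ 1) {x : E n} (hx : R + 1 ≤ ‖x‖) :
    mollify ρ g x = 0 := by
  rw [mollify_apply]
  apply integral_eq_zero_of_ae
  refine Eventually.of_forall fun t => ?_
  by_cases ht : R ≤ ‖t‖
  · simp [hR t ht]
  · have : ρ.normed volume (x - t) = 0 := by
      by_contra h
      have h2 : x - t ∈ Function.support (ρ.normed volume) := h
      rw [ρ.support_normed_eq, mem_ball_zero_iff] at h2
      have := norm_sub_norm_le x t
      linarith
    simp [this]

theorem tendsto_mollify {n : ℕ} {ρ : ℕ → ContDiffBump (0 : E n)}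
    (hρ : Tendsto (fun k => (ρ k).rOut) atTop (𝓝 0)) {g : E n → ℝ} (hg : Continuous g) (x : E n) :
    Tendsto (fun k => mollify (ρ k) g x) atTop (𝓝 (g x)) := by
  simp_rw [mollify_eq]
  exact ContDiffBump.convolution_tendsto_right_of_continuous hρ hg x

theorem continuousLinearMap_apply_eq_sum {n : ℕ} (A : E n →L[ℝ] ℝ) (v : E n) :
    A v = ∑ i, A (e i) * v i := by
  conv_lhs => rw [← (EuclideanSpace.basisFun (Fin n) ℝ).sum_repr v]
  simp [map_sum, e, mul_comm]

theorem continuous_coord {n : ℕ} (i : Fin n) : Continuous fun x : E n => x i :=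
  (EuclideanSpace.proj i : E n →L[ℝ] ℝ).continuous

theorem hasCompactSupport_coord {n : ℕ} {F : E n → E n} (hc : HasCompactSupport F) (i : Fin n) :
    HasCompactSupport fun x => F x i :=
  hc.comp_left (g := fun v : E n => v i) rfl

/-- The product ρ(x - ·)F has integral of divergence zero, which moves the derivative from the bump
to F. Only the divergence of F gets integrated, never a single partial derivative, about whose
integrability nothing is known. -/
theorem sum_fderiv_mollify {d : ℕ} (ρ : ContDiffBump (0 : E (d + 1))) {F : E (d + 1) → E (d + 1)}
    (hF : Differentiable ℝ F) (hc : HasCompactSupport F) (hdiv : Continuous (divergence F))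
    (x : E (d + 1)) :
    ∑ i, fderiv ℝ (mollify ρ fun t => F t i) x (e i) = mollify ρ (divergence F) x := by
  have hρ : ContDiff ℝ 1 (ρ.normed volume) := ρ.contDiff_normed
  have hρ' : Continuous (fderiv ℝ (ρ.normed volume)) := hρ.continuous_fderiv one_ne_zero
  have hψ : ∀ t, HasFDerivAt (fun t => ρ.normed volume (x - t))
      (-(fderiv ℝ (ρ.normed volume) (x - t))) t := by
    intro t
    have := ((hρ.differentiable one_ne_zero) (x - t)).hasFDerivAt.comp t
      ((hasFDerivAt_id t).const_sub x)
    refine this.congr_fderiv ?_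
    ext v; simp
  have hdivψ : ∀ t, divergence (fun t => ρ.normed volume (x - t) • F t) t =
      divergence F t * ρ.normed volume (x - t)
        - ∑ i, F t i * fderiv ℝ (ρ.normed volume) (x - t) (e i) := by
    intro t
    rw [divergence_smul (hψ t).differentiableAt (hF t), (hψ t).fderiv,
      continuousLinearMap_apply_eq_sum]
    simp only [neg_apply, neg_mul, Finset.sum_neg_distrib]
    rw [mul_comm, ← sub_eq_add_neg]
    congr 1
    exact Finset.sum_congr rfl fun i _ => mul_comm _ _
  have hi1 : Integrable fun t => divergence F t * ρ.normed volume (x - t) := by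
    refine Continuous.integrable_of_hasCompactSupport ?_ (hasCompactSupport_divergence hc).mul_right
    exact hdiv.mul (hρ.continuous.comp (continuous_const.sub continuous_id))
  have hi2 : ∀ i, Integrable fun t => F t i * fderiv ℝ (ρ.normed volume) (x - t) (e i) := by
    intro i
    refine Continuous.integrable_of_hasCompactSupport ?_ (hasCompactSupport_coord hc i).mul_right
    refine ((continuous_coord i).comp hF.continuous).mul ?_
    exact (hρ'.comp (continuous_const.sub continuous_id)).clm_apply continuous_const
  have hd : Differentiable ℝ fun t => ρ.normed volume (x - t) • F t := fun t =>
    (hψ t).differentiableAt.fun_smul (hF t)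
  have hcs : HasCompactSupport fun t => ρ.normed volume (x - t) • F t :=
    HasCompactSupport.intro hc.isCompact fun t ht => by
      simp [image_eq_zero_of_notMem_tsupport ht]
  have hzero := integral_divergence_eq_zero hd hcs
    (by
      simp_rw [funext hdivψ]
      exact hi1.sub (integrable_finsetSum _ fun i _ => hi2 i))
  simp_rw [hdivψ] at hzero
  rw [integral_sub hi1 (integrable_finsetSum _ fun i _ => hi2 i),
    integral_finsetSum _ fun i _ => hi2 i] at hzero
  rw [mollify_apply, sub_eq_zero.1 hzero]
  refine Finset.sum_congr rfl fun i _ => ?_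
  exact fderiv_mollify ρ (g := fun t => F t i) ((continuous_coord i).comp hF.continuous) x (e i)

/-- Integration by parts of a differentiable, compactly supported vector field with continuous
divergence against a Lipschitz function. -/
theorem integral_mul_divergence {d : ℕ} {F : E (d + 1) → E (d + 1)} {H : E (d + 1) → ℝ} {C : ℝ≥0}
    (hH : LipschitzWith C H) (hF : Differentiable ℝ F) (hc : HasCompactSupport F)
    (hdiv : Continuous (divergence F)) :
    ∫ x, H x * divergence F x = -∫ x, fderiv ℝ H x (F x) := by
  -- The outer radii tend to 0 and stay at most 1, so all mollified functions live in one fixed ball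
  -- of radius R + 1.
  let ρ : ℕ → ContDiffBump (0 : E (d + 1)) := fun k =>
    ⟨1 / (2 * (k + 1)), 1 / (k + 1), by positivity, by
      rw [div_lt_div_iff₀ (by positivity) (by positivity)]
      have : (0 : ℝ) < k + 1 := by positivity
      linarith⟩
  have hρ0 : Tendsto (fun k => (ρ k).rOut) atTop (𝓝 0) := tendsto_one_div_add_atTop_nhds_zero_nat
  have hρ1 : ∀ k, (ρ k).rOut ≤ 1 := by
    intro k
    change 1 / ((k : ℝ) + 1) ≤ 1
    rw [div_le_one (by positivity)]
    simp
  have hFi : ∀ i, Continuous fun x => F x i := fun i => (continuous_coord i).comp hF.continuous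
  have hm : ∀ i, Measurable fun x => fderiv ℝ H x (e i) := fun i =>
    measurable_fderiv_apply_const ℝ H (e i)
  -- Mollified components are C¹ with compact support, so each can be integrated by parts against H
  -- separately; their partial derivatives recombine into the mollified divergence.
  have hstep : ∀ k, ∫ x, ∑ i, fderiv ℝ H x (e i) * mollify (ρ k) (fun t => F t i) x =
      -∫ x, H x * mollify (ρ k) (divergence F) x := by
    intro k
    have hcd : ∀ i, ContDiff ℝ 1 (mollify (ρ k) fun t => F t i) := fun i => contDiff_mollify _ (hFi i)
    have hcs : ∀ i, HasCompactSupport (mollify (ρ k) fun t => F t i) := fun i =>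
      hasCompactSupport_mollify _ (hasCompactSupport_coord hc i)
    have hint : ∀ i, Integrable fun x => fderiv ℝ H x (e i) * mollify (ρ k) (fun t => F t i) x := by
      intro i
      refine ((hcd i).continuous.integrable_of_hasCompactSupport (hcs i)).bdd_mul (c := C * ‖e i‖)
        (hm i).aestronglyMeasurable (Eventually.of_forall fun x => ?_)
      exact (ContinuousLinearMap.le_opNorm _ _).trans
        (mul_le_mul_of_nonneg_right (norm_fderiv_le_of_lipschitz ℝ hH) (norm_nonneg _))
    have hint' : ∀ i, Integrable fun x =>
        fderiv ℝ (mollify (ρ k) fun t => F t i) x (e i) * H x := by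
      intro i
      refine Continuous.integrable_of_hasCompactSupport ?_ ?_
      · exact (((hcd i).continuous_fderiv one_ne_zero).clm_apply continuous_const).mul hH.continuous
      · exact ((hcs i).fderiv_apply ℝ (e i)).mul_right
    have hi : ∀ i, ∫ x, fderiv ℝ H x (e i) * mollify (ρ k) (fun t => F t i) x =
        -∫ x, fderiv ℝ (mollify (ρ k) fun t => F t i) x (e i) * H x := by
      intro i
      obtain ⟨D, hD⟩ := (hcd i).lipschitzWith_of_hasCompactSupport (hcs i) one_ne_zero
      have h := hH.integral_lineDeriv_mul_eq (μ := volume) hD (hcs i) (e i)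
      rw [← integral_neg]
      refine Eq.trans ?_ (h.trans ?_)
      · refine integral_congr_ae ?_
        filter_upwards [hH.ae_differentiableAt (μ := volume)] with x hx
        rw [hx.lineDeriv_eq_fderiv]
      · refine integral_congr_ae (Eventually.of_forall fun x => ?_)
        simp only
        rw [(((hcd i).differentiable one_ne_zero) x).lineDeriv_eq_fderiv]
        simp
    rw [integral_finsetSum _ fun i _ => hint i, Finset.sum_congr rfl fun i _ => hi i,
      Finset.sum_neg_distrib, ← integral_finsetSum _ fun i _ => hint' i]
    congr 1
    refine integral_congr_ae (Eventually.of_forall fun x => ?_)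
    simp only
    rw [← Finset.sum_mul, sum_fderiv_mollify (ρ k) hF hc hdiv, mul_comm]
  obtain ⟨R, hR⟩ := hc.isCompact.isBounded.subset_ball 0
  have hR' : ∀ x : E (d + 1), R ≤ ‖x‖ → x ∉ tsupport F := by
    intro x hx h
    have := hR h
    simp at this
    linarith
  have hcpt : IsCompact (Metric.closedBall (0 : E (d + 1)) (R + 1)) := isCompact_closedBall _ _
  obtain ⟨A, hA⟩ := hF.continuous.bounded_above_of_compact_support hc
  obtain ⟨B, hB⟩ := hdiv.bounded_above_of_compact_support (hasCompactSupport_divergence hc)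
  have hlim1 : Tendsto (fun k => ∫ x, H x * mollify (ρ k) (divergence F) x) atTop
      (𝓝 (∫ x, H x * divergence F x)) := by
    refine tendsto_integral_of_dominated_convergence
      ((Metric.closedBall (0 : E (d + 1)) (R + 1)).indicator fun x => |H x| * B) ?_ ?_ ?_ ?_
    · intro k
      exact (hH.continuous.mul (contDiff_mollify _ hdiv).continuous).aestronglyMeasurable
    · rw [integrable_indicator_iff hcpt.measurableSet]
      exact (hH.continuous.abs.mul continuous_const).continuousOn.integrableOn_compact hcpt
    · intro k
      refine Eventually.of_forall fun x => ?_
      by_cases hx : x ∈ Metric.closedBall (0 : E (d + 1)) (R + 1)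
      · rw [indicator_of_mem hx, norm_mul, Real.norm_eq_abs, Real.norm_eq_abs]
        gcongr
        exact abs_mollify_le _ hB x
      · rw [indicator_of_notMem hx, mollify_eq_zero (R := R) _ _ (hρ1 k), mul_zero, norm_zero]
        · simp at hx; linarith
        · exact fun x hx => divergence_eq_zero_of_notMem_tsupport (hR' x hx)
    · exact Eventually.of_forall fun x => (tendsto_mollify hρ0 hdiv x).const_mul _
  have hlim2 : Tendsto (fun k => ∫ x, ∑ i, fderiv ℝ H x (e i) * mollify (ρ k) (fun t => F t i) x)
      atTop (𝓝 (∫ x, fderiv ℝ H x (F x))) := by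
    refine tendsto_integral_of_dominated_convergence
      ((Metric.closedBall (0 : E (d + 1)) (R + 1)).indicator
        fun x => ∑ i : Fin (d + 1), C * ‖(e i : E (d + 1))‖ * A) ?_ ?_ ?_ ?_
    · intro k
      refine (Finset.measurable_sum _ fun i _ => ?_).aestronglyMeasurable
      exact (hm i).mul (contDiff_mollify _ (hFi i)).continuous.measurable
    · rw [integrable_indicator_iff hcpt.measurableSet]
      exact continuous_const.continuousOn.integrableOn_compact hcpt
    · intro k
      refine Eventually.of_forall fun x => ?_
      by_cases hx : x ∈ Metric.closedBall (0 : E (d + 1)) (R + 1)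
      · rw [indicator_of_mem hx]
        refine (norm_sum_le _ _).trans (Finset.sum_le_sum fun i _ => ?_)
        rw [norm_mul]
        gcongr
        · exact (ContinuousLinearMap.le_opNorm _ _).trans
            (mul_le_mul_of_nonneg_right (norm_fderiv_le_of_lipschitz ℝ hH) (norm_nonneg _))
        · exact abs_mollify_le _ (fun y => (PiLp.norm_apply_le (F y) i).trans (hA y)) x
      · rw [indicator_of_notMem hx, Finset.sum_eq_zero, norm_zero]
        intro i _
        rw [mollify_eq_zero (R := R) _ _ (hρ1 k), mul_zero]
        · simp at hx; linarith
        · exact fun x hx => by simp [image_eq_zero_of_notMem_tsupport (hR' x hx)]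
    · refine Eventually.of_forall fun x => ?_
      rw [continuousLinearMap_apply_eq_sum]
      exact tendsto_finsetSum _ fun i _ => (tendsto_mollify hρ0 (hFi i) x).const_mul _
  simp_rw [hstep] at hlim2
  have := tendsto_nhds_unique hlim2 hlim1.neg
  rw [this, neg_neg]

end HyperCyl
end

/-! ### Area of Lipschitz graphs: comparison on small pieces. -/

noncomputable section
namespace HyperCyl
open Filter Topology
open scoped ENNReal RealInnerProductSpace

/-- Two measures can be compared on the pieces of a countable measurable cover. -/
theorem measure_le_of_countable_cover {α : Type*} [MeasurableSpace α] {μ ν : Measure α}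
    {κ : Type*} [Countable κ] [Nonempty κ] {s : κ → Set α} (hs : ∀ i, MeasurableSet (s i)) (hcov : ⋃ i, s i = univ)
    (h : ∀ i, ∀ A, MeasurableSet A → A ⊆ s i → μ A ≤ ν A) : μ ≤ ν := by
  obtain ⟨r, hr⟩ := exists_surjective_nat κ
  have hcov' : ⋃ i, (s ∘ r) i = univ := by rw [← hcov]; exact hr.iUnion_comp s
  refine Measure.le_iff.2 fun A hA => ?_
  have hA' : A = ⋃ i, A ∩ disjointed (s ∘ r) i := by
    rw [← inter_iUnion, iUnion_disjointed, hcov', inter_univ]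
  have hm : ∀ i, MeasurableSet (A ∩ disjointed (s ∘ r) i) := fun i =>
    hA.inter (.disjointed (fun i => hs (r i)) i)
  have hd : Pairwise (Function.onFun Disjoint fun i => A ∩ disjointed (s ∘ r) i) := fun i j hij =>
    (disjoint_disjointed (s ∘ r) hij).mono inter_subset_right inter_subset_right
  rw [hA', measure_iUnion hd hm, measure_iUnion hd hm]
  exact ENNReal.tsum_le_tsum fun i =>
    h (r i) _ (hm i) (inter_subset_right.trans (disjointed_subset (s ∘ r) i))

/-- The map `w ↦ ι w + φ(w) u` onto the graph of `φ`. -/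
def graphMap {d : ℕ} (ι : E d →ₗᵢ[ℝ] E (d + 1)) (u : E (d + 1)) (φ : E d → ℝ) (w : E d) :
    E (d + 1) := ι w + φ w • u

/-- The linear map whose graph is the tangent hyperplane with slope `A`. -/
def graphLinear {d : ℕ} (ι : E d →ₗᵢ[ℝ] E (d + 1)) (u : E (d + 1)) (A : E d →L[ℝ] ℝ) :
    E d →ₗ[ℝ] E (d + 1) := ι.toLinearMap + (A : E d →ₗ[ℝ] ℝ).smulRight u

/-- The area element `√(1 + ‖A‖²)`. -/
def areaFactor {d : ℕ} (A : E d →L[ℝ] ℝ) : ℝ := √(1 + ‖A‖ ^ 2)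

theorem one_le_areaFactor {d : ℕ} (A : E d →L[ℝ] ℝ) : 1 ≤ areaFactor A := by
  rw [areaFactor, Real.one_le_sqrt]
  nlinarith [sq_nonneg ‖A‖]

theorem areaFactor_sq {d : ℕ} (A : E d →L[ℝ] ℝ) : areaFactor A ^ 2 = 1 + ‖A‖ ^ 2 :=
  Real.sq_sqrt (by positivity)

theorem continuous_areaFactor {d : ℕ} : Continuous (areaFactor (d := d)) := by
  unfold areaFactor; fun_prop

/-- The area factor is 1-Lipschitz in the slope and at least 1, so an additive error δ is also a
relative one. -/
theorem areaFactor_le {d : ℕ} {A B : E d →L[ℝ] ℝ} {δ : ℝ} (hδ : 0 ≤ δ) (h : ‖A - B‖ ≤ δ) :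
    areaFactor A ≤ (1 + δ) * areaFactor B := by
  have h1 : ‖A‖ ≤ ‖B‖ + δ := by
    have := norm_sub_norm_le A B
    linarith
  have h2 := one_le_areaFactor B
  have h3 := areaFactor_sq B
  have h4 : ‖B‖ ≤ areaFactor B := by
    rw [areaFactor]; exact Real.le_sqrt_of_sq_le (by linarith)
  have h5 : areaFactor A ≤ areaFactor B + δ := by
    rw [areaFactor, Real.sqrt_le_left (by linarith)]
    nlinarith [norm_nonneg A, norm_nonneg B, mul_le_mul_of_nonneg_right h4 hδ]
  nlinarith

section Graph

variable {d : ℕ} {ι : E d →ₗᵢ[ℝ] E (d + 1)} {u : E (d + 1)}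

theorem norm_sq_add_smul (hu : ‖u‖ = 1) (hι : ∀ w, ⟪u, ι w⟫ = 0) (w : E d) (t : ℝ) :
    ‖ι w + t • u‖ ^ 2 = ‖w‖ ^ 2 + t ^ 2 := by
  have h : ⟪ι w, t • u⟫ = 0 := by rw [inner_smul_right, real_inner_comm, hι, mul_zero]
  rw [pow_two, norm_add_sq_eq_norm_sq_add_norm_sq_real h, norm_smul, hu, ι.norm_map,
    Real.norm_eq_abs, mul_one, abs_mul_abs_self]
  ring

/-- The Gram matrix of the images of the basis is 1 + a aᵀ with aᵢ = A eᵢ, a rank-one perturbation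
of the identity, whose determinant is 1 + |a|². -/
theorem normDet_graphLinear (hu : ‖u‖ = 1) (hι : ∀ w, ⟪u, ι w⟫ = 0) (A : E d →L[ℝ] ℝ) :
    (graphLinear ι u A).normDet = areaFactor A := by
  have hg : Matrix.gram ℝ (fun i => graphLinear ι u A (e i)) =
      1 + Matrix.replicateCol Unit (fun i => A (e i)) * Matrix.replicateRow Unit (fun i => A (e i)) := by
    ext i j
    have h2 : ∀ w, ⟪ι w, u⟫ = (0 : ℝ) := fun w => by rw [real_inner_comm]; exact hι w
    simp [Matrix.gram_apply, graphLinear, inner_add_left, inner_add_right, inner_smul_left,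
      inner_smul_right, h2, hι, Matrix.mul_apply, Matrix.one_apply, e,
      EuclideanSpace.inner_single_left, hu, mul_comm]
  have hA : ‖A‖ ^ 2 = ∑ i, A (e i) ^ 2 := by
    have h1 : ‖A‖ = ‖(InnerProductSpace.toDual ℝ (E d)).symm A‖ := by simp
    rw [h1, EuclideanSpace.norm_sq_eq]
    refine Finset.sum_congr rfl fun i _ => ?_
    rw [Real.norm_eq_abs, sq_abs]
    congr 1
    rw [← InnerProductSpace.toDual_symm_apply (x := e i), e, real_inner_comm,
      EuclideanSpace.inner_single_left]
    simp
  have h := LinearMap.normDet_sq_eq_det_gram (graphLinear ι u A) (EuclideanSpace.basisFun (Fin d) ℝ)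
  have h' : (graphLinear ι u A).normDet ^ 2 = areaFactor A ^ 2 := by
    rw [areaFactor_sq, hA]
    simp only [EuclideanSpace.basisFun_apply] at h
    refine h.trans ?_
    change (Matrix.gram ℝ (fun i => graphLinear ι u A (e i))).det = _
    rw [hg, Matrix.det_one_add_replicateCol_mul_replicateRow]
    simp [dotProduct, pow_two]
  exact (sq_eq_sq₀ (LinearMap.normDet_nonneg _)
    (zero_le_one.trans (one_le_areaFactor A))).1 h'

theorem norm_graphMap_sub_sq (hu : ‖u‖ = 1) (hι : ∀ w, ⟪u, ι w⟫ = 0) (φ : E d → ℝ) (a b : E d) :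
    ‖graphMap ι u φ a - graphMap ι u φ b‖ ^ 2 = ‖a - b‖ ^ 2 + (φ a - φ b) ^ 2 := by
  rw [← norm_sq_add_smul hu hι]
  congr 2
  simp only [graphMap, map_sub, sub_smul]
  abel

theorem norm_sub_le_norm_graphMap_sub (hu : ‖u‖ = 1) (hι : ∀ w, ⟪u, ι w⟫ = 0) (φ : E d → ℝ)
    (a b : E d) : ‖a - b‖ ≤ ‖graphMap ι u φ a - graphMap ι u φ b‖ := by
  have := norm_graphMap_sub_sq hu hι φ a b
  refine le_of_sq_le_sq ?_ (norm_nonneg _)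
  nlinarith [sq_nonneg (φ a - φ b)]

theorem injective_graphMap (hu : ‖u‖ = 1) (hι : ∀ w, ⟪u, ι w⟫ = 0) (φ : E d → ℝ) :
    Function.Injective (graphMap ι u φ) := by
  intro a b hab
  have := norm_sub_le_norm_graphMap_sub hu hι φ a b
  rw [hab, sub_self, norm_zero] at this
  exact sub_eq_zero.1 (norm_le_zero_iff.1 this)

theorem continuous_graphMap {φ : E d → ℝ} (hφ : Continuous φ) : Continuous (graphMap ι u φ) :=
  ι.continuous.add (hφ.smul continuous_const)

theorem measurableEmbedding_graphMap (hu : ‖u‖ = 1) (hι : ∀ w, ⟪u, ι w⟫ = 0) {φ : E d → ℝ}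
    (hφ : Continuous φ) : MeasurableEmbedding (graphMap ι u φ) :=
  (continuous_graphMap hφ).measurableEmbedding (injective_graphMap hu hι φ)

end Graph

/-- The map f ∘ g⁻¹ is K-Lipschitz from g(s) onto f(s). Used in both directions, this compares a
graph with its tangent plane. -/
theorem euclideanHausdorffMeasure_image_le {X Y Z : Type*} [MetricSpace Y] [MetricSpace Z]
    [MeasurableSpace Y] [BorelSpace Y] [MeasurableSpace Z] [BorelSpace Z]
    {f : X → Y} {g : X → Z} {s : Set X} {K : ℝ≥0} (hg : InjOn g s)
    (h : ∀ a ∈ s, ∀ b ∈ s, dist (f a) (f b) ≤ K * dist (g a) (g b)) (d : ℕ) :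
    Measure.euclideanHausdorffMeasure d (f '' s) ≤
      (K : ℝ≥0∞) ^ d * Measure.euclideanHausdorffMeasure d (g '' s) := by
  rcases s.eq_empty_or_nonempty with rfl | ⟨x₀, hx₀⟩
  · simp
  have : Nonempty X := ⟨x₀⟩
  have hinv : ∀ a ∈ s, Function.invFunOn g s (g a) = a := fun a ha => hg.leftInvOn_invFunOn ha
  have hL : LipschitzOnWith K (f ∘ Function.invFunOn g s) (g '' s) := by
    refine LipschitzOnWith.of_dist_le_mul ?_
    rintro _ ⟨a, ha, rfl⟩ _ ⟨b, hb, rfl⟩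
    simp only [Function.comp_apply, hinv a ha, hinv b hb]
    exact h a ha b hb
  have him : (f ∘ Function.invFunOn g s) '' (g '' s) = f '' s := by
    rw [image_image]
    exact image_congr fun a ha => by simp only [Function.comp_apply, hinv a ha]
  have := hL.hausdorffMeasure_image_le (d := (d : ℝ)) (by positivity)
  rw [him, ENNReal.rpow_natCast] at this
  simp only [Measure.euclideanHausdorffMeasure_def, Measure.smul_apply, ENNReal.smul_def,
    smul_eq_mul]
  rw [mul_left_comm]
  gcongr

section Graph

variable {d : ℕ} {ι : E d →ₗᵢ[ℝ] E (d + 1)} {u : E (d + 1)}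

theorem graphMap_sub_eq (φ : E d → ℝ) (A : E d →L[ℝ] ℝ) (a b : E d) :
    graphMap ι u φ a - graphMap ι u φ b =
      (graphLinear ι u A a - graphLinear ι u A b) + (φ a - φ b - A (a - b)) • u := by
  simp only [graphMap, graphLinear, LinearMap.add_apply, LinearMap.smulRight_apply, map_sub,
    sub_smul]
  simp
  abel

theorem graphLinear_eq_graphMap (A : E d →L[ℝ] ℝ) :
    (graphLinear ι u A : E d → E (d + 1)) = graphMap ι u A := rfl

/-- Over s the graph and the plane of slope A differ vertically by at most δ times the horizontal
distance, and distances along either surface dominate the horizontal one. So the correspondence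
between them is (1 + δ)-Lipschitz both ways. -/
theorem area_graph_of_approximatesLinearOn (hu : ‖u‖ = 1) (hι : ∀ w, ⟪u, ι w⟫ = 0) {φ : E d → ℝ}
    {A : E d →L[ℝ] ℝ} {δ : ℝ≥0} {s : Set (E d)} (h : ApproximatesLinearOn φ A s δ) :
    Measure.euclideanHausdorffMeasure d (graphMap ι u φ '' s) ≤
        ((1 + δ : ℝ≥0) : ℝ≥0∞) ^ d * (ENNReal.ofReal (areaFactor A) * volume s) ∧
      ENNReal.ofReal (areaFactor A) * volume s ≤
        ((1 + δ : ℝ≥0) : ℝ≥0∞) ^ d * Measure.euclideanHausdorffMeasure d (graphMap ι u φ '' s) := by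
  have hlin : Measure.euclideanHausdorffMeasure d (graphLinear ι u A '' s) =
      ENNReal.ofReal (areaFactor A) * volume s := by
    have := (graphLinear ι u A).euclideanHausdorffMeasure_image_eq_normDet_mul_volume s
    rw [normDet_graphLinear hu hι] at this
    simpa using this
  have hbound : ∀ a ∈ s, ∀ b ∈ s, ‖(φ a - φ b - A (a - b)) • u‖ ≤ δ * ‖a - b‖ := by
    intro a ha b hb
    rw [norm_smul, hu, mul_one]
    exact h a ha b hb
  rw [← hlin]
  constructor
  · refine euclideanHausdorffMeasure_image_le ?_ ?_ d
    · rw [graphLinear_eq_graphMap]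
      exact (injective_graphMap hu hι A).injOn
    · intro a ha b hb
      rw [dist_eq_norm, dist_eq_norm, graphMap_sub_eq φ A]
      have h1 := norm_sub_le_norm_graphMap_sub hu hι A a b
      rw [← graphLinear_eq_graphMap] at h1
      refine (norm_add_le _ _).trans ?_
      have h2 := hbound a ha b hb
      push_cast
      nlinarith [mul_le_mul_of_nonneg_left h1 δ.coe_nonneg]
  · refine euclideanHausdorffMeasure_image_le (injective_graphMap hu hι φ).injOn ?_ d
    intro a ha b hb
    rw [dist_eq_norm, dist_eq_norm]
    have h0 := graphMap_sub_eq (ι := ι) (u := u) φ A a b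
    rw [← sub_eq_iff_eq_add] at h0
    rw [← h0]
    have h1 := norm_sub_le_norm_graphMap_sub hu hι φ a b
    refine (norm_sub_le _ _).trans ?_
    have h2 := hbound a ha b hb
    push_cast
    nlinarith [mul_le_mul_of_nonneg_left h1 δ.coe_nonneg]

theorem lipschitz_graphMap (hu : ‖u‖ = 1) {φ : E d → ℝ} {C : ℝ≥0} (hφ : LipschitzWith C φ) :
    LipschitzWith (1 + C) (graphMap ι u φ) := by
  refine LipschitzWith.of_dist_le_mul fun a b => ?_
  have h0 : graphMap ι u φ a - graphMap ι u φ b = ι (a - b) + (φ a - φ b) • u := by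
    simp only [graphMap, map_sub, sub_smul]; abel
  rw [dist_eq_norm, dist_eq_norm, h0]
  refine (norm_add_le _ _).trans ?_
  rw [norm_smul, hu, mul_one, ι.norm_map]
  have := hφ.norm_sub_le a b
  push_cast
  linarith

end Graph

/-- The measure `√(1 + |∇φ|²) dw`, transported to the graph of `φ`. -/
def graphDensity {d : ℕ} (φ : E d → ℝ) : Measure (E d) :=
  volume.withDensity fun w => ENNReal.ofReal (areaFactor (fderiv ℝ φ w))

theorem measurable_areaFactor_fderiv {d : ℕ} (φ : E d → ℝ) :
    Measurable fun w => areaFactor (fderiv ℝ φ w) :=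
  continuous_areaFactor.measurable.comp (measurable_fderiv ℝ φ)

section Graph

variable {d : ℕ} {ι : E d →ₗᵢ[ℝ] E (d + 1)} {u : E (d + 1)}

/-- Of the exponent d + 1, d factors come from the Lipschitz comparison of d-dimensional measures
and one from replacing the fixed slope A by the derivative of φ at each point. -/
theorem area_graph_piece (hu : ‖u‖ = 1) (hι : ∀ w, ⟪u, ι w⟫ = 0) {φ : E d → ℝ}
    {A : E d →L[ℝ] ℝ} {δ : ℝ≥0} {s : Set (E d)} (hs : MeasurableSet s)
    (h : ApproximatesLinearOn φ A s δ) (hA : ∀ w ∈ s, ‖A - fderiv ℝ φ w‖ ≤ 2 * δ) :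
    Measure.euclideanHausdorffMeasure d (graphMap ι u φ '' s) ≤
        ((1 + 2 * δ : ℝ≥0) : ℝ≥0∞) ^ (d + 1) * graphDensity φ s ∧
      graphDensity φ s ≤ ((1 + 2 * δ : ℝ≥0) : ℝ≥0∞) ^ (d + 1) *
        Measure.euclideanHausdorffMeasure d (graphMap ι u φ '' s) := by
  have hmono : ((1 + δ : ℝ≥0) : ℝ≥0∞) ^ d ≤ ((1 + 2 * δ : ℝ≥0) : ℝ≥0∞) ^ d := by
    refine pow_le_pow_left' ?_ d
    norm_cast
    gcongr
    exact le_mul_of_one_le_left (by positivity) one_le_two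
  have hc : ((1 + 2 * δ : ℝ≥0) : ℝ≥0∞) = ENNReal.ofReal (1 + 2 * δ) := by
    rw [ENNReal.ofReal, Real.toNNReal_add zero_le_one (by positivity)]
    simp [Real.toNNReal_mul]
  have hδ : (0 : ℝ) ≤ 2 * δ := by positivity
  have hd : graphDensity φ s = ∫⁻ w in s, ENNReal.ofReal (areaFactor (fderiv ℝ φ w)) :=
    withDensity_apply _ hs
  have e1 : ENNReal.ofReal (areaFactor A) * volume s ≤
      ((1 + 2 * δ : ℝ≥0) : ℝ≥0∞) * graphDensity φ s := by
    rw [hd, ← lintegral_const_mul _ (measurable_areaFactor_fderiv φ).ennreal_ofReal,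
      ← setLIntegral_const]
    refine setLIntegral_mono' hs fun w hw => ?_
    rw [hc, ← ENNReal.ofReal_mul (by positivity)]
    exact ENNReal.ofReal_le_ofReal (areaFactor_le hδ (hA w hw))
  have e2 : graphDensity φ s ≤
      ((1 + 2 * δ : ℝ≥0) : ℝ≥0∞) * (ENNReal.ofReal (areaFactor A) * volume s) := by
    rw [hd, ← mul_assoc, ← setLIntegral_const]
    refine setLIntegral_mono' hs fun w hw => ?_
    rw [hc, ← ENNReal.ofReal_mul (by positivity)]
    exact ENNReal.ofReal_le_ofReal (areaFactor_le hδ (by rw [norm_sub_rev]; exact hA w hw))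
  obtain ⟨h1, h2⟩ := area_graph_of_approximatesLinearOn hu hι h
  constructor
  · refine h1.trans ((mul_le_mul' hmono e1).trans_eq ?_)
    rw [pow_succ, mul_assoc]
  · refine e2.trans ((mul_le_mul_right (h2.trans (mul_le_mul_left hmono _)) _).trans_eq ?_)
    rw [pow_succ', mul_assoc]

end Graph

end HyperCyl
end

/-! ### The area formula for Lipschitz graphs. -/

noncomputable section
namespace HyperCyl
open Filter Topology
open scoped ENNReal RealInnerProductSpace

section Graph

variable {d : ℕ} {ι : E d →ₗᵢ[ℝ] E (d + 1)} {u : E (d + 1)}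

/-- The differentiability set is first cut by closeness of the derivative to members of a dense
sequence, which bounds its oscillation on each piece by 2δ, and then by quality of linear
approximation. The approximating map is the derivative at some point of the same piece; nonemptiness
is required because on an empty piece the map is arbitrary. -/
theorem exists_cover_area_graph {φ : E d → ℝ} {δ : ℝ≥0} (hδ : 0 < δ) :
    ∃ s : ℕ × ℕ → Set (E d), (∀ i, MeasurableSet (s i)) ∧
      {w | DifferentiableAt ℝ φ w} ⊆ (⋃ i, s i) ∧
      ∀ i, ∀ B ⊆ s i, B.Nonempty → ∃ A : E d →L[ℝ] ℝ,
        ApproximatesLinearOn φ A B δ ∧ ∀ w ∈ B, ‖A - fderiv ℝ φ w‖ ≤ 2 * δ := by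
  let b : ℕ → (E d →L[ℝ] ℝ) := TopologicalSpace.denseSeq _
  let D : ℕ → Set (E d) := fun j =>
    {w | DifferentiableAt ℝ φ w} ∩ (fderiv ℝ φ) ⁻¹' Metric.ball (b j) δ
  have hDm : ∀ j, MeasurableSet (D j) := fun j =>
    (measurableSet_of_differentiableAt ℝ φ).inter (measurable_fderiv ℝ φ measurableSet_ball)
  have hpart : ∀ j, ∃ (t : ℕ → Set (E d)) (A : ℕ → E d →L[ℝ] ℝ),
      (∀ n, MeasurableSet (t n)) ∧ (D j ⊆ ⋃ n, t n) ∧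
      (∀ n, ApproximatesLinearOn φ (A n) (D j ∩ t n) δ) ∧
      ((D j).Nonempty → ∀ n, ∃ y ∈ D j, A n = fderiv ℝ φ y) := by
    intro j
    obtain ⟨t, A, -, h1, h2, h3, h4⟩ :=
      exists_partition_approximatesLinearOn_of_hasFDerivWithinAt φ (D j) (fderiv ℝ φ)
        (fun w hw => hw.1.hasFDerivAt.hasFDerivWithinAt) (fun _ => δ) (fun _ => hδ.ne')
    exact ⟨t, A, h1, h2, h3, h4⟩
  choose t A h1 h2 h3 h4 using hpart
  refine ⟨fun i => D i.1 ∩ t i.1 i.2, fun i => (hDm i.1).inter (h1 i.1 i.2), ?_, ?_⟩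
  · intro w hw
    obtain ⟨j, hj⟩ := (TopologicalSpace.denseRange_denseSeq (E d →L[ℝ] ℝ)).exists_dist_lt
      (fderiv ℝ φ w) (ε := δ) (by exact_mod_cast hδ)
    have hwj : w ∈ D j := ⟨hw, hj⟩
    obtain ⟨n, hn⟩ := mem_iUnion.1 (h2 j hwj)
    exact mem_iUnion.2 ⟨(j, n), hwj, hn⟩
  · rintro ⟨j, n⟩ B hB ⟨w₀, hw₀⟩
    refine ⟨A j n, (h3 j n).mono_set hB, fun w hw => ?_⟩
    obtain ⟨y, hy, hA⟩ := h4 j ⟨w₀, (hB hw₀).1⟩ n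
    have e1 : dist (fderiv ℝ φ y) (b j) < δ := hy.2
    have e2 : dist (fderiv ℝ φ w) (b j) < δ := (hB hw).1.2
    rw [hA, ← dist_eq_norm]
    have := dist_triangle_right (fderiv ℝ φ y) (fderiv ℝ φ w) (b j)
    linarith

/-- The area formula for the graph of a Lipschitz function. -/
theorem comap_graphMap_euclideanHausdorffMeasure (hu : ‖u‖ = 1) (hι : ∀ w, ⟪u, ι w⟫ = 0)
    {φ : E d → ℝ} {C : ℝ≥0} (hφ : LipschitzWith C φ) :
    (Measure.euclideanHausdorffMeasure d).comap (graphMap ι u φ) = graphDensity φ := by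
  have hemb := measurableEmbedding_graphMap hu hι hφ.continuous
  have hN : volume {w | ¬ DifferentiableAt ℝ φ w} = 0 := hφ.ae_differentiableAt
  -- The disjunction lets one argument give both inequalities, since the estimate on pieces is
  -- symmetric in the two measures.
  have hmain : ∀ δ : ℝ≥0, 0 < δ → ∀ μ ν : Measure (E d),
      (μ = (Measure.euclideanHausdorffMeasure d).comap (graphMap ι u φ) ∧ ν = graphDensity φ) ∨
      (ν = (Measure.euclideanHausdorffMeasure d).comap (graphMap ι u φ) ∧ μ = graphDensity φ) →
      μ ≤ (((1 + 2 * δ : ℝ≥0) : ℝ≥0∞) ^ (d + 1)) • ν := by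
    intro δ hδ μ ν hμν
    obtain ⟨s, hs, hcov, happ⟩ := exists_cover_area_graph (φ := φ) hδ
    refine measure_le_of_countable_cover (κ := Option (ℕ × ℕ))
      (s := fun i => i.elim {w | ¬ DifferentiableAt ℝ φ w} s) ?_ ?_ ?_
    · rintro (_ | i)
      · exact (measurableSet_of_differentiableAt ℝ φ).compl
      · exact hs i
    · rw [eq_univ_iff_forall]
      intro w
      by_cases hw : DifferentiableAt ℝ φ w
      · obtain ⟨i, hi⟩ := mem_iUnion.1 (hcov hw)
        exact mem_iUnion.2 ⟨some i, hi⟩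
      · exact mem_iUnion.2 ⟨none, hw⟩
    · rintro (_ | i) B hB hBs
      · have hv : volume B = 0 := measure_mono_null hBs hN
        have h1 : graphDensity φ B = 0 := withDensity_absolutelyContinuous _ _ hv
        have h2 : (Measure.euclideanHausdorffMeasure d).comap (graphMap ι u φ) B = 0 := by
          rw [hemb.comap_apply]
          have := euclideanHausdorffMeasure_image_le (f := graphMap ι u φ) (g := id) (s := B)
            (K := 1 + C) (injOn_id B)
            (fun a _ b _ => (lipschitz_graphMap hu hφ).dist_le_mul a b) d
          rw [image_id, EuclideanSpace.euclideanHausdorffMeasure_eq_volume, hv, mul_zero] at this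
          exact le_antisymm this (zero_le)
        rcases hμν with ⟨rfl, rfl⟩ | ⟨rfl, rfl⟩
        · rw [h2]; exact zero_le
        · rw [h1]; exact zero_le
      · rcases B.eq_empty_or_nonempty with rfl | hne
        · simp
        obtain ⟨A, hA1, hA2⟩ := happ i B hBs hne
        obtain ⟨k1, k2⟩ := area_graph_piece hu hι hB hA1 hA2
        rcases hμν with ⟨rfl, rfl⟩ | ⟨rfl, rfl⟩
        · rw [Measure.smul_apply, hemb.comap_apply]; exact k1
        · rw [Measure.smul_apply, hemb.comap_apply]; exact k2
  have hlim : ∀ x : ℝ≥0∞, Tendsto (fun δ : ℝ≥0 => ((1 + 2 * δ : ℝ≥0) : ℝ≥0∞) ^ (d + 1) * x)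
      (𝓝[>] 0) (𝓝 x) := by
    intro x
    have h1 : Tendsto (fun δ : ℝ≥0 => (1 + 2 * δ) ^ (d + 1)) (𝓝 0) (𝓝 1) := by
      have : Continuous fun δ : ℝ≥0 => (1 + 2 * δ) ^ (d + 1) := by fun_prop
      simpa using this.tendsto 0
    have h2 : Tendsto (fun δ : ℝ≥0 => (((1 + 2 * δ) ^ (d + 1) : ℝ≥0) : ℝ≥0∞)) (𝓝 0) (𝓝 1) :=
      ENNReal.tendsto_coe.2 h1
    have h3 := ENNReal.Tendsto.mul_const (b := x) (h2.mono_left (nhdsWithin_le_nhds (s := Ioi 0)))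
      (Or.inl one_ne_zero)
    simpa using h3
  have hfin : ∀ μ ν : Measure (E d),
      (∀ δ : ℝ≥0, 0 < δ → μ ≤ (((1 + 2 * δ : ℝ≥0) : ℝ≥0∞) ^ (d + 1)) • ν) → μ ≤ ν := by
    intro μ ν h
    refine Measure.le_iff.2 fun A _ => ?_
    refine ge_of_tendsto (hlim (ν A)) ?_
    filter_upwards [self_mem_nhdsWithin] with δ hδ
    exact h δ hδ A
  exact le_antisymm (hfin _ _ fun δ hδ => hmain δ hδ _ _ (Or.inl ⟨rfl, rfl⟩))
    (hfin _ _ fun δ hδ => hmain δ hδ _ _ (Or.inr ⟨rfl, rfl⟩))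

theorem restrict_range_graphMap (hu : ‖u‖ = 1) (hι : ∀ w, ⟪u, ι w⟫ = 0)
    {φ : E d → ℝ} {C : ℝ≥0} (hφ : LipschitzWith C φ) :
    (Measure.euclideanHausdorffMeasure d).restrict (range (graphMap ι u φ)) =
      (graphDensity φ).map (graphMap ι u φ) := by
  have hemb := measurableEmbedding_graphMap hu hι hφ.continuous
  rw [← comap_graphMap_euclideanHausdorffMeasure hu hι hφ, hemb.map_comap]

end Graph

end HyperCyl
end

/-! ### Orthonormal graph coordinates, outer normals and Lipschitz charts. -/

noncomputable section
namespace HyperCyl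
open Filter Topology
open scoped ENNReal RealInnerProductSpace

/-- The coordinates along the hyperplane `ι(ℝᵈ)`. -/
def graphProj {d : ℕ} (ι : E d →ₗᵢ[ℝ] E (d + 1)) : E (d + 1) →L[ℝ] E d :=
  ι.toContinuousLinearMap.adjoint

/-- The unit normal to the graph pointing below it, where the slope is `A`. -/
def graphNormal {d : ℕ} (ι : E d →ₗᵢ[ℝ] E (d + 1)) (u : E (d + 1)) (A : E d →L[ℝ] ℝ) :
    E (d + 1) := (areaFactor A)⁻¹ • (ι ((InnerProductSpace.toDual ℝ (E d)).symm A) - u)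

theorem continuous_graphNormal {d : ℕ} (ι : E d →ₗᵢ[ℝ] E (d + 1)) (u : E (d + 1)) :
    Continuous (graphNormal ι u) := by
  have h : ∀ A : E d →L[ℝ] ℝ, areaFactor A ≠ 0 := fun A =>
    (zero_lt_one.trans_le (one_le_areaFactor A)).ne'
  exact (continuous_areaFactor.inv₀ h).smul ((ι.continuous.comp
    (InnerProductSpace.toDual ℝ (E d)).symm.continuous).sub continuous_const)

section Chart

variable {d : ℕ} {ι : E d →ₗᵢ[ℝ] E (d + 1)} {u : E (d + 1)}

theorem graphProj_add_smul (hι : ∀ w, ⟪u, ι w⟫ = 0) (w : E d) (t : ℝ) :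
    graphProj ι (ι w + t • u) = w := by
  refine ext_inner_right ℝ fun v => ?_
  rw [graphProj, ContinuousLinearMap.adjoint_inner_left, inner_add_left, inner_smul_left]
  simp [hι, ι.inner_map_map]

theorem inner_add_smul_graph (hu : ‖u‖ = 1) (hι : ∀ w, ⟪u, ι w⟫ = 0) (w : E d) (t : ℝ) :
    ⟪u, ι w + t • u⟫ = t := by
  rw [inner_add_right, hι, inner_smul_right, real_inner_self_eq_norm_sq, hu]; ring

theorem inner_graphProj (w : E d) (x : E (d + 1)) : ⟪w, graphProj ι x⟫ = ⟪ι w, x⟫ := by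
  rw [graphProj, ContinuousLinearMap.adjoint_inner_right]; rfl

theorem exists_linearIsometryEquiv_graph (hu : ‖u‖ = 1) (hι : ∀ w, ⟪u, ι w⟫ = 0) :
    ∃ T : WithLp 2 (E d × ℝ) ≃ₗᵢ[ℝ] E (d + 1), ∀ w t, T (WithLp.toLp 2 (w, t)) = ι w + t • u := by
  let L : WithLp 2 (E d × ℝ) →ₗ[ℝ] E (d + 1) :=
    (ι.toLinearMap.coprod (LinearMap.toSpanSingleton ℝ _ u)) ∘ₗ
      (WithLp.linearEquiv 2 ℝ (E d × ℝ)).toLinearMap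
  have hL : ∀ p, ‖L p‖ = ‖p‖ := by
    intro p
    have h1 : ‖L p‖ ^ 2 = ‖p‖ ^ 2 := by
      have : L p = ι p.fst + p.snd • u := rfl
      rw [this, norm_sq_add_smul hu hι, WithLp.prod_norm_sq_eq_of_L2]
      simp
    exact (sq_eq_sq₀ (norm_nonneg _) (norm_nonneg _)).1 h1
  let li : WithLp 2 (E d × ℝ) →ₗᵢ[ℝ] E (d + 1) := ⟨L, hL⟩
  refine ⟨li.toLinearIsometryEquiv ?_, fun w t => rfl⟩
  rw [(WithLp.linearEquiv 2 ℝ (E d × ℝ)).finrank_eq]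
  simp

theorem graph_decomp (hu : ‖u‖ = 1) (hι : ∀ w, ⟪u, ι w⟫ = 0) (x : E (d + 1)) :
    ι (graphProj ι x) + ⟪u, x⟫ • u = x := by
  obtain ⟨T, hT⟩ := exists_linearIsometryEquiv_graph hu hι
  obtain ⟨p, rfl⟩ := T.surjective x
  obtain ⟨w, t, rfl⟩ : ∃ w t, p = WithLp.toLp 2 (w, t) := ⟨p.fst, p.snd, rfl⟩
  rw [hT, graphProj_add_smul hι, inner_add_smul_graph hu hι]

theorem measurePreserving_graph (hu : ‖u‖ = 1) (hι : ∀ w, ⟪u, ι w⟫ = 0) :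
    MeasurePreserving (fun p : E d × ℝ => ι p.1 + p.2 • u) := by
  obtain ⟨T, hT⟩ := exists_linearIsometryEquiv_graph hu hι
  have := T.measurePreserving.comp (WithLp.volume_preserving_toLp (E d) ℝ)
  convert this using 1
  ext1 p
  exact (hT p.1 p.2).symm

theorem measurableEmbedding_graph (hu : ‖u‖ = 1) (hι : ∀ w, ⟪u, ι w⟫ = 0) :
    MeasurableEmbedding (fun p : E d × ℝ => ι p.1 + p.2 • u) := by
  refine Continuous.measurableEmbedding (by fun_prop) fun p q h => ?_
  have h1 := congrArg (graphProj ι) h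
  have h2 := congrArg (fun x => ⟪u, x⟫) h
  simp only [graphProj_add_smul hι, inner_add_smul_graph hu hι] at h1 h2
  exact Prod.ext h1 h2

/-- The area factor cancels the normalisation of the normal. The product of surface density and
normal component is thus linear in the slope, and equals minus the flux that appears when the graph
is approximated by layers. -/
theorem areaFactor_mul_inner_graphNormal (A : E d →L[ℝ] ℝ) (x : E (d + 1)) :
    areaFactor A * ⟪x, graphNormal ι u A⟫ = A (graphProj ι x) - ⟪u, x⟫ := by
  have h : areaFactor A ≠ 0 := (zero_lt_one.trans_le (one_le_areaFactor A)).ne'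
  rw [graphNormal, inner_smul_right, mul_inv_cancel_left₀ h, inner_sub_right, real_inner_comm,
    ← inner_graphProj, InnerProductSpace.toDual_symm_apply, real_inner_comm]

theorem norm_graphNormal (hu : ‖u‖ = 1) (hι : ∀ w, ⟪u, ι w⟫ = 0) (A : E d →L[ℝ] ℝ) :
    ‖graphNormal ι u A‖ = 1 := by
  have h1 := one_le_areaFactor A
  have h : ‖ι ((InnerProductSpace.toDual ℝ (E d)).symm A) - u‖ ^ 2 = areaFactor A ^ 2 := by
    have := norm_sq_add_smul hu hι ((InnerProductSpace.toDual ℝ (E d)).symm A) (-1)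
    rw [neg_one_smul, ← sub_eq_add_neg, LinearIsometryEquiv.norm_map] at this
    rw [this, areaFactor_sq]; ring
  have h' := (sq_eq_sq₀ (norm_nonneg _) (by linarith)).1 h
  rw [graphNormal, norm_smul, h', norm_inv, Real.norm_eq_abs, abs_of_pos (by linarith)]
  exact inv_mul_cancel₀ (by linarith)

/-- Near the centre of the chart, `K` is the region above the graph of `φ`. -/
theorem isOuterNormal_graphNormal (hu : ‖u‖ = 1) (hι : ∀ w, ⟪u, ι w⟫ = 0) {K : Set (E (d + 1))}
    {φ : E d → ℝ} {c : E (d + 1)} {r : ℝ}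
    (hK : ∀ x ∈ Metric.ball c r, x ∈ K ↔ φ (graphProj ι x) < ⟪u, x⟫) {w : E d}
    (hφ : DifferentiableAt ℝ φ w) (hw : graphMap ι u φ w ∈ Metric.ball c r) :
    IsOuterNormal K (graphMap ι u φ w) (graphNormal ι u (fderiv ℝ φ w)) := by
  refine ⟨norm_graphNormal hu hι _, fun ε hε => ?_⟩
  have hlittle := hφ.hasFDerivAt.isLittleO
  have hlit2 : ∀ᶠ v in 𝓝 w, ‖φ v - φ w - fderiv ℝ φ w (v - w)‖ ≤ ε * ‖v - w‖ :=
    hlittle.def hε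
  set x := graphMap ι u φ w with hx
  have hpx : graphProj ι x = w := graphProj_add_smul hι _ _
  have hux : ⟪u, x⟫ = φ w := inner_add_smul_graph hu hι _ _
  have hev : ∀ᶠ z in 𝓝 x, z ∈ Metric.ball c r ∧
      ‖φ (graphProj ι z) - φ w - fderiv ℝ φ w (graphProj ι z - w)‖ ≤ ε * ‖graphProj ι z - w‖ := by
    refine Filter.Eventually.and (Metric.isOpen_ball.mem_nhds hw) ?_
    have : Tendsto (graphProj ι) (𝓝 x) (𝓝 w) := by
      have := (graphProj ι).continuous.tendsto x
      rwa [hpx] at this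
    exact this.eventually hlit2
  obtain ⟨δ, hδ, hball⟩ := Metric.eventually_nhds_iff.1 hev
  refine ⟨δ, hδ, fun z hz => ?_⟩
  obtain ⟨hzB, hzo⟩ := hball (by rwa [dist_eq_norm])
  rw [hK z hzB]
  have hpz : graphProj ι z - w = graphProj ι (z - x) := by rw [map_sub, hpx]
  rw [hpz] at hzo
  have hle : ‖graphProj ι (z - x)‖ ≤ ‖z - x‖ := by
    have h1 := graph_decomp hu hι (z - x)
    have h2 := norm_sq_add_smul hu hι (graphProj ι (z - x)) ⟪u, z - x⟫
    rw [h1] at h2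
    refine le_of_sq_le_sq ?_ (norm_nonneg _)
    nlinarith [sq_nonneg ⟪u, z - x⟫]
  have hJ := areaFactor_mul_inner_graphNormal (ι := ι) (u := u) (fderiv ℝ φ w) (z - x)
  have hJ1 := one_le_areaFactor (fderiv ℝ φ w)
  rw [inner_sub_right, hux] at hJ
  -- The first-order error of φ is at most ε‖z - x‖. Since the area factor is at least 1, the cone
  -- inequality multiplied by that factor absorbs it.
  have hzo' := abs_le.1 (hzo.trans (mul_le_mul_of_nonneg_left hle hε.le))
  have hnn : 0 ≤ ε * ‖z - x‖ := by positivity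
  constructor
  · intro h
    nlinarith [mul_nonneg (sub_nonneg.2 hJ1) hnn, hzo'.2,
      mul_lt_mul_of_pos_left h (zero_lt_one.trans_le hJ1)]
  · intro h
    rw [not_lt]
    nlinarith [mul_nonneg (sub_nonneg.2 hJ1) hnn, hzo'.1,
      mul_lt_mul_of_pos_left h (zero_lt_one.trans_le hJ1)]

end Chart

/-- Moving from x in the direction ν' - ν enters the inner cone of ν and the outer cone of ν' at
once, which is contradictory when ν ≠ ν'. So the choice inside `outerNormal` is immaterial. -/
theorem IsOuterNormal.unique {n : ℕ} {K : Set (E n)} {x ν ν' : E n} (h : IsOuterNormal K x ν)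
    (h' : IsOuterNormal K x ν') : ν = ν' := by
  by_contra hne
  have hc : ⟪ν, ν'⟫ < (1 : ℝ) := inner_lt_one_iff_real_of_norm_eq_one h.1 h'.1 |>.2 hne
  set c : ℝ := ⟪ν, ν'⟫ with hcdef
  -- As ‖ν' - ν‖ ≤ 2, this aperture gives the threshold at most t(1 - c)/2, below the inner product
  -- t(1 - c).
  obtain ⟨δ, hδ, H⟩ := h.2 ((1 - c) / 4) (by linarith)
  obtain ⟨δ', hδ', H'⟩ := h'.2 ((1 - c) / 4) (by linarith)
  set t := min δ δ' / 4 with ht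
  have htpos : 0 < t := by have := lt_min hδ hδ'; positivity
  have hnorm : ‖ν' - ν‖ ≤ 2 := by
    refine (norm_sub_le _ _).trans ?_
    rw [h.1, h'.1]; norm_num
  have hz : x + t • (ν' - ν) - x = t • (ν' - ν) := by abel
  have hzn : ‖t • (ν' - ν)‖ ≤ 2 * t := by
    rw [norm_smul, Real.norm_eq_abs, abs_of_pos htpos]; nlinarith
  have hm : 2 * t < min δ δ' := by
    have := lt_min hδ hδ'
    rw [ht]; linarith
  have e1 : ⟪t • (ν' - ν), ν⟫ = -(t * (1 - c)) := by
    rw [inner_smul_left, inner_sub_left, real_inner_self_eq_norm_sq, h.1, real_inner_comm]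
    simp [← hcdef]; ring
  have e2 : ⟪t • (ν' - ν), ν'⟫ = t * (1 - c) := by
    rw [inner_smul_left, inner_sub_left, real_inner_self_eq_norm_sq, h'.1]
    simp [← hcdef]
  have hp : 0 < t * (1 - c) := mul_pos htpos (by linarith)
  have hq : (1 - c) / 4 * ‖t • (ν' - ν)‖ < t * (1 - c) := by
    have := mul_le_mul_of_nonneg_left hzn (by linarith : 0 ≤ (1 - c) / 4)
    nlinarith
  have k1 := (H (x + t • (ν' - ν)) (by rw [hz]; exact hzn.trans_lt (hm.trans_le (min_le_left _ _)))).1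
    (by rw [hz, e1]; linarith)
  have k2 := (H' (x + t • (ν' - ν)) (by rw [hz]; exact hzn.trans_lt (hm.trans_le (min_le_right _ _)))).2
    (by rw [hz, e2]; linarith)
  exact k2 k1

theorem IsOuterNormal.outerNormal_eq {n : ℕ} {K : Set (E n)} {x ν : E n}
    (h : IsOuterNormal K x ν) : outerNormal K x = ν := by
  have hex : ∃ ν, IsOuterNormal K x ν := ⟨ν, h⟩
  rw [outerNormal, dif_pos hex]
  exact hex.choose_spec.unique h

theorem norm_outerNormal_le {n : ℕ} (K : Set (E n)) (x : E n) : ‖outerNormal K x‖ ≤ 1 := by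
  rw [outerNormal]
  split_ifs with h
  · exact h.choose_spec.1.le
  · simp

/-- A Lipschitz chart in product coordinates. -/
structure LipschitzChart {d : ℕ} (K : Set (E (d + 1))) (c : E (d + 1)) where
  ι : E d →ₗᵢ[ℝ] E (d + 1)
  u : E (d + 1)
  φ : E d → ℝ
  C : ℝ≥0
  r : ℝ
  norm_u : ‖u‖ = 1
  inner_ι : ∀ w, ⟪u, ι w⟫ = 0
  lip : LipschitzWith C φ
  pos : 0 < r
  mem_iff : ∀ x ∈ Metric.ball c r, x ∈ K ↔ φ (graphProj ι x) < ⟪u, x⟫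

theorem HasLipschitzBoundary.exists_chart {d : ℕ} {K : Set (E (d + 1))}
    (hK : HasLipschitzBoundary K) {c : E (d + 1)} (hc : c ∈ frontier K) :
    Nonempty (LipschitzChart K c) := by
  obtain ⟨u, C, φ, r, hu, hφ, hr, h⟩ := hK c hc
  have hu0 : u ≠ 0 := by rintro rfl; simp at hu
  have : Fact (Module.finrank ℝ (E (d + 1)) = d + 1) := ⟨by simp⟩
  have hfin : Module.finrank ℝ (ℝ ∙ u)ᗮ = d :=
    Submodule.finrank_orthogonal_span_singleton (n := d) hu0
  let T : E d ≃ₗᵢ[ℝ] (ℝ ∙ u)ᗮ :=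
    ((stdOrthonormalBasis ℝ (ℝ ∙ u)ᗮ).reindex (finCongr hfin)).repr.symm
  let ι : E d →ₗᵢ[ℝ] E (d + 1) := ((ℝ ∙ u)ᗮ).subtypeₗᵢ.comp T.toLinearIsometry
  have hι : ∀ w, ⟪u, ι w⟫ = 0 := fun w =>
    Submodule.mem_orthogonal_singleton_iff_inner_right.1 (T w).2
  refine ⟨⟨ι, u, φ ∘ T, C * 1, r, hu, hι, hφ.comp T.lipschitz, hr, fun x hx => ?_⟩⟩
  rw [h x hx]
  have : (ℝ ∙ u)ᗮ.orthogonalProjectionOnto x = T (graphProj ι x) := by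
    conv_lhs => rw [← graph_decomp hu hι x]
    rw [map_add, map_smul, Submodule.orthogonalProjectionOnto_orthogonalComplement_singleton_eq_zero,
      smul_zero, add_zero]
    exact Submodule.orthogonalProjectionOnto_mem_subspace_eq_self (T (graphProj ι x))
  rw [this]
  rfl

end HyperCyl
end

/-! ### The divergence theorem above a Lipschitz graph. -/

noncomputable section
namespace HyperCyl
open Filter Topology
open scoped ENNReal RealInnerProductSpace

theorem continuous_deriv_smoothTransition : Continuous (deriv Real.smoothTransition) :=
  (Real.smoothTransition.contDiff (n := 1)).continuous_deriv le_rfl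

theorem hasDerivAt_smoothTransition (s : ℝ) :
    HasDerivAt Real.smoothTransition (deriv Real.smoothTransition s) s :=
  ((Real.smoothTransition.contDiff (n := 1)).differentiable one_ne_zero s).hasDerivAt

theorem deriv_smoothTransition_eq_zero {s : ℝ} (hs : s ∉ Icc (0 : ℝ) 1) :
    deriv Real.smoothTransition s = 0 := by
  rw [mem_Icc, not_and_or, not_le, not_le] at hs
  rcases hs with hs | hs
  · have : Real.smoothTransition =ᶠ[𝓝 s] fun _ => 0 := by
      filter_upwards [Iio_mem_nhds hs] with t ht using Real.smoothTransition.zero_of_nonpos ht.le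
    rw [this.deriv_eq]; simp
  · have : Real.smoothTransition =ᶠ[𝓝 s] fun _ => 1 := by
      filter_upwards [Ioi_mem_nhds hs] with t ht using Real.smoothTransition.one_of_one_le ht.le
    rw [this.deriv_eq]; simp

theorem hasCompactSupport_deriv_smoothTransition :
    HasCompactSupport (deriv Real.smoothTransition) :=
  HasCompactSupport.intro isCompact_Icc fun _ hs => deriv_smoothTransition_eq_zero hs

theorem integrable_deriv_smoothTransition : Integrable (deriv Real.smoothTransition) :=
  continuous_deriv_smoothTransition.integrable_of_hasCompactSupport
    hasCompactSupport_deriv_smoothTransition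

theorem integral_deriv_smoothTransition : ∫ s, deriv Real.smoothTransition s = 1 := by
  have h := integral_of_hasDerivAt_of_tendsto (f := Real.smoothTransition) (m := 0) (n := 1)
    hasDerivAt_smoothTransition integrable_deriv_smoothTransition
    (tendsto_const_nhds.congr' ?_) (tendsto_const_nhds.congr' ?_)
  · rw [h]; norm_num
  · filter_upwards [eventually_le_atBot (0 : ℝ)] with t ht
    exact (Real.smoothTransition.zero_of_nonpos ht).symm
  · filter_upwards [eventually_ge_atTop (1 : ℝ)] with t ht
    exact (Real.smoothTransition.one_of_one_le ht).symm

theorem exists_lipschitzWith_smoothTransition : ∃ D : ℝ≥0, LipschitzWith D Real.smoothTransition := by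
  obtain ⟨D, hD⟩ := continuous_deriv_smoothTransition.bounded_above_of_compact_support
    hasCompactSupport_deriv_smoothTransition
  refine ⟨.mk (max D 0) (le_max_right _ _), lipschitzWith_of_nnnorm_deriv_le
    ((Real.smoothTransition.contDiff (n := 1)).differentiable one_ne_zero) fun s => ?_⟩
  rw [← NNReal.coe_le_coe]
  exact (hD s).trans (le_max_left _ _)

section Chart

variable {d : ℕ} {ι : E d →ₗᵢ[ℝ] E (d + 1)} {u : E (d + 1)}

/-- The height of `x` above the graph of `φ`. -/
def graphHeight (ι : E d →ₗᵢ[ℝ] E (d + 1)) (u : E (d + 1)) (φ : E d → ℝ) (x : E (d + 1)) : ℝ :=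
  ⟪u, x⟫ - φ (graphProj ι x)

theorem graphHeight_add_smul (hu : ‖u‖ = 1) (hι : ∀ w, ⟪u, ι w⟫ = 0) (φ : E d → ℝ) (w : E d)
    (t : ℝ) : graphHeight ι u φ (ι w + t • u) = t - φ w := by
  rw [graphHeight, graphProj_add_smul hι, inner_add_smul_graph hu hι]

theorem exists_lipschitzWith_graphHeight {φ : E d → ℝ} {C : ℝ≥0} (hφ : LipschitzWith C φ) :
    ∃ D : ℝ≥0, LipschitzWith D (graphHeight ι u φ) :=
  ⟨_, (innerSL ℝ u).lipschitz.sub (hφ.comp (graphProj ι).lipschitz)⟩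

theorem hasFDerivAt_graphHeight {φ : E d → ℝ} {x : E (d + 1)}
    (hφ : DifferentiableAt ℝ φ (graphProj ι x)) :
    HasFDerivAt (graphHeight ι u φ)
      (innerSL ℝ u - (fderiv ℝ φ (graphProj ι x)).comp (graphProj ι)) x :=
  (innerSL ℝ u).hasFDerivAt.sub (hφ.hasFDerivAt.comp x (graphProj ι).hasFDerivAt)

/-- The flux density through the translate of the graph. -/
def graphFlux (ι : E d →ₗᵢ[ℝ] E (d + 1)) (u : E (d + 1)) (φ : E d → ℝ)
    (F : E (d + 1) → E (d + 1)) (w : E d) (t : ℝ) : ℝ :=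
  ⟪u, F (ι w + t • u)⟫ - fderiv ℝ φ w (graphProj ι (F (ι w + t • u)))

theorem measurable_graphFlux (φ : E d → ℝ) {F : E (d + 1) → E (d + 1)} (hF : Continuous F) :
    Measurable fun p : E d × ℝ => graphFlux ι u φ F p.1 p.2 := by
  have hc : Continuous fun p : E d × ℝ => F (ι p.1 + p.2 • u) := by fun_prop
  refine Measurable.sub ((innerSL ℝ u).continuous.comp hc).measurable ?_
  have h2 : Measurable fun p : E d × ℝ => (fderiv ℝ φ p.1, graphProj ι (F (ι p.1 + p.2 • u))) :=
    ((measurable_fderiv ℝ φ).comp measurable_fst).prodMk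
      ((graphProj ι).continuous.comp hc).measurable
  exact isBoundedBilinearMap_apply.continuous.measurable.comp h2

theorem measurable_bump_mul_graphFlux {φ : E d → ℝ} (hφ : Continuous φ)
    {F : E (d + 1) → E (d + 1)} (hF : Continuous F) (ε : ℝ) :
    Measurable fun p : E d × ℝ =>
      deriv Real.smoothTransition p.2 * graphFlux ι u φ F p.1 (φ p.1 + ε * p.2) := by
  have h1 : Measurable fun p : E d × ℝ => deriv Real.smoothTransition p.2 :=
    continuous_deriv_smoothTransition.measurable.comp measurable_snd
  have h2 : Measurable fun p : E d × ℝ => (p.1, φ p.1 + ε * p.2) :=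
    (by fun_prop : Continuous fun p : E d × ℝ => (p.1, φ p.1 + ε * p.2)).measurable
  have h3 := (measurable_graphFlux (ι := ι) (u := u) φ hF).comp h2
  exact h1.mul h3

theorem norm_graphProj_le (hu : ‖u‖ = 1) (hι : ∀ w, ⟪u, ι w⟫ = 0) (x : E (d + 1)) :
    ‖graphProj ι x‖ ≤ ‖x‖ := by
  have h2 := norm_sq_add_smul hu hι (graphProj ι x) ⟪u, x⟫
  rw [graph_decomp hu hι x] at h2
  refine le_of_sq_le_sq ?_ (norm_nonneg _)
  nlinarith [sq_nonneg ⟪u, x⟫]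

theorem abs_graphFlux_le (hu : ‖u‖ = 1) (hι : ∀ w, ⟪u, ι w⟫ = 0) {φ : E d → ℝ} {C : ℝ≥0}
    (hφ : LipschitzWith C φ) {F : E (d + 1) → E (d + 1)} (w : E d) (t : ℝ) :
    |graphFlux ι u φ F w t| ≤ (1 + C) * ‖F (ι w + t • u)‖ := by
  refine (abs_sub _ _).trans ?_
  have h1 := abs_real_inner_le_norm u (F (ι w + t • u))
  rw [hu, one_mul] at h1
  have h2 := (fderiv ℝ φ w).le_of_opNorm_le (norm_fderiv_le_of_lipschitz ℝ hφ)
    (graphProj ι (F (ι w + t • u)))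
  rw [Real.norm_eq_abs] at h2
  have h3 := mul_le_mul_of_nonneg_left (norm_graphProj_le hu hι (F (ι w + t • u))) C.coe_nonneg
  linarith

theorem integral_scaled_bump {q : ℝ → ℝ} {ε : ℝ} (hε : 0 < ε) (a : ℝ) (g : ℝ → ℝ) :
    ∫ t, g (ε⁻¹ * (t - a)) * (ε⁻¹ * q t) = ∫ s, g s * q (a + ε * s) := by
  have h1 := Measure.integral_comp_mul_left
    (fun t => g (ε⁻¹ * (t + a - a)) * (ε⁻¹ * q (t + a))) ε
  have h2 := integral_add_right_eq_self (μ := volume)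
    (fun t => g (ε⁻¹ * (t - a)) * (ε⁻¹ * q t)) a
  rw [h2, abs_of_pos (inv_pos.2 hε)] at h1
  rw [smul_eq_mul, eq_inv_mul_iff_mul_eq₀ hε.ne', ← integral_const_mul] at h1
  rw [← h1]
  refine integral_congr_ae (Eventually.of_forall fun s => ?_)
  simp only [add_sub_cancel_right]
  rw [inv_mul_cancel_left₀ hε.ne', add_comm a]
  field_simp

/-- A smooth approximation of the indicator function of the region above the graph. -/
def graphCutoff (ι : E d →ₗᵢ[ℝ] E (d + 1)) (u : E (d + 1)) (φ : E d → ℝ) (ε : ℝ)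
    (x : E (d + 1)) : ℝ := Real.smoothTransition (ε⁻¹ * graphHeight ι u φ x)

theorem exists_lipschitzWith_graphCutoff {φ : E d → ℝ} {C : ℝ≥0} (hφ : LipschitzWith C φ) (ε : ℝ) :
    ∃ D : ℝ≥0, LipschitzWith D (graphCutoff ι u φ ε) := by
  obtain ⟨D, hD⟩ := exists_lipschitzWith_smoothTransition
  obtain ⟨D', hD'⟩ := exists_lipschitzWith_graphHeight (ι := ι) (u := u) hφ
  exact ⟨_, hD.comp ((lipschitzWith_smul (α := ℝ) (β := ℝ) ε⁻¹).comp hD')⟩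

/-- In the coordinates (w, t), where Fubini applies, the derivative of the cutoff along F is a
scaled bump in t - φ(w) times the flux density; then t = φ(w) + εs. Differentiability of φ is needed
only for almost every w. -/
theorem integral_fderiv_graphCutoff (hu : ‖u‖ = 1) (hι : ∀ w, ⟪u, ι w⟫ = 0) {φ : E d → ℝ}
    {C : ℝ≥0} (hφ : LipschitzWith C φ) {F : E (d + 1) → E (d + 1)}
    (hF : Continuous F) (hc : HasCompactSupport F) {ε : ℝ} (hε : 0 < ε) :
    ∫ x, fderiv ℝ (graphCutoff ι u φ ε) x (F x) =
      ∫ w, ∫ s, deriv Real.smoothTransition s * graphFlux ι u φ F w (φ w + ε * s) := by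
  obtain ⟨D'', hD''⟩ := exists_lipschitzWith_graphCutoff (ι := ι) (u := u) hφ ε
  have hm : Measurable fun x => fderiv ℝ (graphCutoff ι u φ ε) x (F x) :=
    isBoundedBilinearMap_apply.continuous.measurable.comp
      ((measurable_fderiv ℝ (graphCutoff ι u φ ε)).prodMk hF.measurable)
  have hint : Integrable fun x => fderiv ℝ (graphCutoff ι u φ ε) x (F x) := by
    have hi : Integrable fun x => (D'' : ℝ) * ‖F x‖ :=
      (hF.norm.integrable_of_hasCompactSupport hc.norm).const_mul (D'' : ℝ)
    refine hi.mono' hm.aestronglyMeasurable (Eventually.of_forall fun x => ?_)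
    exact ContinuousLinearMap.le_of_opNorm_le _ (norm_fderiv_le_of_lipschitz ℝ hD'') _
  have hmp := measurePreserving_graph hu hι
  have hemb := measurableEmbedding_graph hu hι
  rw [← hmp.integral_comp hemb, Measure.volume_eq_prod, integral_prod]
  · refine integral_congr_ae ?_
    filter_upwards [hφ.ae_differentiableAt (μ := volume)] with w hw
    rw [← integral_scaled_bump hε]
    refine integral_congr_ae (Eventually.of_forall fun t => ?_)
    simp only
    have hpw : graphProj ι (ι w + t • u) = w := graphProj_add_smul hι w t
    have hd := hasFDerivAt_graphHeight (ι := ι) (u := u) (x := ι w + t • u) (φ := φ)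
      (by rw [hpw]; exact hw)
    have hd2 : HasFDerivAt (graphCutoff ι u φ ε) _ (ι w + t • u) :=
      (hasDerivAt_smoothTransition _).comp_hasFDerivAt _ (hd.const_mul ε⁻¹)
    rw [hd2.fderiv, hpw, graphHeight_add_smul hu hι]
    simp [graphFlux]
  · rw [← Measure.volume_eq_prod]
    exact (hmp.integrable_comp_emb hemb).2 hint

/-- The layer of height ε collapses onto the graph. Because the bump has integral 1, the inner
integral tends to the flux at t = φ(w); dominated convergence is used for s and again for w. -/
theorem tendsto_integral_fderiv_graphCutoff (hu : ‖u‖ = 1) (hι : ∀ w, ⟪u, ι w⟫ = 0) {φ : E d → ℝ}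
    {C : ℝ≥0} (hφ : LipschitzWith C φ) {F : E (d + 1) → E (d + 1)}
    (hF : Continuous F) (hc : HasCompactSupport F) {ε : ℕ → ℝ} (hε : ∀ k, 0 < ε k)
    (hε0 : Tendsto ε atTop (𝓝 0)) :
    Tendsto (fun k => ∫ x, fderiv ℝ (graphCutoff ι u φ (ε k)) x (F x)) atTop
      (𝓝 (∫ w, graphFlux ι u φ F w (φ w))) := by
  obtain ⟨A, hA⟩ := hF.bounded_above_of_compact_support hc
  have hA0 : 0 ≤ A := (norm_nonneg _).trans (hA 0)
  obtain ⟨R, hR⟩ := hc.isCompact.isBounded.subset_ball 0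
  have hzero : ∀ x : E (d + 1), R ≤ ‖x‖ → F x = 0 := by
    intro x hx
    by_contra h
    have := hR (subset_tsupport F h)
    simp at this
    linarith
  have hflux0 : ∀ w t, R ≤ ‖w‖ → graphFlux ι u φ F w t = 0 := by
    intro w t hw
    have h1 := norm_sq_add_smul hu hι w t
    have h2 : ‖w‖ ≤ ‖ι w + t • u‖ := by
      refine le_of_sq_le_sq ?_ (norm_nonneg _)
      nlinarith [sq_nonneg t]
    rw [graphFlux, hzero _ (hw.trans h2)]
    simp
  have hfluxb : ∀ w t, |graphFlux ι u φ F w t| ≤ (1 + C) * A := fun w t =>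
    (abs_graphFlux_le hu hι hφ w t).trans (mul_le_mul_of_nonneg_left (hA _) (by positivity))
  have hfluxc : ∀ w, Continuous (graphFlux ι u φ F w) := by
    intro w
    have hF' := hF
    unfold graphFlux
    fun_prop
  simp_rw [integral_fderiv_graphCutoff hu hι hφ hF hc (hε _)]
  refine tendsto_integral_of_dominated_convergence
    ((Metric.closedBall (0 : E d) R).indicator fun _ =>
      ∫ s, ‖deriv Real.smoothTransition s‖ * ((1 + C) * A)) ?_ ?_ ?_ ?_
  · intro k
    exact (measurable_bump_mul_graphFlux hφ.continuous hF (ε k)).stronglyMeasurable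
      |>.integral_prod_right.aestronglyMeasurable
  · rw [integrable_indicator_iff Metric.isClosed_closedBall.measurableSet]
    exact continuous_const.continuousOn.integrableOn_compact (isCompact_closedBall _ _)
  · intro k
    refine Eventually.of_forall fun w => ?_
    by_cases hw : w ∈ Metric.closedBall (0 : E d) R
    · rw [indicator_of_mem hw]
      refine norm_integral_le_of_norm_le
        (integrable_deriv_smoothTransition.norm.mul_const _) (Eventually.of_forall fun s => ?_)
      rw [norm_mul]
      gcongr
      exact hfluxb _ _
    · rw [indicator_of_notMem hw]
      have hw' : R ≤ ‖w‖ := by simp at hw; exact hw.le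
      simp [hflux0 w _ hw']
  · refine Eventually.of_forall fun w => ?_
    have hone : graphFlux ι u φ F w (φ w) =
        ∫ s, deriv Real.smoothTransition s * graphFlux ι u φ F w (φ w) := by
      rw [integral_mul_const, integral_deriv_smoothTransition, one_mul]
    rw [hone]
    refine tendsto_integral_of_dominated_convergence
      (fun s => ‖deriv Real.smoothTransition s‖ * ((1 + C) * A)) ?_ ?_ ?_ ?_
    · intro k
      have h1 := hfluxc w
      have h2 := continuous_deriv_smoothTransition
      exact Continuous.aestronglyMeasurable (by fun_prop)
    · exact integrable_deriv_smoothTransition.norm.mul_const _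
    · intro k
      refine Eventually.of_forall fun s => ?_
      rw [norm_mul]
      gcongr
      exact hfluxb _ _
    · refine Eventually.of_forall fun s => ?_
      have h1 : Tendsto (fun k => φ w + ε k * s) atTop (𝓝 (φ w)) := by
        simpa using (hε0.mul_const s).const_add (φ w)
      exact (((hfluxc w).tendsto _).comp h1).const_mul _
theorem tendsto_integral_graphCutoff_mul {φ : E d → ℝ}
    {C : ℝ≥0} (hφ : LipschitzWith C φ) {g : E (d + 1) → ℝ} (hg : Integrable g)
    {ε : ℕ → ℝ} (hε : ∀ k, 0 < ε k) (hε0 : Tendsto ε atTop (𝓝 0)) :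
    Tendsto (fun k => ∫ x, graphCutoff ι u φ (ε k) x * g x) atTop
      (𝓝 (∫ x in {x | 0 < graphHeight ι u φ x}, g x)) := by
  obtain ⟨D', hD'⟩ := exists_lipschitzWith_graphHeight (ι := ι) (u := u) hφ
  have hop : IsOpen {x | 0 < graphHeight ι u φ x} := isOpen_lt continuous_const hD'.continuous
  rw [← integral_indicator hop.measurableSet]
  refine tendsto_integral_of_dominated_convergence (fun x => ‖g x‖) ?_ hg.norm ?_ ?_
  · intro k
    obtain ⟨D'', hD''⟩ := exists_lipschitzWith_graphCutoff (ι := ι) (u := u) hφ (ε k)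
    exact hD''.continuous.aestronglyMeasurable.mul hg.aestronglyMeasurable
  · intro k
    refine Eventually.of_forall fun x => ?_
    rw [norm_mul]
    refine mul_le_of_le_one_left (norm_nonneg _) ?_
    unfold graphCutoff
    rw [Real.norm_eq_abs, abs_of_nonneg (Real.smoothTransition.nonneg _)]
    exact Real.smoothTransition.le_one _
  · refine Eventually.of_forall fun x => ?_
    by_cases hx : 0 < graphHeight ι u φ x
    · rw [indicator_of_mem (by exact hx)]
      refine tendsto_const_nhds.congr' ?_
      filter_upwards [hε0.eventually (Iio_mem_nhds hx)] with k hk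
      have : graphCutoff ι u φ (ε k) x = 1 := by
        refine Real.smoothTransition.one_of_one_le ?_
        rw [le_inv_mul_iff₀ (hε k), mul_one]
        exact le_of_lt hk
      rw [this, one_mul]
    · rw [indicator_of_notMem (by exact hx)]
      refine tendsto_const_nhds.congr fun k => ?_
      have : graphCutoff ι u φ (ε k) x = 0 := by
        refine Real.smoothTransition.zero_of_nonpos ?_
        exact mul_nonpos_of_nonneg_of_nonpos (inv_pos.2 (hε k)).le (not_lt.1 hx)
      rw [this, zero_mul]
/-- The divergence theorem on the region above a Lipschitz graph. -/
theorem integral_divergence_above_graph (hu : ‖u‖ = 1) (hι : ∀ w, ⟪u, ι w⟫ = 0) {φ : E d → ℝ}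
    {C : ℝ≥0} (hφ : LipschitzWith C φ) {F : E (d + 1) → E (d + 1)}
    (hF : Differentiable ℝ F) (hc : HasCompactSupport F) (hdiv : Continuous (divergence F)) :
    ∫ x in {x | 0 < graphHeight ι u φ x}, divergence F x =
      -∫ w, graphFlux ι u φ F w (φ w) := by
  let ε : ℕ → ℝ := fun k => 1 / ((k : ℝ) + 1)
  have hε : ∀ k, 0 < ε k := fun k => by positivity
  have hε0 : Tendsto ε atTop (𝓝 0) := tendsto_one_div_add_atTop_nhds_zero_nat
  have hlim1 := tendsto_integral_graphCutoff_mul (ι := ι) (u := u) hφ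
    (hdiv.integrable_of_hasCompactSupport (hasCompactSupport_divergence hc)) hε hε0
  have hparts : ∀ k, ∫ x, graphCutoff ι u φ (ε k) x * divergence F x =
      -∫ x, fderiv ℝ (graphCutoff ι u φ (ε k)) x (F x) := by
    intro k
    obtain ⟨D'', hD''⟩ := exists_lipschitzWith_graphCutoff (ι := ι) (u := u) hφ (ε k)
    exact integral_mul_divergence hD'' hF hc hdiv
  simp_rw [hparts] at hlim1
  exact tendsto_nhds_unique hlim1
    (tendsto_integral_fderiv_graphCutoff hu hι hφ hF.continuous hc hε hε0).neg

end Chart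

end HyperCyl
end

/-! ### The divergence theorem inside one chart. -/

noncomputable section
namespace HyperCyl
open Filter Topology
open scoped ENNReal RealInnerProductSpace

section Chart

variable {d : ℕ} {ι : E d →ₗᵢ[ℝ] E (d + 1)} {u : E (d + 1)}

theorem mem_range_graphMap (hu : ‖u‖ = 1) (hι : ∀ w, ⟪u, ι w⟫ = 0) {φ : E d → ℝ}
    {x : E (d + 1)} : x ∈ range (graphMap ι u φ) ↔ graphHeight ι u φ x = 0 := by
  constructor
  · rintro ⟨w, rfl⟩
    rw [graphMap, graphHeight_add_smul hu hι, sub_self]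
  · intro h
    refine ⟨graphProj ι x, ?_⟩
    rw [graphHeight, sub_eq_zero] at h
    rw [graphMap, ← h, graph_decomp hu hι]

theorem frontier_above_graph (hu : ‖u‖ = 1) (hι : ∀ w, ⟪u, ι w⟫ = 0) {φ : E d → ℝ}
    (hφ : Continuous φ) :
    frontier {x | 0 < graphHeight ι u φ x} = {x | graphHeight ι u φ x = 0} := by
  have hcont : Continuous (graphHeight ι u φ) :=
    ((innerSL ℝ u).continuous).sub (hφ.comp (graphProj ι).continuous)
  refine Subset.antisymm ?_ ?_
  · refine (frontier_lt_subset_eq continuous_const hcont).trans ?_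
    intro x hx
    exact (hx : (0 : ℝ) = graphHeight ι u φ x).symm
  · intro x hx
    have hop : IsOpen {x | 0 < graphHeight ι u φ x} := isOpen_lt continuous_const hcont
    rw [hop.frontier_eq]
    refine ⟨?_, fun h => ?_⟩
    · have hshift : ∀ t : ℝ, graphHeight ι u φ (x + t • u) = t := by
        intro t
        have h1 := graph_decomp hu hι x
        have h2 : x + t • u = ι (graphProj ι x) + (⟪u, x⟫ + t) • u := by
          conv_lhs => rw [← h1]
          rw [add_smul, add_assoc]
        rw [h2, graphHeight_add_smul hu hι]
        have h3 : ⟪u, x⟫ - φ (graphProj ι x) = 0 := hx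
        linarith
      have hlim : Tendsto (fun t : ℝ => x + t • u) (𝓝[>] 0) (𝓝 x) := by
        have : Continuous fun t : ℝ => x + t • u := by fun_prop
        have := this.tendsto 0
        rw [zero_smul, add_zero] at this
        exact this.mono_left nhdsWithin_le_nhds
      refine mem_closure_of_tendsto hlim ?_
      filter_upwards [self_mem_nhdsWithin] with t ht
      rw [hshift]
      exact ht
    · have h1 : (0 : ℝ) < graphHeight ι u φ x := h
      have h2 : graphHeight ι u φ x = 0 := hx
      linarith

end Chart

namespace LipschitzChart

variable {d : ℕ} {K : Set (E (d + 1))} {c : E (d + 1)} (ch : LipschitzChart K c)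

/-- The parametrisation of the boundary in the chart. -/
def param : E d → E (d + 1) := graphMap ch.ι ch.u ch.φ

theorem inter_ball :
    K ∩ Metric.ball c ch.r = {x | 0 < graphHeight ch.ι ch.u ch.φ x} ∩ Metric.ball c ch.r := by
  ext x
  simp only [mem_inter_iff, and_congr_left_iff]
  intro hx
  rw [ch.mem_iff x hx]
  simp [graphHeight]

theorem frontier_inter_ball :
    frontier K ∩ Metric.ball c ch.r = range ch.param ∩ Metric.ball c ch.r := by
  rw [← frontier_inter_open_inter Metric.isOpen_ball, ch.inter_ball,
    frontier_inter_open_inter Metric.isOpen_ball,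
    frontier_above_graph ch.norm_u ch.inner_ι ch.lip.continuous]
  ext x
  simp only [mem_inter_iff, and_congr_left_iff]
  intro _
  exact (mem_range_graphMap ch.norm_u ch.inner_ι).symm

theorem measurableEmbedding_param : MeasurableEmbedding ch.param :=
  measurableEmbedding_graphMap ch.norm_u ch.inner_ι ch.lip.continuous

/-- This is how the area formula is used: surface integrals in the chart become weighted Lebesgue
integrals over the parameter space. -/
theorem restrict_frontier_inter_ball :
    (Measure.euclideanHausdorffMeasure d).restrict (frontier K ∩ Metric.ball c ch.r) =
      ((graphDensity ch.φ).restrict (ch.param ⁻¹' Metric.ball c ch.r)).map ch.param := by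
  rw [ch.frontier_inter_ball, inter_comm, ← Measure.restrict_restrict Metric.isOpen_ball.measurableSet,
    param, restrict_range_graphMap ch.norm_u ch.inner_ι ch.lip]
  exact ch.measurableEmbedding_param.restrict_map _ _

theorem ae_outerNormal_param :
    ∀ᵐ w, ch.param w ∈ Metric.ball c ch.r →
      outerNormal K (ch.param w) = graphNormal ch.ι ch.u (fderiv ℝ ch.φ w) := by
  filter_upwards [ch.lip.ae_differentiableAt (μ := volume)] with w hw hB
  exact (isOuterNormal_graphNormal ch.norm_u ch.inner_ι ch.mem_iff hw hB).outerNormal_eq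

theorem aestronglyMeasurable_outerNormal :
    AEStronglyMeasurable (outerNormal K)
      ((Measure.euclideanHausdorffMeasure d).restrict (frontier K ∩ Metric.ball c ch.r)) := by
  rw [ch.restrict_frontier_inter_ball, ch.measurableEmbedding_param.aestronglyMeasurable_map_iff]
  have hm : AEStronglyMeasurable (fun w => graphNormal ch.ι ch.u (fderiv ℝ ch.φ w))
      ((graphDensity ch.φ).restrict (ch.param ⁻¹' Metric.ball c ch.r)) :=
    ((continuous_graphNormal ch.ι ch.u).measurable.comp
      (measurable_fderiv ℝ ch.φ)).aestronglyMeasurable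
  refine hm.congr ?_
  have hms := ch.measurableEmbedding_param.measurable Metric.isOpen_ball.measurableSet
    (t := Metric.ball c ch.r)
  rw [EventuallyEq, ae_restrict_iff' hms]
  refine (withDensity_absolutelyContinuous _ _).ae_le ?_
  filter_upwards [ch.ae_outerNormal_param] with w hw hB
  exact (hw hB).symm

theorem measure_frontier_inter_ball_lt_top :
    Measure.euclideanHausdorffMeasure d (frontier K ∩ Metric.ball c ch.r) < ∞ := by
  have hms := ch.measurableEmbedding_param.measurable Metric.isOpen_ball.measurableSet
    (t := Metric.ball c ch.r)
  have h1 : Measure.euclideanHausdorffMeasure d (frontier K ∩ Metric.ball c ch.r) =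
      graphDensity ch.φ (ch.param ⁻¹' Metric.ball c ch.r) := by
    rw [← comap_graphMap_euclideanHausdorffMeasure ch.norm_u ch.inner_ι ch.lip,
      (measurableEmbedding_graphMap ch.norm_u ch.inner_ι ch.lip.continuous).comap_apply,
      ch.frontier_inter_ball, inter_comm, ← image_preimage_eq_inter_range]
    rfl
  rw [h1, graphDensity, withDensity_apply _ hms]
  have hb : Bornology.IsBounded (ch.param ⁻¹' Metric.ball c ch.r) := by
    refine (isBounded_iff_forall_norm_le).2 ⟨‖c‖ + ch.r, fun w hw => ?_⟩
    have h2 : ‖w‖ ≤ ‖ch.param w‖ := by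
      have h3 := norm_sq_add_smul ch.norm_u ch.inner_ι w (ch.φ w)
      refine le_of_sq_le_sq ?_ (norm_nonneg _)
      change ‖w‖ ^ 2 ≤ ‖ch.ι w + ch.φ w • ch.u‖ ^ 2
      nlinarith [sq_nonneg (ch.φ w)]
    have h4 : ‖ch.param w - c‖ < ch.r := mem_ball_iff_norm.1 hw
    have h5 := norm_sub_norm_le (ch.param w) c
    linarith
  calc ∫⁻ w in ch.param ⁻¹' Metric.ball c ch.r, ENNReal.ofReal (areaFactor (fderiv ℝ ch.φ w))
      ≤ ∫⁻ _ in ch.param ⁻¹' Metric.ball c ch.r, ENNReal.ofReal (√(1 + (ch.C : ℝ) ^ 2)) := by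
        refine lintegral_mono fun w => ENNReal.ofReal_le_ofReal (Real.sqrt_le_sqrt ?_)
        have := norm_fderiv_le_of_lipschitz ℝ ch.lip (x₀ := w)
        gcongr
    _ < ∞ := by
        rw [setLIntegral_const]
        exact ENNReal.mul_lt_top ENNReal.ofReal_lt_top hb.measure_lt_top

/-- The divergence theorem for vector fields supported in a chart. -/
theorem integral_divergence {F : E (d + 1) → E (d + 1)}
    (hF : Differentiable ℝ F) (hc : HasCompactSupport F) (hdiv : Continuous (divergence F))
    (hsupp : tsupport F ⊆ Metric.ball c ch.r) (hKm : MeasurableSet K) :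
    ∫ x in frontier K, ⟪F x, outerNormal K x⟫ ∂(Measure.euclideanHausdorffMeasure d) =
      ∫ x in K, divergence F x := by
  have hF0 : ∀ x, x ∉ Metric.ball c ch.r → F x = 0 := fun x hx =>
    image_eq_zero_of_notMem_tsupport fun h => hx (hsupp h)
  have hd0 : ∀ x, x ∉ Metric.ball c ch.r → divergence F x = 0 := fun x hx =>
    divergence_eq_zero_of_notMem_tsupport fun h => hx (hsupp h)
  have hΩ : MeasurableSet {x | 0 < graphHeight ch.ι ch.u ch.φ x} := by
    obtain ⟨D, hD⟩ := exists_lipschitzWith_graphHeight (ι := ch.ι) (u := ch.u) ch.lip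
    exact (isOpen_lt continuous_const hD.continuous).measurableSet
  have hemb := ch.measurableEmbedding_param
  have hms := hemb.measurable Metric.isOpen_ball.measurableSet (t := Metric.ball c ch.r)
  have hvol : ∫ x in K, divergence F x =
      ∫ x in {x | 0 < graphHeight ch.ι ch.u ch.φ x}, divergence F x := by
    rw [← integral_indicator hKm, ← integral_indicator hΩ]
    congr 1
    ext x
    by_cases hx : x ∈ Metric.ball c ch.r
    · have : x ∈ K ↔ x ∈ {x | 0 < graphHeight ch.ι ch.u ch.φ x} := by
        have h := congrArg (fun s => x ∈ s) ch.inter_ball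
        simp only [mem_inter_iff, hx, and_true] at h
        exact iff_of_eq h
      simp only [indicator, this]
    · simp only [indicator, hd0 x hx, ite_self]
  have hsurf : ∫ x in frontier K, ⟪F x, outerNormal K x⟫ ∂(Measure.euclideanHausdorffMeasure d) =
      ∫ x in frontier K ∩ Metric.ball c ch.r, ⟪F x, outerNormal K x⟫
        ∂(Measure.euclideanHausdorffMeasure d) := by
    rw [← integral_indicator isClosed_frontier.measurableSet,
      ← integral_indicator (isClosed_frontier.measurableSet.inter Metric.isOpen_ball.measurableSet)]
    congr 1
    ext x
    by_cases hx : x ∈ Metric.ball c ch.r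
    · by_cases hxf : x ∈ frontier K
      · rw [indicator_of_mem hxf, indicator_of_mem (mem_inter hxf hx)]
      · rw [indicator_of_notMem hxf, indicator_of_notMem fun h => hxf h.1]
    · simp [indicator, hF0 x hx]
  rw [hvol, hsurf, integral_divergence_above_graph ch.norm_u ch.inner_ι ch.lip hF hc hdiv,
    ch.restrict_frontier_inter_ball, hemb.integral_map, graphDensity,
    restrict_withDensity hms, ← integral_neg,
    integral_withDensity_eq_integral_toReal_smul
      (measurable_areaFactor_fderiv ch.φ).ennreal_ofReal
      (Eventually.of_forall fun _ => ENNReal.ofReal_lt_top),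
    ← integral_indicator hms]
  refine integral_congr_ae ?_
  filter_upwards [ch.ae_outerNormal_param] with w hw
  by_cases hB : ch.param w ∈ Metric.ball c ch.r
  · rw [indicator_of_mem (by exact hB), hw hB,
      ENNReal.toReal_ofReal (zero_le_one.trans (one_le_areaFactor _)), smul_eq_mul,
      areaFactor_mul_inner_graphNormal, graphFlux, neg_sub]
    rfl
  · rw [indicator_of_notMem (by exact hB)]
    have h0 : F (ch.ι w + ch.φ w • ch.u) = 0 := hF0 _ hB
    simp [graphFlux, h0]

end LipschitzChart

end HyperCyl
end

/-! ### The divergence theorem on open sets with Lipschitz boundary. -/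

noncomputable section
namespace HyperCyl
open Filter Topology
open scoped ENNReal RealInnerProductSpace Manifold

section Global

variable {d : ℕ} {K : Set (E (d + 1))}

/-- The normal is defined by choice, so its measurability has to be proved. In each chart it agrees
almost everywhere with a measurable function of the derivative of φ, and countably many charts cover
the frontier. -/
theorem aestronglyMeasurable_outerNormal (hK : HasLipschitzBoundary K) :
    AEStronglyMeasurable (outerNormal K)
      ((Measure.euclideanHausdorffMeasure d).restrict (frontier K)) := by
  have hch : ∀ x : E (d + 1), ∃ U ∈ 𝓝 x, x ∈ frontier K → AEStronglyMeasurable (outerNormal K)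
      ((Measure.euclideanHausdorffMeasure d).restrict (frontier K ∩ U)) := by
    intro x
    by_cases hx : x ∈ frontier K
    · obtain ⟨ch⟩ := hK.exists_chart hx
      exact ⟨_, Metric.ball_mem_nhds x ch.pos, fun _ => ch.aestronglyMeasurable_outerNormal⟩
    · exact ⟨univ, univ_mem, fun h => absurd h hx⟩
  choose U hU hUm using hch
  obtain ⟨t, htK, htc, htcov⟩ := TopologicalSpace.countable_cover_nhdsWithin
    (f := U) (s := frontier K) fun x _ => mem_nhdsWithin_of_mem_nhds (hU x)
  have : Countable t := htc
  have hsub : frontier K ⊆ ⋃ x : t, frontier K ∩ U x := by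
    intro x hx
    obtain ⟨y, hy, hxy⟩ := mem_iUnion₂.1 (htcov hx)
    exact mem_iUnion.2 ⟨⟨y, hy⟩, hx, hxy⟩
  exact AEStronglyMeasurable.mono_set hsub
    (aestronglyMeasurable_iUnion_iff.2 fun x => hUm x (htK x.2))

theorem measure_frontier_inter_lt_top (hK : HasLipschitzBoundary K) {A : Set (E (d + 1))}
    (hA : IsCompact A) : Measure.euclideanHausdorffMeasure d (frontier K ∩ A) < ∞ := by
  refine (hA.inter_left isClosed_frontier).measure_lt_top_of_nhdsWithin fun x hx => ?_
  obtain ⟨ch⟩ := hK.exists_chart hx.1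
  refine ⟨frontier K ∩ Metric.ball x ch.r, ?_, ch.measure_frontier_inter_ball_lt_top⟩
  exact inter_mem (mem_of_superset self_mem_nhdsWithin inter_subset_left)
    (mem_nhdsWithin_of_mem_nhds (Metric.ball_mem_nhds x ch.pos))

theorem integrableOn_apply_outerNormal {A : Type*} [NormedAddCommGroup A] [NormedSpace ℝ A]
    (hK : HasLipschitzBoundary K) {V : E (d + 1) → E (d + 1) →L[ℝ] A} (hV : Continuous V)
    (hc : HasCompactSupport V) :
    IntegrableOn (fun x => V x (outerNormal K x)) (frontier K)
      (Measure.euclideanHausdorffMeasure d) := by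
  obtain ⟨M, hM⟩ := hV.bounded_above_of_compact_support hc
  have hm : AEStronglyMeasurable (fun x => V x (outerNormal K x))
      ((Measure.euclideanHausdorffMeasure d).restrict (frontier K)) :=
    isBoundedBilinearMap_apply.continuous.comp_aestronglyMeasurable
      (hV.aestronglyMeasurable.prodMk (aestronglyMeasurable_outerNormal hK))
  have h1 : IntegrableOn (fun x => V x (outerNormal K x)) (frontier K ∩ tsupport V)
      (Measure.euclideanHausdorffMeasure d) := by
    have : IsFiniteMeasure ((Measure.euclideanHausdorffMeasure d).restrict
        (frontier K ∩ tsupport V)) :=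
      ⟨by rw [Measure.restrict_apply_univ]; exact measure_frontier_inter_lt_top hK hc.isCompact⟩
    refine Integrable.of_bound (hm.mono_set inter_subset_left) M ?_
    refine Eventually.of_forall fun x => ?_
    exact ((V x).le_of_opNorm_le (hM x) _).trans
      (mul_le_of_le_one_right ((norm_nonneg _).trans (hM x)) (norm_outerNormal_le K x))
  refine h1.of_forall_sdiff_eq_zero isClosed_frontier.measurableSet fun x hx => ?_
  have : V x = 0 := image_eq_zero_of_notMem_tsupport fun h => hx.2 ⟨hx.1, h⟩
  rw [this]; rfl

theorem integrableOn_inner_outerNormal (hK : HasLipschitzBoundary K) {F : E (d + 1) → E (d + 1)}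
    (hF : Continuous F) (hc : HasCompactSupport F) :
    IntegrableOn (fun x => ⟪F x, outerNormal K x⟫) (frontier K)
      (Measure.euclideanHausdorffMeasure d) :=
  integrableOn_apply_outerNormal hK (V := fun x => innerSL ℝ (F x))
    ((innerSL ℝ).continuous.comp hF) (hc.comp_left (g := fun v => innerSL ℝ v) (map_zero _))

/-- Frontier points have charts. For fields supported inside K or outside its closure both sides
vanish. These neighbourhoods are what the partition of unity is subordinate to. -/
theorem exists_local_divergence_nhds (hKo : IsOpen K) (hK : HasLipschitzBoundary K)
    (x : E (d + 1)) : ∃ U : Set (E (d + 1)), IsOpen U ∧ x ∈ U ∧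
      ∀ F : E (d + 1) → E (d + 1), Differentiable ℝ F → HasCompactSupport F →
        Continuous (divergence F) → tsupport F ⊆ U →
        ∫ x in frontier K, ⟪F x, outerNormal K x⟫ ∂(Measure.euclideanHausdorffMeasure d) =
          ∫ x in K, divergence F x := by
  have hzero : ∀ F : E (d + 1) → E (d + 1), (∀ x ∈ frontier K, x ∉ tsupport F) →
      ∫ x in frontier K, ⟪F x, outerNormal K x⟫ ∂(Measure.euclideanHausdorffMeasure d) = 0 := by
    intro F h
    refine setIntegral_eq_zero_of_forall_eq_zero fun x hx => ?_
    rw [image_eq_zero_of_notMem_tsupport (h x hx), inner_zero_left]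
  by_cases hx : x ∈ frontier K
  · obtain ⟨ch⟩ := hK.exists_chart hx
    exact ⟨_, Metric.isOpen_ball, Metric.mem_ball_self ch.pos, fun F hF hc hdiv hs =>
      ch.integral_divergence hF hc hdiv hs hKo.measurableSet⟩
  by_cases hxK : x ∈ K
  · refine ⟨K, hKo, hxK, fun F hF hc hdiv hs => ?_⟩
    rw [hzero F fun y hy h => ?_, setIntegral_eq_integral_of_forall_compl_eq_zero,
      integral_divergence_eq_zero hF hc
        (hdiv.integrable_of_hasCompactSupport (hasCompactSupport_divergence hc))]
    · exact fun y hy => divergence_eq_zero_of_notMem_tsupport fun h => hy (hs h)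
    · rw [hKo.frontier_eq] at hy
      exact hy.2 (hs h)
  · refine ⟨(closure K)ᶜ, isClosed_closure.isOpen_compl, ?_, fun F hF hc hdiv hs => ?_⟩
    · intro h
      rw [hKo.frontier_eq] at hx
      exact hx ⟨h, hxK⟩
    · rw [hzero F fun y hy h => hs h (frontier_subset_closure hy),
        setIntegral_eq_zero_of_forall_eq_zero]
      exact fun y hy => divergence_eq_zero_of_notMem_tsupport fun h => hs h (subset_closure hy)

theorem divergence_finsetSum {κ : Type*} {t : Finset κ} {F : κ → E (d + 1) → E (d + 1)}
    (hF : ∀ i ∈ t, Differentiable ℝ (F i)) (x : E (d + 1)) :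
    divergence (fun x => ∑ i ∈ t, F i x) x = ∑ i ∈ t, divergence (F i) x := by
  unfold divergence
  rw [fderiv_fun_sum fun i hi => hF i hi x, Finset.sum_comm]
  refine Finset.sum_congr rfl fun i _ => ?_
  simp

/-- The divergence theorem on an open set with Lipschitz boundary. -/
theorem integral_inner_outerNormal (hKo : IsOpen K) (hK : HasLipschitzBoundary K)
    {F : E (d + 1) → E (d + 1)} (hF : Differentiable ℝ F) (hc : HasCompactSupport F)
    (hdiv : Continuous (divergence F)) :
    ∫ x in frontier K, ⟪F x, outerNormal K x⟫ ∂(Measure.euclideanHausdorffMeasure d) =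
      ∫ x in K, divergence F x := by
  choose U hUo hxU hU using exists_local_divergence_nhds hKo hK
  obtain ⟨f, hf⟩ := SmoothPartitionOfUnity.exists_isSubordinate 𝓘(ℝ, E (d + 1))
    (isClosed_tsupport F) U hUo fun x _ => mem_iUnion.2 ⟨x, hxU x⟩
  have hfin := f.locallyFinite.finite_nonempty_inter_compact hc.isCompact
  let t := hfin.toFinset
  have hsm : ∀ i, ContDiff ℝ 1 (f i) := fun i =>
    (contMDiff_iff_contDiff.1 (f i).contMDiff).of_le (mod_cast le_top)
  have hd1 : ∀ i, Differentiable ℝ (f i) := fun i => (hsm i).differentiable one_ne_zero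
  let G : E (d + 1) → E (d + 1) → E (d + 1) := fun i x => f i x • F x
  have hG : ∀ i, Differentiable ℝ (G i) := fun i x => (hd1 i x).fun_smul (hF x)
  have hGc : ∀ i, HasCompactSupport (G i) := fun i =>
    HasCompactSupport.intro hc.isCompact fun x hx => by
      simp [G, image_eq_zero_of_notMem_tsupport hx]
  have hGdiv : ∀ i, Continuous (divergence (G i)) := by
    intro i
    have : divergence (G i) = fun x => f i x * divergence F x + fderiv ℝ (f i) x (F x) :=
      funext fun x => divergence_smul (hd1 i x) (hF x)
    rw [this]
    have h1 := (hsm i).continuous_fderiv one_ne_zero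
    have h2 := (hsm i).continuous
    have h3 := hF.continuous
    fun_prop
  have hGs : ∀ i, tsupport (G i) ⊆ U i := fun i =>
    (closure_mono (Function.support_smul_subset_left _ _)).trans (hf i)
  have hsum : F = fun x => ∑ i ∈ t, G i x := by
    ext1 x
    by_cases hx : x ∈ tsupport F
    · have h1 := f.sum_eq_one hx
      rw [finsum_eq_sum_of_support_subset (s := t)] at h1
      · simp only [G]
        rw [← Finset.sum_smul, h1, one_smul]
      · intro i hi
        simp only [t, Finite.coe_toFinset, mem_ofPred_eq]
        exact ⟨x, hi, hx⟩
    · simp [G, image_eq_zero_of_notMem_tsupport hx]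
  have hdivsum : ∀ x, divergence F x = ∑ i ∈ t, divergence (G i) x := by
    intro x
    conv_lhs => rw [hsum]
    exact divergence_finsetSum (fun i _ => hG i) x
  simp_rw [hdivsum]
  have hinner : ∀ x, ⟪F x, outerNormal K x⟫ = ∑ i ∈ t, ⟪G i x, outerNormal K x⟫ := by
    intro x
    rw [← sum_inner]
    congr 1
    exact congrFun hsum x
  simp_rw [hinner]
  rw [integral_finsetSum _ fun i _ => integrableOn_inner_outerNormal hK (hG i).continuous (hGc i),
    integral_finsetSum _ fun i _ => ((hGdiv i).integrable_of_hasCompactSupport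
      (hasCompactSupport_divergence (hGc i))).integrableOn]
  exact Finset.sum_congr rfl fun i _ => hU i _ (hG i) (hGc i) (hGdiv i) (hGs i)

/-- The divergence theorem for vector-valued linear forms: `∫_{∂K} V(x) n(x) = ∫_K ∑ ∂ᵢ V(x) eᵢ`. -/
theorem integral_apply_outerNormal {A : Type*} [NormedAddCommGroup A] [NormedSpace ℝ A]
    [CompleteSpace A] (hKo : IsOpen K) (hK : HasLipschitzBoundary K)
    {V : E (d + 1) → E (d + 1) →L[ℝ] A} (hV : Differentiable ℝ V) (hc : HasCompactSupport V)
    (hdiv : Continuous fun x => ∑ i, fderiv ℝ V x (e i) (e i)) :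
    ∫ x in frontier K, V x (outerNormal K x) ∂(Measure.euclideanHausdorffMeasure d) =
      ∫ x in K, ∑ i, fderiv ℝ V x (e i) (e i) := by
  have hi1 := integrableOn_apply_outerNormal hK hV.continuous hc
  have hds : HasCompactSupport fun x => ∑ i, fderiv ℝ V x (e i) (e i) := by
    refine HasCompactSupport.intro hc.isCompact fun x hx => ?_
    have h0 : fderiv ℝ V x = 0 := by
      by_contra hne
      exact hx (support_fderiv_subset ℝ (f := V) hne)
    simp [h0]
  have hi2 : IntegrableOn (fun x => ∑ i, fderiv ℝ V x (e i) (e i)) K :=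
    (hdiv.integrable_of_hasCompactSupport hds).integrableOn
  refine (SeparatingDual.eq_iff_forall_dual_eq (R := ℝ)).2 fun ℓ => ?_
  rw [← ContinuousLinearMap.integral_comp_comm _ hi1, ← ContinuousLinearMap.integral_comp_comm _ hi2]
  -- T sends a form B to the vector representing the functional ℓ ∘ B, so the scalar theorem applies
  -- to T ∘ V for each dual element ℓ.
  let T : (E (d + 1) →L[ℝ] A) →L[ℝ] E (d + 1) :=
    ∑ i, (ℓ.comp (ContinuousLinearMap.apply ℝ A (e i))).smulRight (e i)
  have hT : ∀ B v, ⟪T B, v⟫ = ℓ (B v) := by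
    intro B v
    have h1 := continuousLinearMap_apply_eq_sum (ℓ.comp B) v
    rw [ContinuousLinearMap.comp_apply] at h1
    rw [h1]
    simp [T, sum_inner, inner_smul_left, e, EuclideanSpace.inner_single_left]
  have hF : ∀ x, HasFDerivAt (fun x => T (V x)) (T.comp (fderiv ℝ V x)) x := fun x =>
    T.hasFDerivAt.comp x (hV x).hasFDerivAt
  have hdF : ∀ x, divergence (fun x => T (V x)) x = ℓ (∑ i, fderiv ℝ V x (e i) (e i)) := by
    intro x
    rw [divergence, (hF x).fderiv, map_sum]
    refine Finset.sum_congr rfl fun i _ => ?_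
    rw [← hT, ContinuousLinearMap.comp_apply, e, real_inner_comm, EuclideanSpace.inner_single_left]
    simp
  have h := integral_inner_outerNormal hKo hK (F := fun x => T (V x))
    (fun x => (hF x).differentiableAt) (hc.comp_left (map_zero T))
    (by rw [funext hdF]; exact ℓ.continuous.comp hdiv)
  simp_rw [hT, hdF] at h
  exact h

end Global

end HyperCyl
end

/-! ### The area of the unit sphere. -/

noncomputable section
namespace HyperCyl
open Filter Topology
open scoped ENNReal RealInnerProductSpace

section Sphere

/-- In ‖z‖² = 1 + 2⟪z - x, x⟫ + ‖z - x‖² the quadratic term is dominated by 2ε‖z - x‖ as soon as ‖z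
- x‖ < 2ε. -/
theorem isOuterNormal_ball {n : ℕ} {x : E n} (hx : ‖x‖ = 1) :
    IsOuterNormal (Metric.ball (0 : E n) 1) x x := by
  refine ⟨hx, fun ε hε => ⟨2 * ε, by positivity, fun z hz => ?_⟩⟩
  have h1 : ‖z‖ ^ 2 = 1 + 2 * ⟪z - x, x⟫ + ‖z - x‖ ^ 2 := by
    have h := norm_add_sq_real x (z - x)
    rw [add_sub_cancel, hx, real_inner_comm] at h
    linarith
  have h2 : z ∈ Metric.ball (0 : E n) 1 ↔ ‖z‖ ^ 2 < 1 := by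
    rw [mem_ball_zero_iff, sq_lt_one_iff_abs_lt_one, abs_norm]
  rw [h2, h1]
  have h3 := norm_nonneg (z - x)
  constructor
  · intro h
    nlinarith
  · intro h
    nlinarith [sq_nonneg ‖z - x‖]

theorem lipschitz_sqrt_one_sub_sq {a b : ℝ} (ha : 0 ≤ a) (ha' : a ≤ 1 / 2) (hb : 0 ≤ b)
    (hb' : b ≤ 1 / 2) : |√(1 - a ^ 2) - √(1 - b ^ 2)| ≤ |a - b| := by
  have hA : 0 ≤ 1 - a ^ 2 := by nlinarith
  have hB : 0 ≤ 1 - b ^ 2 := by nlinarith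
  have h1 : 1 / 2 ≤ √(1 - a ^ 2) := Real.le_sqrt_of_sq_le (by nlinarith)
  have h2 : 1 / 2 ≤ √(1 - b ^ 2) := Real.le_sqrt_of_sq_le (by nlinarith)
  have h3 : (√(1 - a ^ 2) - √(1 - b ^ 2)) * (√(1 - a ^ 2) + √(1 - b ^ 2)) = (b - a) * (a + b) := by
    have e1 := Real.sq_sqrt hA
    have e2 := Real.sq_sqrt hB
    nlinarith
  have h4 := congrArg abs h3
  rw [abs_mul, abs_mul, abs_of_nonneg (by linarith : 0 ≤ √(1 - a ^ 2) + √(1 - b ^ 2)),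
    abs_of_nonneg (by linarith : 0 ≤ a + b), abs_sub_comm b a] at h4
  nlinarith [abs_nonneg (√(1 - a ^ 2) - √(1 - b ^ 2)), abs_nonneg (a - b)]

/-- With axis u = -x₀ the sphere near x₀ is the graph of -√(1 - |w|²). Truncating |w| at 1/2 makes
this function globally Lipschitz and changes nothing within distance 1/2 of x₀. -/
theorem hasLipschitzBoundary_ball {n : ℕ} : HasLipschitzBoundary (Metric.ball (0 : E n) 1) := by
  intro x₀ hx₀
  have hx1 : ‖x₀‖ = 1 := by
    rw [frontier_ball (0 : E n) one_ne_zero] at hx₀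
    simpa using hx₀
  refine ⟨-x₀, 1, fun w => -√(1 - min ‖w‖ (1 / 2) ^ 2), 1 / 2, by simpa using hx1, ?_,
    by norm_num, fun x hx => ?_⟩
  · refine LipschitzWith.of_dist_le_mul fun a b => ?_
    rw [Real.dist_eq, neg_sub_neg, dist_eq_norm, abs_sub_comm]
    refine (lipschitz_sqrt_one_sub_sq (le_min (norm_nonneg _) (by norm_num)) (min_le_right _ _)
      (le_min (norm_nonneg _) (by norm_num)) (min_le_right _ _)).trans ?_
    refine (abs_min_sub_min_le_max _ _ _ _).trans ?_
    rw [sub_self, abs_zero, max_eq_left (abs_nonneg _), NNReal.coe_one, one_mul]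
    exact abs_norm_sub_norm_le a b
  · set u : E n := -x₀ with hu
    have hu1 : ‖u‖ = 1 := by rw [hu, norm_neg, hx1]
    set P := (ℝ ∙ u)ᗮ.orthogonalProjectionOnto with hP
    have hdec : ∀ z : E n, ‖z‖ ^ 2 = ⟪u, z⟫ ^ 2 + ‖P z‖ ^ 2 := by
      intro z
      have h := Submodule.norm_sq_eq_add_norm_sq_projection z (ℝ ∙ u)
      rw [h]
      congr 1
      have h2 : ‖(ℝ ∙ u).orthogonalProjectionOnto z‖ = |⟪u, z⟫| := by
        change ‖((ℝ ∙ u).orthogonalProjectionOnto z : E n)‖ = _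
        rw [Submodule.coe_orthogonalProjectionOnto_apply,
          Submodule.starProjection_unit_singleton ℝ hu1, norm_smul, hu1, mul_one, Real.norm_eq_abs]
      rw [h2, sq_abs]
    have hPx0 : P x₀ = 0 := by
      have h := hdec x₀
      have : ⟪u, x₀⟫ = -1 := by
        rw [hu, inner_neg_left, real_inner_self_eq_norm_sq, hx1]; norm_num
      rw [this, hx1] at h
      have : ‖P x₀‖ ^ 2 = 0 := by linarith
      simpa using this
    have hxb : ‖x - x₀‖ < 1 / 2 := by rwa [mem_ball_iff_norm] at hx
    have hPx : ‖P x‖ ≤ 1 / 2 := by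
      have h1 : P x = P (x - x₀) := by rw [map_sub, hPx0, sub_zero]
      have h2 := hdec (x - x₀)
      rw [← h1] at h2
      have h3 : ‖P x‖ ^ 2 ≤ (1 / 2) ^ 2 := by nlinarith [sq_nonneg ⟪u, x - x₀⟫, norm_nonneg (x - x₀)]
      exact le_of_sq_le_sq h3 (by norm_num)
    have hux : ⟪u, x⟫ < 0 := by
      have h1 : ⟪u, x⟫ = -1 + ⟪u, x - x₀⟫ := by
        rw [inner_sub_right, hu, inner_neg_left, inner_neg_left, real_inner_self_eq_norm_sq, hx1]
        ring
      have h2 := (abs_le.1 (abs_real_inner_le_norm u (x - x₀))).2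
      rw [hu1] at h2
      linarith
    have hnn : 0 ≤ 1 - ‖P x‖ ^ 2 := by nlinarith [norm_nonneg (P x)]
    change x ∈ Metric.ball 0 1 ↔ -√(1 - min ‖P x‖ (1 / 2) ^ 2) < ⟪u, x⟫
    rw [min_eq_left hPx, mem_ball_zero_iff, neg_lt, Real.lt_sqrt (by linarith)]
    have := hdec x
    constructor
    · intro h
      nlinarith [norm_nonneg x]
    · intro h
      nlinarith [norm_nonneg x]

/-- The divergence theorem for the field x on the unit ball: divergence d + 1, flux density 1. The
bump only makes the support compact and is 1 around the closed ball. This links the Hausdorff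
normalisation with the volume constant of polar coordinates. -/
theorem sphereArea_eq (d : ℕ) :
    sphereArea (d + 1) = (d + 1) * (volume (Metric.ball (0 : E (d + 1)) 1)).toReal := by
  let ψ : ContDiffBump (0 : E (d + 1)) := ⟨2, 3, by norm_num, by norm_num⟩
  have hψ : ContDiff ℝ 1 ψ := ψ.contDiff
  have hψd := hψ.differentiable one_ne_zero
  let F : E (d + 1) → E (d + 1) := fun x => ψ x • x
  have hF : Differentiable ℝ F := hψd.fun_smul differentiable_id
  have hFc : HasCompactSupport F :=
    HasCompactSupport.intro ψ.hasCompactSupport.isCompact fun x hx => by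
      simp [F, image_eq_zero_of_notMem_tsupport hx]
  have hid : ∀ x : E (d + 1), divergence (fun x => x) x = d + 1 := by
    intro x
    simp [divergence, e]
  have hdivF : ∀ x, divergence F x = ψ x * (d + 1) + fderiv ℝ ψ x x := by
    intro x
    rw [← hid x]
    exact divergence_smul (hψd x) differentiableAt_id
  have hcont : Continuous (divergence F) := by
    rw [funext hdivF]
    have h1 := hψ.continuous_fderiv one_ne_zero
    have h2 := hψ.continuous
    fun_prop
  have h := integral_inner_outerNormal Metric.isOpen_ball hasLipschitzBoundary_ball hF hFc hcont
  rw [frontier_ball (0 : E (d + 1)) one_ne_zero] at h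
  have hl : ∫ x in Metric.sphere (0 : E (d + 1)) 1, ⟪F x, outerNormal (Metric.ball 0 1) x⟫
      ∂(Measure.euclideanHausdorffMeasure d) = sphereArea (d + 1) := by
    have h1 : ∀ x ∈ Metric.sphere (0 : E (d + 1)) 1,
        ⟪F x, outerNormal (Metric.ball 0 1) x⟫ = (1 : ℝ) := by
      intro x hx
      have hx1 : ‖x‖ = 1 := by simpa using hx
      have h2 : ψ x = 1 := ψ.one_of_mem_closedBall (by
        rw [mem_closedBall_zero_iff, hx1]; norm_num [ψ])
      rw [(isOuterNormal_ball hx1).outerNormal_eq]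
      simp only [F]
      rw [h2, one_smul, real_inner_self_eq_norm_sq, hx1]
      norm_num
    rw [setIntegral_congr_fun Metric.isClosed_sphere.measurableSet h1]
    simp [sphereArea, Measure.real]
  have hr : ∫ x in Metric.ball (0 : E (d + 1)) 1, divergence F x =
      (d + 1) * (volume (Metric.ball (0 : E (d + 1)) 1)).toReal := by
    have h1 : ∀ x ∈ Metric.ball (0 : E (d + 1)) 1, divergence F x = (d : ℝ) + 1 := by
      intro x hx
      have hx' : x ∈ Metric.ball (0 : E (d + 1)) 2 := Metric.ball_subset_ball (by norm_num) hx
      have h2 : (ψ : E (d + 1) → ℝ) =ᶠ[𝓝 x] fun _ => 1 := ψ.eventuallyEq_one_of_mem_ball hx'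
      rw [hdivF, h2.fderiv_eq, h2.eq_of_nhds]
      simp
    rw [setIntegral_congr_fun Metric.isOpen_ball.measurableSet h1]
    simp [Measure.real, mul_comm]
  rw [← hl, ← hr]
  exact h

end Sphere

end HyperCyl
end

/-! ### Clifford algebra: conjugation and product identities. -/

noncomputable section
namespace HyperCyl
open Filter Topology
open scoped ENNReal RealInnerProductSpace

section Clifford

variable {n : ℕ}

/-- The inclusion of vectors as a continuous linear map. -/
def vecL : E n →L[ℝ] Cl n :=
  LinearMap.toContinuousLinearMap (CliffordAlgebra.ι (cliffordForm n))

theorem vecL_apply (x : E n) : vecL x = vec x := rfl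

theorem vec_add (x y : E n) : vec (x + y) = vec x + vec y := map_add _ _ _

theorem vec_sub (x y : E n) : vec (x - y) = vec x - vec y := map_sub _ _ _

theorem vec_neg (x : E n) : vec (-x) = -vec x := map_neg _ _

theorem vec_smul (c : ℝ) (x : E n) : vec (c • x) = c • vec x := map_smul _ _ _

/-- Multiplication of `Cl_n` as a continuous bilinear map. -/
def mulL : Cl n →L[ℝ] Cl n →L[ℝ] Cl n :=
  (LinearMap.mul ℝ (Cl n)).toContinuousBilinearMap

theorem mulL_apply (a b : Cl n) : mulL a b = a * b := rfl

/-- The automorphism `*` as a continuous linear map. -/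
def conjL [NeZero n] : Cl n →L[ℝ] Cl n :=
  LinearMap.toContinuousLinearMap (conjCl (n := n)).toLinearMap

theorem conjL_apply [NeZero n] (a : Cl n) : conjL a = conjCl a := rfl

/-- The bilinear map `(a, b) ↦ (v ↦ a v b)`. -/
def sandwich : Cl n →L[ℝ] Cl n →L[ℝ] E n →L[ℝ] Cl n :=
  (LinearMap.mk₂ ℝ
    (fun a b : Cl n => ((mulL (n := n)).flip b).comp ((mulL a).comp vecL))
    (fun a a' b => by ext v; simp [mulL_apply, vecL_apply])
    (fun c a b => by ext v; simp [mulL_apply, vecL_apply])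
    (fun a b b' => by ext v; simp [mulL_apply, vecL_apply])
    (fun c a b => by ext v; simp [mulL_apply, vecL_apply])).toContinuousBilinearMap

theorem sandwich_apply (a b : Cl n) (v : E n) : sandwich a b v = a * vec v * b := rfl

theorem exists_norm_mul_le : ∃ C, 0 ≤ C ∧ ∀ a b : Cl n, ‖a * b‖ ≤ C * ‖a‖ * ‖b‖ :=
  ⟨‖mulL (n := n)‖, ContinuousLinearMap.opNorm_nonneg _, fun a b => (mulL (n := n)).le_opNorm₂ a b⟩

theorem vec_mul_self' (x : E n) : vec x * vec x = (-‖x‖ ^ 2) • (1 : Cl n) := by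
  rw [vec_mul_self, Algebra.algebraMap_eq_smul_one]

theorem vec_mul_vec_add_swap (x y : E n) :
    vec x * vec y + vec y * vec x = (-2 * ⟪x, y⟫) • (1 : Cl n) := by
  have h := vec_mul_self' (x + y)
  rw [vec_add, add_mul, mul_add, mul_add, vec_mul_self', vec_mul_self', norm_add_sq_real] at h
  have : vec x * vec y + vec y * vec x
      = (-(‖x‖ ^ 2 + 2 * ⟪x, y⟫ + ‖y‖ ^ 2)) • (1 : Cl n) + (‖x‖ ^ 2) • (1 : Cl n)
        + (‖y‖ ^ 2) • (1 : Cl n) := by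
    rw [← h]; module
  rw [this]
  module

theorem norm_e (i : Fin n) : ‖e i‖ = 1 := by simp [e]

theorem inner_e (x : E n) (i : Fin n) : ⟪x, e i⟫ = x i := by
  simp [e, EuclideanSpace.inner_single_right]

theorem vec_e_mul_self (i : Fin n) : vec (e i) * vec (e i) = (-1 : Cl n) := by
  rw [vec_mul_self', norm_e]; simp

theorem sum_smul_vec_e (x : E n) : ∑ i, x i • vec (e i) = vec x := by
  conv_rhs => rw [← (EuclideanSpace.basisFun (Fin n) ℝ).sum_repr x]
  simp only [← vecL_apply, map_sum, map_smul]
  simp [e]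

variable [NeZero n]

theorem conjVec_eq (x : E n) : conjVec x = x - (2 * x ⊤) • e ⊤ := by
  rw [conjVec, Submodule.reflection_orthogonal_apply, Submodule.reflection_singleton_apply, norm_e,
    real_inner_comm, inner_e]
  simp only [one_pow, RCLike.ofReal_real_eq_id, id, div_one]
  module

theorem conjVec_conjVec (x : E n) : conjVec (conjVec x) = x :=
  Submodule.reflection_reflection _ _

theorem conjVec_apply_top (x : E n) : conjVec x ⊤ = -x ⊤ := by
  rw [conjVec_eq]; simp [e]; ring

theorem conjVec_e_top : conjVec (e (⊤ : Fin n)) = -e ⊤ := by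
  rw [conjVec_eq]
  have : e (⊤ : Fin n) ⊤ = (1 : ℝ) := by simp [e]
  rw [this]; module

theorem conjVec_e_of_ne {i : Fin n} (hi : i ≠ ⊤) : conjVec (e i) = e i := by
  rw [conjVec_eq]
  have : e i (⊤ : Fin n) = (0 : ℝ) := by simp [e, hi.symm]
  rw [this]; simp

theorem norm_conjVec_sub (x y : E n) : ‖conjVec x - y‖ = ‖x - conjVec y‖ := by
  rw [← conjVec_conjVec y, ← map_sub, LinearIsometryEquiv.norm_map, conjVec_conjVec]

theorem norm_sub_conjVec_sq (x y : E n) :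
    ‖x - conjVec y‖ ^ 2 = ‖x - y‖ ^ 2 + 4 * x ⊤ * y ⊤ := by
  have : x - conjVec y = (x - y) + (2 * y ⊤) • e ⊤ := by rw [conjVec_eq]; module
  rw [this, norm_add_sq_real, real_inner_smul_right, inner_e, norm_smul, norm_e]
  simp only [Real.norm_eq_abs, mul_one, sq_abs, PiLp.sub_apply]
  ring

/-- Reflecting x exchanges its distances to y and y*, so facts on p₂ follow from facts on p₁. -/
theorem p₂_eq_p₁_conjVec (x y : E n) : p₂ x y = p₁ (conjVec x) y := by
  rw [p₂, p₁, ← map_sub, LinearIsometryEquiv.norm_map, norm_conjVec_sub, mul_comm]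

theorem conjCl_conjCl (a : Cl n) : conjCl (conjCl a) = a := by
  have : (conjCl (n := n)).comp conjCl = AlgHom.id ℝ _ := by
    apply CliffordAlgebra.hom_ext
    ext x : 1
    change conjCl (conjCl (vec x)) = vec x
    rw [conjCl_vec, conjCl_vec, conjVec_conjVec]
  exact DFunLike.congr_fun this a

theorem conjCl_qPart (a : Cl n) : conjCl (qPart a) = qPart a := by
  rw [qPart, map_smul, map_add, conjCl_conjCl, add_comm]

/-- For a = P + eₙQ the conjugate is P - eₙQ. This is why f* in the second integral accounts for the
term Qf of the equation. -/
theorem sub_conjCl_eq (a : Cl n) : a - conjCl a = (2 : ℝ) • (vec (e ⊤) * qPart a) := by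
  have h1 : conjCl (vec (e (⊤ : Fin n))) = -vec (e ⊤) := by
    rw [conjCl_vec, conjVec_e_top, vec_neg]
  rw [qPart, map_neg, map_mul, h1, mul_smul_comm, smul_smul]
  simp only [mul_add, mul_neg, neg_mul, neg_neg, ← mul_assoc, vec_e_mul_self]
  norm_num
  rw [sub_eq_add_neg]

/-- The product `(x - y) (x - y*)` is unchanged under `x ↦ x*`. -/
theorem vec_mul_vec_conjVec (x y : E n) :
    vec (conjVec x - y) * vec (conjVec x - conjVec y) = vec (x - y) * vec (x - conjVec y) := by
  have h1 : conjVec x - y = (x - y) - (2 * x ⊤) • e ⊤ := by rw [conjVec_eq]; module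
  have h2 : conjVec x - conjVec y = (x - y) + (2 * y ⊤ - 2 * x ⊤) • e ⊤ := by
    rw [conjVec_eq, conjVec_eq]; module
  have h3 : x - conjVec y = (x - y) + (2 * y ⊤) • e ⊤ := by rw [conjVec_eq]; module
  have hs := vec_mul_vec_add_swap (x - y) (e ⊤)
  rw [inner_e] at hs
  have hs' := eq_sub_of_add_eq' hs
  rw [h1, h2, h3]
  simp only [vec_sub (x - y), vec_add (x - y), vec_smul, mul_add, sub_mul, mul_smul_comm,
    smul_mul_assoc, vec_mul_self', norm_e, hs', PiLp.sub_apply]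
  module

/-- Follows from x* - y = (x - y) - 2xₙeₙ and x - y* = (x - y) + 2yₙeₙ. After division by powers of
the distances the right side is a multiple of p₁ - p₂. -/
theorem two_smul_vec_mul_vec_mul_e (x y : E n) :
    (2 * x ⊤) • (vec (x - y) * vec (x - conjVec y) * vec (e ⊤))
      = -(‖x - conjVec y‖ ^ 2) • vec (x - y) + (‖x - y‖ ^ 2) • vec (conjVec x - y) := by
  have h1 : conjVec x - y = (x - y) - (2 * x ⊤) • e ⊤ := by rw [conjVec_eq]; module
  have h3 : x - conjVec y = (x - y) + (2 * y ⊤) • e ⊤ := by rw [conjVec_eq]; module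
  rw [norm_sub_conjVec_sq, h1, h3, vec_sub (x - y), vec_add (x - y), vec_smul, vec_smul, mul_add, mul_smul_comm,
    add_mul, vec_mul_self', smul_mul_assoc, smul_mul_assoc, mul_assoc (vec (x - y)),
    vec_e_mul_self, one_mul, mul_neg, mul_one]
  module

end Clifford

end HyperCyl
end

/-! ### Derivatives of the kernels and the divergence-free Cauchy form. -/

noncomputable section
namespace HyperCyl
open Filter Topology
open scoped ENNReal RealInnerProductSpace

section KernelDerivative

variable {n : ℕ}

theorem hasFDerivAt_norm_sub_pow {a x : E n} (hx : x ≠ a) (p : ℕ) :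
    HasFDerivAt (fun x : E n => ‖x - a‖ ^ p)
      ((p * ‖x - a‖ ^ p / ‖x - a‖ ^ 2) • innerSL ℝ (x - a)) x := by
  have hr : ‖x - a‖ ≠ 0 := norm_ne_zero_iff.2 (sub_ne_zero.2 hx)
  have h1 : HasFDerivAt (fun x : E n => ‖x - a‖ ^ 2) (2 • innerSL ℝ (x - a)) x := by
    refine ((hasStrictFDerivAt_norm_sq (x - a)).hasFDerivAt.comp x
      ((hasFDerivAt_id x).sub_const a)).congr_fderiv ?_
    ext v
    simp
  have h2 := h1.sqrt (pow_ne_zero 2 hr)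
  simp only [Real.sqrt_sq (norm_nonneg _)] at h2
  refine (h2.pow p).congr_fderiv ?_
  ext v
  simp only [smul_apply, innerSL_apply_apply, nsmul_eq_mul, smul_eq_mul]
  rcases p with _ | p
  · simp
  · simp only [Nat.add_sub_cancel]
    push_cast
    field_simp
    ring

theorem hasFDerivAt_inv_norm_pow_mul {a b x : E n} (ha : x ≠ a) (hb : x ≠ b) (p q : ℕ) :
    HasFDerivAt (fun x : E n => (‖x - a‖ ^ p * ‖x - b‖ ^ q)⁻¹)
      (-((‖x - a‖ ^ p * ‖x - b‖ ^ q)⁻¹ • ((p / ‖x - a‖ ^ 2) • innerSL ℝ (x - a)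
        + (q / ‖x - b‖ ^ 2) • innerSL ℝ (x - b)))) x := by
  have hr : ‖x - a‖ ≠ 0 := norm_ne_zero_iff.2 (sub_ne_zero.2 ha)
  have hs : ‖x - b‖ ≠ 0 := norm_ne_zero_iff.2 (sub_ne_zero.2 hb)
  have h := (hasFDerivAt_norm_sub_pow ha p).mul (hasFDerivAt_norm_sub_pow hb q)
  have h0 : ‖x - a‖ ^ p * ‖x - b‖ ^ q ≠ 0 := mul_ne_zero (pow_ne_zero _ hr) (pow_ne_zero _ hs)
  refine ((hasDerivAt_inv h0).comp_hasFDerivAt x h).congr_fderiv ?_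
  ext v
  simp only [smul_apply, add_apply, neg_apply, innerSL_apply_apply, smul_eq_mul]
  field_simp
  ring

theorem sum_smul_mul_vec_e (c : E n) (a : Cl n) :
    ∑ i, (c i • a) * vec (e i) = a * vec c := by
  rw [← sum_smul_vec_e c, Finset.mul_sum]
  simp

variable [NeZero n]

theorem p₁_eq (hn : 2 ≤ n) (x y : E n) :
    p₁ x y = -((‖x - y‖ ^ n * ‖x - conjVec y‖ ^ (n - 2))⁻¹ • vec (x - y)) := by
  rw [p₁, vecInv, vec_neg, vec_smul, smul_neg, smul_smul, ← mul_inv]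
  congr 3
  obtain ⟨q, rfl⟩ := Nat.exists_eq_add_of_le' hn
  rw [Nat.add_sub_cancel]
  ring

theorem hasFDerivAt_p₁ (hn : 2 ≤ n) {x y : E n} (h1 : x ≠ y) (h2 : x ≠ conjVec y) :
    HasFDerivAt (fun x => p₁ x y)
      (-((‖x - y‖ ^ n * ‖x - conjVec y‖ ^ (n - 2))⁻¹ • vecL
        + (-((‖x - y‖ ^ n * ‖x - conjVec y‖ ^ (n - 2))⁻¹ •
          (((n : ℕ) / ‖x - y‖ ^ 2) • innerSL ℝ (x - y)
          + ((n - 2 : ℕ) / ‖x - conjVec y‖ ^ 2) • innerSL ℝ (x - conjVec y)))).smulRight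
            (vec (x - y)))) x := by
  have hv : HasFDerivAt (fun x : E n => vec (x - y)) vecL x :=
    vecL.hasFDerivAt.comp x ((hasFDerivAt_id x).sub_const y)
  have := ((hasFDerivAt_inv_norm_pow_mul h1 h2 n (n - 2)).smul hv).neg
  refine this.congr_of_eventuallyEq (Eventually.of_forall fun z => ?_)
  exact p₁_eq hn z y

/-- Without the factor in ‖x - y*‖, p₁ is the Euclidean Cauchy kernel, which is annihilated by D
acting from the right. Only the derivative of ‖x - y*‖^(2-n) survives. -/
theorem sum_fderiv_p₁_mul_vec_e (hn : 2 ≤ n) {x y : E n} (h1 : x ≠ y) (h2 : x ≠ conjVec y) :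
    ∑ i, fderiv ℝ (fun x => p₁ x y) x (e i) * vec (e i)
      = ((n - 2) * (‖x - y‖ ^ n * ‖x - conjVec y‖ ^ n)⁻¹) •
        (vec (x - y) * vec (x - conjVec y)) := by
  have hr : ‖x - y‖ ≠ 0 := norm_ne_zero_iff.2 (sub_ne_zero.2 h1)
  have hs : ‖x - conjVec y‖ ≠ 0 := norm_ne_zero_iff.2 (sub_ne_zero.2 h2)
  rw [(hasFDerivAt_p₁ hn h1 h2).fderiv]
  set g := (‖x - y‖ ^ n * ‖x - conjVec y‖ ^ (n - 2))⁻¹ with hg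
  set A := x - y with hA
  set B := x - conjVec y with hB
  have hterm : ∀ i : Fin n, (-(g • vecL + (-(g • (((n : ℕ) / ‖A‖ ^ 2) • innerSL ℝ A
      + ((n - 2 : ℕ) / ‖B‖ ^ 2) • innerSL ℝ B))).smulRight (vec A)) : E n →L[ℝ] Cl n) (e i) * vec (e i)
      = g • (1 : Cl n) + (((g * (n / ‖A‖ ^ 2)) • A + (g * ((n - 2 : ℕ) / ‖B‖ ^ 2)) • B) i • vec A)
        * vec (e i) := by
    intro i
    simp only [neg_apply, add_apply, smul_apply,
      ContinuousLinearMap.smulRight_apply, innerSL_apply_apply, inner_e, vecL_apply, neg_mul,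
      add_mul, smul_mul_assoc, vec_e_mul_self, PiLp.add_apply, PiLp.smul_apply, smul_eq_mul]
    module
  rw [Finset.sum_congr rfl fun i _ => hterm i, Finset.sum_add_distrib, sum_smul_mul_vec_e,
    vec_add, vec_smul, vec_smul, mul_add, mul_smul_comm, mul_smul_comm, vec_mul_self',
    Finset.sum_const, Finset.card_univ, Fintype.card_fin, ← Nat.cast_smul_eq_nsmul ℝ, smul_smul,
    smul_smul, ← add_assoc, ← add_smul]
  -- The cancellation for the Euclidean Cauchy kernel: n from the sum of the eᵢeᵢ against the
  -- derivative of ‖x - y‖^(-n).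
  have h0 : (n : ℝ) * g + g * (n / ‖A‖ ^ 2) * -‖A‖ ^ 2 = 0 := by field_simp; ring
  rw [h0, zero_smul, zero_add]
  congr 1
  rw [Nat.cast_sub hn, hg]
  obtain ⟨q, rfl⟩ := Nat.exists_eq_add_of_le' hn
  rw [Nat.add_sub_cancel]
  push_cast
  field_simp
  ring

/-- The Clifford-valued linear form `v ↦ p₁ v f - p₂ v* f*` of the Cauchy formula. -/
def kernelForm (f : E n → Cl n) (y x : E n) : E n →L[ℝ] Cl n :=
  sandwich (p₁ x y) (f x) -
    (sandwich (p₂ x y) (conjCl (f x))).comp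
      (conjVec (n := n)).toContinuousLinearEquiv.toContinuousLinearMap

theorem kernelForm_apply (f : E n → Cl n) (y x v : E n) :
    kernelForm f y x v = p₁ x y * vec v * f x - p₂ x y * conjCl (vec v) * conjCl (f x) := by
  rw [conjCl_vec]; rfl

theorem hasFDerivAt_p₂ {x y : E n} (hn : 2 ≤ n) (h1 : x ≠ y) (h2 : x ≠ conjVec y) :
    HasFDerivAt (fun x => p₂ x y)
      ((fderiv ℝ (fun x => p₁ x y) (conjVec x)).comp
        (conjVec (n := n)).toContinuousLinearEquiv.toContinuousLinearMap) x := by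
  have h1' : conjVec x ≠ y := fun h => h2 (by rw [← h, conjVec_conjVec])
  have h2' : conjVec x ≠ conjVec y := fun h => h1 (conjVec.injective h)
  have h := (hasFDerivAt_p₁ hn h1' h2').differentiableAt.hasFDerivAt.comp x
    (conjVec (n := n)).toContinuousLinearEquiv.toContinuousLinearMap.hasFDerivAt
  refine h.congr_of_eventuallyEq (Eventually.of_forall fun z => ?_)
  exact p₂_eq_p₁_conjVec z y

/-- By reflection the left side is the sum for p₁ at x*. Its closed form involves only the product
of the two distances and (x - y)(x - y*), both invariant under x ↦ x*. -/
theorem sum_fderiv_p₂_mul_vec_e (hn : 2 ≤ n) {x y : E n} (h1 : x ≠ y) (h2 : x ≠ conjVec y) :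
    ∑ i, fderiv ℝ (fun x => p₂ x y) x (e i) * vec (conjVec (e i))
      = ∑ i, fderiv ℝ (fun x => p₁ x y) x (e i) * vec (e i) := by
  have h1' : conjVec x ≠ y := fun h => h2 (by rw [← h, conjVec_conjVec])
  have h2' : conjVec x ≠ conjVec y := fun h => h1 (conjVec.injective h)
  rw [(hasFDerivAt_p₂ hn h1 h2).fderiv]
  have : ∀ i, ((fderiv ℝ (fun x => p₁ x y) (conjVec x)).comp
      (conjVec (n := n)).toContinuousLinearEquiv.toContinuousLinearMap) (e i)
        * vec (conjVec (e i)) = fderiv ℝ (fun x => p₁ x y) (conjVec x) (e i) * vec (e i) := by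
    intro i
    change fderiv ℝ (fun x => p₁ x y) (conjVec x) (conjVec (e i)) * _ = _
    by_cases hi : i = ⊤
    · rw [hi, conjVec_e_top, map_neg, vec_neg, neg_mul_neg]
    · rw [conjVec_e_of_ne hi]
  rw [Finset.sum_congr rfl fun i _ => this i, sum_fderiv_p₁_mul_vec_e hn h1' h2',
    sum_fderiv_p₁_mul_vec_e hn h1 h2, vec_mul_vec_conjVec, norm_conjVec_sub, ← map_sub,
    LinearIsometryEquiv.norm_map, mul_comm (‖x - y‖ ^ n)]

/-- Combined with f - f* = 2eₙQf, this brings out the same coefficient (n - 2)/xₙ as in the equation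
for f. -/
theorem two_smul_sum_fderiv_p₁ (hn : 2 ≤ n) {x y : E n} (h1 : x ≠ y) (h2 : x ≠ conjVec y)
    (hx : x ⊤ ≠ 0) :
    (2 : ℝ) • ((∑ i, fderiv ℝ (fun x => p₁ x y) x (e i) * vec (e i)) * vec (e ⊤))
      = (((n : ℝ) - 2) / x ⊤) • (p₁ x y - p₂ x y) := by
  have hr : ‖x - y‖ ≠ 0 := norm_ne_zero_iff.2 (sub_ne_zero.2 h1)
  have hs : ‖x - conjVec y‖ ≠ 0 := norm_ne_zero_iff.2 (sub_ne_zero.2 h2)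
  have hk := two_smul_vec_mul_vec_mul_e x y
  have hk' : vec (x - y) * vec (x - conjVec y) * vec (e ⊤) = (2 * x ⊤)⁻¹ •
      (-(‖x - conjVec y‖ ^ 2) • vec (x - y) + (‖x - y‖ ^ 2) • vec (conjVec x - y)) := by
    rw [← hk, smul_smul, inv_mul_cancel₀ (by simpa using hx), one_smul]
  rw [sum_fderiv_p₁_mul_vec_e hn h1 h2, smul_mul_assoc, hk', p₂_eq_p₁_conjVec, p₁_eq hn, p₁_eq hn,
    norm_conjVec_sub, ← map_sub, LinearIsometryEquiv.norm_map]
  simp only [smul_smul, smul_add, sub_neg_eq_add, smul_neg, neg_smul]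
  rw [← neg_smul, ← neg_smul]
  obtain ⟨q, rfl⟩ := Nat.exists_eq_add_of_le' hn
  rw [Nat.add_sub_cancel]
  push_cast
  congr 2 <;> · field_simp
                ring

theorem dirac_eq_of_leftHypermonogenicOn {f : E n → Cl n} {U : Set (E n)}
    (hf : LeftHypermonogenicOn f U) {x : E n} (hxU : x ∈ U) (hx : x ⊤ ≠ 0) :
    dirac f x = -((((n : ℝ) - 2) / x ⊤) • qPart (f x)) := by
  have h := hf.2 x hxU
  have h2 := eq_neg_of_add_eq_zero_left h
  rw [div_eq_inv_mul, mul_smul, ← smul_neg, ← h2, smul_smul, inv_mul_cancel₀ hx, one_smul]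

theorem hasFDerivAt_kernelForm (hn : 2 ≤ n) {f : E n → Cl n} {x y : E n}
    (hf : DifferentiableAt ℝ f x) (h1 : x ≠ y) (h2 : x ≠ conjVec y) :
    ∃ D : E n →L[ℝ] E n →L[ℝ] Cl n, HasFDerivAt (kernelForm f y) D x ∧ ∀ v w, D v w =
      (fderiv ℝ (fun x => p₁ x y) x v * vec w * f x + p₁ x y * vec w * fderiv ℝ f x v) -
      (fderiv ℝ (fun x => p₂ x y) x v * vec (conjVec w) * conjCl (f x)
        + p₂ x y * vec (conjVec w) * conjCl (fderiv ℝ f x v)) := by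
  have hp₁ := (hasFDerivAt_p₁ hn h1 h2).differentiableAt.hasFDerivAt
  have hp₂ := (hasFDerivAt_p₂ hn h1 h2).differentiableAt.hasFDerivAt
  have hcf : HasFDerivAt (fun x => conjCl (f x)) (conjL.comp (fderiv ℝ f x)) x :=
    conjL.hasFDerivAt.comp x hf.hasFDerivAt
  have a1 := (sandwich (n := n)).hasFDerivAt_of_bilinear hp₁ hf.hasFDerivAt
  have a2 := (sandwich (n := n)).hasFDerivAt_of_bilinear hp₂ hcf
  have a3 := (((ContinuousLinearMap.compL ℝ (E n) (E n) (Cl n)).flip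
    (conjVec (n := n)).toContinuousLinearEquiv.toContinuousLinearMap).hasFDerivAt).comp x a2
  refine ⟨_, a1.sub a3, fun v w => ?_⟩
  simp [ContinuousLinearMap.precompR, ContinuousLinearMap.precompL, sandwich_apply, conjL_apply]
  abel

/-- Differentiated kernels contribute R(f - f*) = ((n-2)/xₙ)(p₁ - p₂)Qf. Differentiated f
contributes p₁Df - p₂(Df)*, the negative of this, because Df = -((n-2)/xₙ)Qf and Qf is fixed by
conjugation. -/
theorem sum_fderiv_kernelForm (hn : 2 ≤ n) {f : E n → Cl n} {U : Set (E n)} (hU : IsOpen U)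
    (hf : LeftHypermonogenicOn f U) {x y : E n} (hxU : x ∈ U) (hx : x ⊤ ≠ 0)
    (h1 : x ≠ y) (h2 : x ≠ conjVec y) :
    ∑ i, fderiv ℝ (kernelForm f y) x (e i) (e i) = 0 := by
  have hfx : DifferentiableAt ℝ f x := (hf.1 x hxU).differentiableAt (hU.mem_nhds hxU)
  obtain ⟨D, hD, hDa⟩ := hasFDerivAt_kernelForm hn hfx h1 h2
  rw [hD.fderiv]
  simp only [hDa, Finset.sum_sub_distrib, Finset.sum_add_distrib, mul_assoc,
    ← Finset.mul_sum]
  simp only [← mul_assoc, ← Finset.sum_mul]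
  rw [sum_fderiv_p₂_mul_vec_e hn h1 h2]
  have hd : ∑ i, vec (e i) * fderiv ℝ f x (e i) = dirac f x := rfl
  have hd' : ∑ i, vec (conjVec (e i)) * conjCl (fderiv ℝ f x (e i)) = conjCl (dirac f x) := by
    simp only [dirac, map_sum, map_mul, conjCl_vec]
  have hsub := sub_conjCl_eq (f x)
  have hR := two_smul_sum_fderiv_p₁ hn h1 h2 hx
  rw [hd, hd', dirac_eq_of_leftHypermonogenicOn hf hxU hx, map_neg, map_smul, conjCl_qPart]
  set R := ∑ i, fderiv ℝ (fun x => p₁ x y) x (e i) * vec (e i)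
  have h3 : R * f x - R * conjCl (f x)
      = (((n : ℝ) - 2) / x ⊤) • ((p₁ x y - p₂ x y) * qPart (f x)) := by
    rw [← mul_sub, hsub, mul_smul_comm, ← mul_assoc, ← smul_mul_assoc, hR, smul_mul_assoc]
  rw [add_sub_add_comm, h3]
  simp only [mul_neg, mul_smul_comm, sub_mul, smul_sub]
  abel

end KernelDerivative

end HyperCyl
end

/-! ### The divergence theorem for the cut-off Cauchy form. -/

noncomputable section
namespace HyperCyl
open Filter Topology
open scoped ENNReal RealInnerProductSpace

section CauchyCutoff

theorem differentiable_fun_smul_of_tsupport {G H : Type*} [NormedAddCommGroup G] [NormedSpace ℝ G]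
    [NormedAddCommGroup H] [NormedSpace ℝ H] {ψ : G → ℝ} {V : G → H} (hψ : Differentiable ℝ ψ)
    (hV : ∀ x ∈ tsupport ψ, DifferentiableAt ℝ V x) : Differentiable ℝ fun x => ψ x • V x := by
  intro x
  by_cases hx : x ∈ tsupport ψ
  · exact (hψ x).fun_smul (hV x hx)
  · have h0 : (fun x => ψ x • V x) =ᶠ[𝓝 x] fun _ => 0 := by
      filter_upwards [notMem_tsupport_iff_eventuallyEq.1 hx] with z hz
      rw [hz]; simp
    exact (differentiableAt_const _).congr_of_eventuallyEq h0

theorem continuous_of_tsupport {X H : Type*} [TopologicalSpace X] [TopologicalSpace H] [Zero H]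
    {g : X → H} {s : Set X} (hs : IsClosed s) (h0 : ∀ x ∉ s, g x = 0)
    (hg : ∀ x ∈ s, ContinuousAt g x) : Continuous g := by
  rw [continuous_iff_continuousAt]
  intro x
  by_cases hx : x ∈ s
  · exact hg x hx
  · have : g =ᶠ[𝓝 x] fun _ => 0 := by
      filter_upwards [hs.isOpen_compl.mem_nhds hx] with z hz using h0 z hz
    exact continuousAt_const.congr this.symm

variable {d : ℕ} [NeZero (d + 1)]

/-- Only the gradient of the cutoff remains, so the divergence is continuous although the derivative
of f need not be. This meets the hypothesis of `integral_apply_outerNormal`. -/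
theorem sum_fderiv_smul_kernelForm (hd : 2 ≤ d + 1) {f : E (d + 1) → Cl (d + 1)}
    {U : Set (E (d + 1))} (hU : IsOpen U) (hf : LeftHypermonogenicOn f U)
    (hU0 : ∀ x ∈ U, x ⊤ ≠ 0) {y : E (d + 1)} {ψ : E (d + 1) → ℝ} (hψ : Differentiable ℝ ψ)
    (hsub : tsupport ψ ⊆ U \ {y, conjVec y}) (x : E (d + 1)) :
    ∑ i, fderiv ℝ (fun x => ψ x • kernelForm f y x) x (e i) (e i)
      = ∑ i, fderiv ℝ ψ x (e i) • kernelForm f y x (e i) := by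
  by_cases hx : x ∈ tsupport ψ
  · have h := hsub hx
    have hxy : x ≠ y := fun h' => h.2 (by simp [h'])
    have hxy' : x ≠ conjVec y := fun h' => h.2 (by simp [h'])
    obtain ⟨D, hD, -⟩ := hasFDerivAt_kernelForm hd
      ((hf.1 x h.1).differentiableAt (hU.mem_nhds h.1)) hxy hxy'
    have h0 := sum_fderiv_kernelForm hd hU hf h.1 (hU0 x h.1) hxy hxy'
    rw [((hψ x).hasFDerivAt.fun_smul hD).fderiv]
    rw [hD.fderiv] at h0
    simp only [add_apply, smul_apply, ContinuousLinearMap.smulRight_apply, Finset.sum_add_distrib,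
      ← Finset.smul_sum, h0, smul_zero, zero_add]
  · have h1 := notMem_tsupport_iff_eventuallyEq.1 hx
    have h0 : (fun x => ψ x • kernelForm f y x) =ᶠ[𝓝 x] fun _ => 0 := by
      filter_upwards [h1] with z hz
      rw [hz]; simp
    rw [h0.fderiv_eq, h1.fderiv_eq]
    simp

theorem integral_frontier_smul_kernelForm (hd : 2 ≤ d + 1) {K : Set (E (d + 1))} (hKo : IsOpen K)
    (hK : HasLipschitzBoundary K) {f : E (d + 1) → Cl (d + 1)}
    {U : Set (E (d + 1))} (hU : IsOpen U) (hf : LeftHypermonogenicOn f U)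
    (hU0 : ∀ x ∈ U, x ⊤ ≠ 0) {y : E (d + 1)} {ψ : E (d + 1) → ℝ} (hψ : ContDiff ℝ 1 ψ)
    (hc : HasCompactSupport ψ) (hsub : tsupport ψ ⊆ U \ {y, conjVec y}) :
    ∫ x in frontier K, ψ x • kernelForm f y x (outerNormal K x)
        ∂(Measure.euclideanHausdorffMeasure d)
      = ∫ x in K, ∑ i, fderiv ℝ ψ x (e i) • kernelForm f y x (e i) := by
  have hψd := hψ.differentiable one_ne_zero
  have hVd : ∀ x ∈ tsupport ψ, DifferentiableAt ℝ (kernelForm f y) x := by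
    intro x hx
    have h := hsub hx
    have hxy : x ≠ y := fun h' => h.2 (by simp [h'])
    have hxy' : x ≠ conjVec y := fun h' => h.2 (by simp [h'])
    obtain ⟨D, hD, -⟩ := hasFDerivAt_kernelForm hd
      ((hf.1 x h.1).differentiableAt (hU.mem_nhds h.1)) hxy hxy'
    exact hD.differentiableAt
  have hdiff := differentiable_fun_smul_of_tsupport hψd hVd
  have hcs : HasCompactSupport fun x => ψ x • kernelForm f y x :=
    HasCompactSupport.intro hc.isCompact fun x hx => by
      simp [image_eq_zero_of_notMem_tsupport hx]
  have hdiv := sum_fderiv_smul_kernelForm hd hU hf hU0 hψd hsub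
  have hcont : Continuous fun x => ∑ i, fderiv ℝ ψ x (e i) • kernelForm f y x (e i) := by
    refine continuous_of_tsupport (isClosed_tsupport ψ) (fun x hx => ?_) fun x hx => ?_
    · rw [(notMem_tsupport_iff_eventuallyEq.1 hx).fderiv_eq]
      simp
    · refine tendsto_finsetSum _ fun i _ => ?_
      have h1 : ContinuousAt (fun x => fderiv ℝ ψ x (e i)) x :=
        ((hψ.continuous_fderiv one_ne_zero).clm_apply continuous_const).continuousAt
      have h2 : ContinuousAt (fun x => kernelForm f y x (e i)) x :=
        (hVd x hx).continuousAt.clm_apply continuousAt_const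
      exact h1.smul h2
  have h := integral_apply_outerNormal hKo hK hdiff hcs (by simpa only [hdiv] using hcont)
  simpa only [hdiv, smul_apply] using h

end CauchyCutoff

end HyperCyl
end

/-! ### The lattice, its fundamental cell and lattice sums. -/

noncomputable section
namespace HyperCyl
open Filter Topology
open scoped ENNReal RealInnerProductSpace

section Lattice

variable {n k : ℕ} {ω : Fin k → E n}

theorem latticePoint_eq (m : Fin k → ℤ) : latticePoint ω m = ∑ i, (m i : ℝ) • ω i := by
  simp only [latticePoint, Int.cast_smul_eq_zsmul]

theorem latticePoint_add (m m' : Fin k → ℤ) :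
    latticePoint ω (m + m') = latticePoint ω m + latticePoint ω m' := by
  simp [latticePoint, add_smul, Finset.sum_add_distrib]

theorem latticePoint_neg (m : Fin k → ℤ) : latticePoint ω (-m) = -latticePoint ω m := by
  simp [latticePoint]

theorem latticePoint_zero : latticePoint ω 0 = 0 := by simp [latticePoint]

theorem mem_lattice_iff {x : E n} : x ∈ lattice ω ↔ ∃ m, latticePoint ω m = x := by
  rw [lattice, AddSubgroup.mem_closure_range_iff_of_fintype]
  simp only [latticePoint, eq_comm]

theorem proj_eq_iff {x x' : E n} : proj ω x = proj ω x' ↔ ∃ m, x' = x + latticePoint ω m := by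
  rw [proj, proj, QuotientAddGroup.eq, mem_lattice_iff]
  constructor
  · rintro ⟨m, hm⟩
    exact ⟨m, by rw [hm]; abel⟩
  · rintro ⟨m, hm⟩
    exact ⟨m, by rw [hm]; abel⟩

theorem proj_add_latticePoint (x : E n) (m : Fin k → ℤ) :
    proj ω (x + latticePoint ω m) = proj ω x :=
  (proj_eq_iff.2 ⟨m, rfl⟩).symm

theorem latticeSign_mul_self (l : ℕ) (m : Fin k → ℤ) : latticeSign l m * latticeSign l m = 1 := by
  rw [latticeSign, ← mul_zpow]; simp

theorem abs_latticeSign (l : ℕ) (m : Fin k → ℤ) : |latticeSign l m| = 1 := by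
  rw [latticeSign, abs_zpow]; simp

theorem latticeSign_add (l : ℕ) (m m' : Fin k → ℤ) :
    latticeSign l (m + m') = latticeSign l m * latticeSign l m' := by
  rw [latticeSign, latticeSign, latticeSign, ← zpow_add₀ (by norm_num)]
  simp [Finset.sum_add_distrib]

theorem continuous_proj : Continuous (proj ω) := QuotientAddGroup.continuous_mk

theorem isOpenMap_proj : IsOpenMap (proj ω) := QuotientAddGroup.isOpenMap_coe

theorem measurable_proj : Measurable (proj ω) := measurable_quotient_mk''

theorem surjective_proj : Function.Surjective (proj ω) := Quotient.mk_surjective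

theorem preimage_proj_frontier (K' : Set (Cylinder ω)) :
    proj ω ⁻¹' frontier K' = frontier (proj ω ⁻¹' K') :=
  isOpenMap_proj.preimage_frontier_eq_frontier_preimage continuous_proj K'

theorem preimage_proj_closure (K' : Set (Cylinder ω)) :
    proj ω ⁻¹' closure K' = closure (proj ω ⁻¹' K') :=
  isOpenMap_proj.preimage_closure_eq_closure_preimage continuous_proj K'

/-- The lattice coordinates of the orthogonal projection to the span of the lattice. -/
def cellCoord (hω : LinearIndependent ℝ ω) : E n →L[ℝ] (Fin k → ℝ) :=
  LinearMap.toContinuousLinearMap ((Module.Basis.span hω).equivFun.toLinearMap ∘ₗ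
    ((Submodule.span ℝ (range ω)).orthogonalProjectionOnto).toLinearMap)

theorem cellCoord_add_of_orthogonal (hω : LinearIndependent ℝ ω) (t : Fin k → ℝ) {v : E n}
    (hv : ∀ i, ⟪v, ω i⟫ = 0) : cellCoord hω (∑ i, t i • ω i + v) = t := by
  have h1 : (Submodule.span ℝ (range ω)).orthogonalProjectionOnto v = 0 := by
    rw [Submodule.orthogonalProjectionOnto_eq_zero_iff, Submodule.mem_orthogonal']
    intro u hu
    induction hu using Submodule.span_induction with
    | mem x h => obtain ⟨i, rfl⟩ := h; exact hv i
    | zero => simp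
    | add x y _ _ hx hy => rw [inner_add_right, hx, hy, add_zero]
    | smul a x _ hx => rw [inner_smul_right, hx, mul_zero]
  have h2 : (Submodule.span ℝ (range ω)).orthogonalProjectionOnto (∑ i, t i • ω i)
      = ∑ i, t i • Module.Basis.span hω i := by
    rw [← Submodule.orthogonalProjectionOnto_mem_subspace_eq_self
      (∑ i, t i • Module.Basis.span hω i)]
    congr 1
    simp [Module.Basis.span_apply]
  change (Module.Basis.span hω).equivFun
    ((Submodule.span ℝ (range ω)).orthogonalProjectionOnto _) = t
  rw [map_add, h1, add_zero, h2, ← Module.Basis.equivFun_symm_apply, LinearEquiv.apply_symm_apply]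

theorem inner_sub_cellCoord (hω : LinearIndependent ℝ ω) (x : E n) (i : Fin k) :
    ⟪x - ∑ j, cellCoord hω x j • ω j, ω i⟫ = 0 := by
  have h : ∑ j, cellCoord hω x j • ω j
      = ((Submodule.span ℝ (range ω)).orthogonalProjectionOnto x : E n) := by
    have := (Module.Basis.span hω).sum_equivFun
      ((Submodule.span ℝ (range ω)).orthogonalProjectionOnto x)
    conv_rhs => rw [← this]
    simp [Module.Basis.span_apply, cellCoord]
  rw [h]
  exact Submodule.inner_left_of_mem_orthogonal (Submodule.subset_span (mem_range_self i))
    (Submodule.sub_starProjection_mem_orthogonal x)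

theorem mem_fundamentalCell_iff (hω : LinearIndependent ℝ ω) {x : E n} :
    x ∈ fundamentalCell ω ↔ ∀ i, 0 ≤ cellCoord hω x i ∧ cellCoord hω x i < 1 := by
  constructor
  · rintro ⟨t, v, ht, hv, rfl⟩
    rwa [cellCoord_add_of_orthogonal hω t hv]
  · intro h
    exact ⟨cellCoord hω x, x - ∑ j, cellCoord hω x j • ω j, h, inner_sub_cellCoord hω x,
      by abel⟩

theorem cellCoord_latticePoint (hω : LinearIndependent ℝ ω) (m : Fin k → ℤ) :
    cellCoord hω (latticePoint ω m) = fun i => (m i : ℝ) := by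
  have := cellCoord_add_of_orthogonal hω (fun i => (m i : ℝ)) (v := 0) (by simp)
  rwa [add_zero, ← latticePoint_eq] at this

theorem measurableSet_fundamentalCell (hω : LinearIndependent ℝ ω) :
    MeasurableSet (fundamentalCell ω) := by
  have h : fundamentalCell ω = cellCoord hω ⁻¹' (Set.pi univ fun _ => Ico 0 1) := by
    ext x
    simp [mem_fundamentalCell_iff hω]
  rw [h]
  exact (cellCoord hω).measurable (MeasurableSet.univ_pi fun _ => measurableSet_Ico)

/-- The integer parts of the lattice coordinates. -/
def cellFloor (hω : LinearIndependent ℝ ω) (x : E n) : Fin k → ℤ := fun i => ⌊cellCoord hω x i⌋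

theorem measurable_cellFloor (hω : LinearIndependent ℝ ω) : Measurable (cellFloor hω) :=
  measurable_pi_lambda _ fun i =>
    Int.measurable_floor.comp ((measurable_pi_apply i).comp (cellCoord hω).measurable)

theorem cellFloor_eq_iff (hω : LinearIndependent ℝ ω) {x : E n} {m : Fin k → ℤ} :
    cellFloor hω x = m ↔ x - latticePoint ω m ∈ fundamentalCell ω := by
  rw [mem_fundamentalCell_iff hω, funext_iff]
  refine forall_congr' fun i => ?_
  rw [cellFloor, Int.floor_eq_iff, map_sub, cellCoord_latticePoint]
  simp only [Pi.sub_apply, sub_nonneg]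
  constructor <;> rintro ⟨h1, h2⟩ <;> constructor <;> linarith

/-- The representative of `x` in the fundamental cell. -/
def cellFract (hω : LinearIndependent ℝ ω) (x : E n) : E n := x - latticePoint ω (cellFloor hω x)

theorem proj_cellFract (hω : LinearIndependent ℝ ω) (x : E n) :
    proj ω (cellFract hω x) = proj ω x := by
  rw [cellFract, sub_eq_add_neg, ← latticePoint_neg, proj_add_latticePoint]

theorem cellFract_of_mem (hω : LinearIndependent ℝ ω) {x : E n} (hx : x ∈ fundamentalCell ω) :
    cellFract hω x = x := by
  have : cellFloor hω x = 0 := (cellFloor_eq_iff hω).2 (by simpa [latticePoint_zero] using hx)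
  rw [cellFract, this, latticePoint_zero, sub_zero]

theorem cellFract_add (hω : LinearIndependent ℝ ω) (x : E n) (m : Fin k → ℤ) :
    cellFract hω (x + latticePoint ω m) = cellFract hω x := by
  have : cellFloor hω (x + latticePoint ω m) = cellFloor hω x + m := by
    rw [cellFloor_eq_iff, latticePoint_add, add_sub_add_right_eq_sub, ← cellFloor_eq_iff]
  rw [cellFract, cellFract, this, latticePoint_add, add_sub_add_right_eq_sub]

theorem cellFract_eq_of_proj_eq (hω : LinearIndependent ℝ ω) {x x' : E n}
    (h : proj ω x = proj ω x') : cellFract hω x = cellFract hω x' := by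
  obtain ⟨m, rfl⟩ := proj_eq_iff.1 h
  rw [cellFract_add]

theorem measurable_cellFract (hω : LinearIndependent ℝ ω) : Measurable (cellFract hω) :=
  measurable_id.sub ((measurable_of_countable (latticePoint ω)).comp (measurable_cellFloor hω))

/-- The section of the projection with values in the fundamental cell. -/
def cellSection (hω : LinearIndependent ℝ ω) (x' : Cylinder ω) : E n := cellFract hω x'.out

theorem proj_out (x' : Cylinder ω) : proj ω x'.out = x' := Quotient.out_eq' x'

theorem cellSection_proj (hω : LinearIndependent ℝ ω) (x : E n) :
    cellSection hω (proj ω x) = cellFract hω x :=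
  cellFract_eq_of_proj_eq hω (proj_out _)

theorem measurable_cellSection (hω : LinearIndependent ℝ ω) : Measurable (cellSection hω) := by
  refine measurable_from_quotient.2 ?_
  have : (cellSection hω) ∘ Quotient.mk'' = cellFract hω := by
    ext1 x; exact cellSection_proj hω x
  rw [this]
  exact measurable_cellFract hω

/-- The bounded part of the fundamental cell that meets the translates of a bounded set. -/
theorem exists_norm_le_of_mem_fundamentalCell (hω : LinearIndependent ℝ ω) (R : ℝ) :
    ∃ R₁, ∀ x ∈ fundamentalCell ω, ∀ m, ‖x + latticePoint ω m‖ ≤ R → ‖x‖ ≤ R₁ := by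
  -- D is the projection orthogonal to the lattice span. It ignores lattice translations, so D x is
  -- bounded through the translate of x; the remaining coordinates lie in [0, 1).
  set D : E n →L[ℝ] E n := ContinuousLinearMap.id ℝ (E n) -
    ∑ j, (((ContinuousLinearMap.proj j : (Fin k → ℝ) →L[ℝ] ℝ).comp (cellCoord hω)).smulRight (ω j))
    with hD
  have hDx : ∀ x, D x = x - ∑ j, cellCoord hω x j • ω j := by
    intro x
    simp [hD]
  refine ⟨‖D‖ * R + ∑ j, ‖ω j‖, fun x hx m hR => ?_⟩
  rw [mem_fundamentalCell_iff hω] at hx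
  have h1 : D (x + latticePoint ω m) = D x := by
    rw [map_add, hDx (latticePoint ω m), cellCoord_latticePoint, ← latticePoint_eq]
    simp
  have h2 : x = D x + ∑ j, cellCoord hω x j • ω j := by rw [hDx]; abel
  have h3 : ‖D x‖ ≤ ‖D‖ * R := by
    rw [← h1]; exact (D.le_opNorm _).trans (by gcongr)
  have h4 : ‖∑ j, cellCoord hω x j • ω j‖ ≤ ∑ j, ‖ω j‖ := by
    refine (norm_sum_le _ _).trans (Finset.sum_le_sum fun j _ => ?_)
    rw [norm_smul, Real.norm_eq_abs, abs_of_nonneg (hx j).1]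
    exact mul_le_of_le_one_left (norm_nonneg _) (hx j).2.le
  calc ‖x‖ = ‖D x + ∑ j, cellCoord hω x j • ω j‖ := by rw [← h2]
    _ ≤ _ := (norm_add_le _ _).trans (add_le_add h3 h4)

theorem summable_inv_norm_int_pow {p : ℕ} (hp : k < p) :
    Summable fun m : Fin k → ℤ => (‖(fun i => (m i : ℝ))‖⁻¹ : ℝ) ^ p := by
  let b := Pi.basisFun ℝ (Fin k)
  let L := Submodule.span ℤ (range b)
  have hr : Module.finrank ℤ L = k := by
    rw [ZLattice.rank ℝ L]; simp
  have hs := ZLattice.summable_norm_pow_inv L p (by rw [hr]; exact hp)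
  let g : (Fin k → ℤ) → L := fun m => ⟨fun i => (m i : ℝ), by
    have : (fun i => (m i : ℝ)) = ∑ i, m i • b i := by
      ext j
      simp [b, Finset.sum_apply, Pi.single_apply]
    rw [this]
    exact Submodule.sum_mem _ fun i _ =>
      Submodule.smul_mem _ _ (Submodule.subset_span (mem_range_self i))⟩
  have hg : Function.Injective g := by
    intro m m' h
    have h' := congrArg Subtype.val h
    ext i
    have : (m i : ℝ) = m' i := congrFun h' i
    exact_mod_cast this
  exact (hs.comp_injective hg).congr fun m => rfl

/-- Linear independence makes m a bounded linear function of the lattice point, which reduces the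
sum to ℤᵏ, where exponents above k converge. -/
theorem summable_inv_one_add_norm_latticePoint (hω : LinearIndependent ℝ ω) {p : ℕ} (hp : k < p) :
    Summable fun m : Fin k → ℤ => ((1 + ‖latticePoint ω m‖)⁻¹ : ℝ) ^ p := by
  have hs := ((summable_inv_norm_int_pow hp).mul_left ((‖cellCoord hω‖ + 1) ^ p))
  refine hs.of_norm_bounded_eventually ?_
  -- At m = 0 the inverse norm has the default value 0 and bounds nothing, so this index is set
  -- aside.
  have hfin : ({0} : Set (Fin k → ℤ)).Finite := finite_singleton 0
  filter_upwards [hfin.compl_mem_cofinite] with m hm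
  have hm0 : (fun i => (m i : ℝ)) ≠ 0 := by
    intro h
    refine hm ?_
    rw [mem_singleton_iff]
    ext i
    have : (m i : ℝ) = 0 := congrFun h i
    exact_mod_cast this
  have hpos := norm_pos_iff.2 hm0
  have h1 : ‖(fun i => (m i : ℝ))‖ ≤ (‖cellCoord hω‖ + 1) * (1 + ‖latticePoint ω m‖) := by
    rw [← cellCoord_latticePoint hω]
    refine ((cellCoord hω).le_opNorm _).trans ?_
    gcongr <;> linarith
  rw [Real.norm_of_nonneg (by positivity), ← mul_pow]
  gcongr
  rw [← div_eq_mul_inv, inv_eq_one_div, div_le_div_iff₀ (by positivity) hpos]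
  linarith

theorem lt_of_linearIndependent_of_apply_eq_zero (hω : LinearIndependent ℝ ω) {i₀ : Fin n}
    (h0 : ∀ i, ω i i₀ = 0) : k < n := by
  have h : LinearIndependent ℝ (Fin.cons (e i₀) ω : Fin (k + 1) → E n) := by
    rw [linearIndependent_finCons]
    refine ⟨hω, fun h => ?_⟩
    have h1 : ∀ v ∈ Submodule.span ℝ (range ω), v i₀ = 0 := by
      intro v hv
      induction hv using Submodule.span_induction with
      | mem x h => obtain ⟨i, rfl⟩ := h; exact h0 i
      | zero => simp
      | add x y _ _ hx hy => simp [hx, hy]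
      | smul a x _ hx => simp [hx]
    have := h1 _ h
    simp [e] at this
  have := h.fintype_card_le_finrank
  simpa using this

end Lattice

end HyperCyl
end

/-! ### Unfolding integrals from the fundamental cell. -/

noncomputable section
namespace HyperCyl
open Filter Topology
open scoped ENNReal RealInnerProductSpace

section Unfolding

variable {n k : ℕ} {ω : Fin k → E n}

/-- Translates of the cell tile space, each tile being a level set of `cellFloor`. Stated for any
translation invariant μ, since both Hausdorff measure on the boundary and Lebesgue measure on the
region are unfolded. -/
theorem sum_restrict_translate_fundamentalCell (hω : LinearIndependent ℝ ω) {μ : Measure (E n)}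
    (hμ : ∀ v : E n, MeasurePreserving (fun x => x + v) μ μ) {A : Set (E n)}
    (hA : MeasurableSet A) (hAinv : ∀ x m, x + latticePoint ω m ∈ A ↔ x ∈ A) :
    μ.restrict A = Measure.sum fun m : Fin k → ℤ =>
      (μ.restrict (A ∩ fundamentalCell ω)).map (fun x => x + latticePoint ω m) := by
  have h1 : A = ⋃ m : Fin k → ℤ, A ∩ cellFloor hω ⁻¹' {m} := by
    rw [← inter_iUnion]
    ext x; simp
  have hm : ∀ m, MeasurableSet (A ∩ cellFloor hω ⁻¹' {m}) := fun m =>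
    hA.inter (measurable_cellFloor hω (measurableSet_singleton m))
  have hd : Pairwise (Function.onFun Disjoint fun m => A ∩ cellFloor hω ⁻¹' {m}) := by
    intro m m' hmm
    rw [Function.onFun, Set.disjoint_left]
    rintro x ⟨-, hx⟩ ⟨-, hx'⟩
    rw [mem_preimage, mem_singleton_iff] at hx hx'
    exact hmm (hx.symm.trans hx')
  conv_lhs => rw [h1, Measure.restrict_iUnion hd hm]
  congr 1
  ext1 m
  have h2 : A ∩ fundamentalCell ω = (fun x => x + latticePoint ω m) ⁻¹'
      (A ∩ cellFloor hω ⁻¹' {m}) := by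
    ext x
    simp only [mem_inter_iff, mem_preimage, hAinv, mem_singleton_iff, cellFloor_eq_iff,
      add_sub_cancel_right]
  rw [h2, ((hμ (latticePoint ω m)).restrict_preimage (hm m)).map_eq]

variable {X : Type*} [NormedAddCommGroup X] [NormedSpace ℝ X]

theorem integral_eq_integral_fundamentalCell_tsum [CompleteSpace X]
    (hω : LinearIndependent ℝ ω) {μ : Measure (E n)}
    (hμ : ∀ v : E n, MeasurePreserving (fun x => x + v) μ μ) {A : Set (E n)}
    (hA : MeasurableSet A) (hAinv : ∀ x m, x + latticePoint ω m ∈ A ↔ x ∈ A) {g : E n → X}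
    (hg : AEStronglyMeasurable g (μ.restrict A)) {b : (Fin k → ℤ) → ℝ} (hb : Summable b)
    (hgb : ∀ x ∈ A ∩ fundamentalCell ω, ∀ m, ‖g (x + latticePoint ω m)‖ ≤ b m)
    (hfin : μ (A ∩ fundamentalCell ω) < ∞) :
    IntegrableOn g A μ ∧
      IntegrableOn (fun x => ∑' m, g (x + latticePoint ω m)) (A ∩ fundamentalCell ω) μ ∧
      ∫ x in A, g x ∂μ = ∫ x in A ∩ fundamentalCell ω, ∑' m, g (x + latticePoint ω m) ∂μ := by
  have hdec := sum_restrict_translate_fundamentalCell hω hμ hA hAinv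
  have hms := hA.inter (measurableSet_fundamentalCell hω)
  set ν := μ.restrict (A ∩ fundamentalCell ω) with hν
  have hνfin : IsFiniteMeasure ν := ⟨by rwa [hν, Measure.restrict_apply_univ]⟩
  have hτ : ∀ m, Measurable fun x : E n => x + latticePoint ω m := fun m => measurable_add_const _
  have hgm : ∀ m, AEStronglyMeasurable g (ν.map fun x => x + latticePoint ω m) := by
    intro m
    rw [hdec] at hg
    exact hg.mono_measure (Measure.le_sum _ m)
  have hgm' : ∀ m, AEStronglyMeasurable (fun x => g (x + latticePoint ω m)) ν := fun m =>
    (hgm m).comp_measurable (hτ m)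
  have hae : ∀ᵐ x ∂ν, ∀ m, ‖g (x + latticePoint ω m)‖ ≤ b m :=
    (ae_restrict_iff' hms).2 (Eventually.of_forall hgb)
  have hint : ∀ m, Integrable (fun x => g (x + latticePoint ω m)) ν := fun m =>
    (integrable_const (b m)).mono' (hgm' m) (hae.mono fun x hx => hx m)
  have hbound : ∀ m, ∫ x, ‖g (x + latticePoint ω m)‖ ∂ν ≤ b m * ν.real univ := by
    intro m
    have := integral_mono_ae (hint m).norm (integrable_const (b m)) (hae.mono fun x hx => hx m)
    rwa [integral_const, smul_eq_mul, mul_comm] at this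
  have hsum : Summable fun m => ∫ x, ‖g (x + latticePoint ω m)‖ ∂ν :=
    Summable.of_nonneg_of_le (fun m => integral_nonneg fun x => norm_nonneg _) hbound
      (hb.mul_right _)
  have hmapint : ∀ m, ∫ x, ‖g x‖ ∂(ν.map fun x => x + latticePoint ω m)
      = ∫ x, ‖g (x + latticePoint ω m)‖ ∂ν := fun m =>
    integral_map (hτ m).aemeasurable (hgm m).norm
  have hI : IntegrableOn g A μ := by
    rw [IntegrableOn, hdec]
    refine integrable_sum_measure (fun m => ?_) (by simpa only [hmapint] using hsum)
    exact (integrable_map_measure (hgm m) (hτ m).aemeasurable).2 (hint m)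
  refine ⟨hI, ?_, ?_⟩
  · have hmeas : AEStronglyMeasurable (fun x => ∑' m, g (x + latticePoint ω m)) ν := by
      refine aestronglyMeasurable_of_tendsto_ae (u := atTop)
        (f := fun s : Finset (Fin k → ℤ) => fun x => ∑ m ∈ s, g (x + latticePoint ω m))
        (fun s => Finset.aestronglyMeasurable_fun_sum s fun m _ => hgm' m) ?_
      filter_upwards [hae] with x hx
      exact (hb.of_norm_bounded hx).hasSum
    refine (integrable_const (∑' m, b m)).mono' hmeas ?_
    filter_upwards [hae] with x hx
    exact tsum_of_norm_bounded hb.hasSum hx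
  · have h1 : HasSum (fun m => ∫ x, g (x + latticePoint ω m) ∂ν) (∫ x in A, g x ∂μ) := by
      have h := hasSum_integral_measure (by rw [IntegrableOn, hdec] at hI; exact hI)
      rw [← hdec] at h
      have h2 : (fun m => ∫ x, g (x + latticePoint ω m) ∂ν)
          = fun m => ∫ x, g x ∂(ν.map fun x => x + latticePoint ω m) :=
        funext fun m => (integral_map (hτ m).aemeasurable (hgm m)).symm
      rw [h2]
      exact h
    exact h1.unique (hasSum_integral_of_summable_integral_norm hint hsum)

/-- The section into the fundamental cell is measurable and inverts the projection there. It
supplies measurability of G', which in the application is evaluated at arbitrarily chosen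
representatives. -/
theorem integrable_and_integral_surfaceMeasure (hω : LinearIndependent ℝ ω)
    {S' : Set (Cylinder ω)} (hS' : MeasurableSet S') {G : E n → X}
    (hG : IntegrableOn G (proj ω ⁻¹' S' ∩ fundamentalCell ω)
      (Measure.euclideanHausdorffMeasure (n - 1)))
    {G' : Cylinder ω → X} (hGG' : ∀ x, proj ω x ∈ S' → G' (proj ω x) = G x) :
    IntegrableOn G' S' (surfaceMeasure ω) ∧
      ∫ x' in S', G' x' ∂(surfaceMeasure ω) = ∫ x in proj ω ⁻¹' S' ∩ fundamentalCell ω, G x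
        ∂(Measure.euclideanHausdorffMeasure (n - 1)) := by
  set ν := (Measure.euclideanHausdorffMeasure (n - 1) : Measure (E n)).restrict
    (proj ω ⁻¹' S' ∩ fundamentalCell ω) with hν
  have hms := (measurable_proj hS').inter (measurableSet_fundamentalCell hω)
  have hmap : (surfaceMeasure ω).restrict S' = ν.map (proj ω) := by
    rw [surfaceMeasure, Measure.restrict_map measurable_proj hS',
      Measure.restrict_restrict (measurable_proj hS')]
  have hsec : ∀ᵐ x ∂ν, cellSection hω (proj ω x) = x := by
    refine (ae_restrict_iff' hms).2 (Eventually.of_forall fun x hx => ?_)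
    rw [cellSection_proj, cellFract_of_mem hω hx.2]
  have hback : (ν.map (proj ω)).map (cellSection hω) = ν := by
    rw [Measure.map_map (measurable_cellSection hω) measurable_proj]
    conv_rhs => rw [← Measure.map_id (μ := ν)]
    exact Measure.map_congr hsec
  have haeG : G' =ᵐ[ν.map (proj ω)] fun x' => G (cellSection hω x') := by
    rw [← hmap]
    refine (ae_restrict_iff' hS').2 (Eventually.of_forall fun x' hx' => ?_)
    have h1 : proj ω (cellSection hω x') = x' := by
      rw [cellSection, proj_cellFract, proj_out]
    have := hGG' (cellSection hω x') (by rwa [h1])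
    rwa [h1] at this
  have hGm : AEStronglyMeasurable G' (ν.map (proj ω)) := by
    refine AEStronglyMeasurable.congr ?_ haeG.symm
    refine AEStronglyMeasurable.comp_measurable ?_ (measurable_cellSection hω)
    rw [hback]
    exact hG.aestronglyMeasurable
  have hcomp : (G' ∘ proj ω) =ᵐ[ν] G := by
    refine (ae_restrict_iff' hms).2 (Eventually.of_forall fun x hx => hGG' x hx.1)
  constructor
  · rw [IntegrableOn, hmap, integrable_map_measure hGm measurable_proj.aemeasurable]
    exact (integrable_congr hcomp).2 hG
  · rw [hmap, integral_map measurable_proj.aemeasurable hGm]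
    exact integral_congr_ae hcomp

end Unfolding

end HyperCyl
end

/-! ### Decay of the kernels and geometry of the periodic region. -/

noncomputable section
namespace HyperCyl
open Filter Topology
open scoped ENNReal RealInnerProductSpace

section Decay

variable {n k : ℕ} {ω : Fin k → E n}

theorem exists_norm_vec_le : ∃ M, 0 ≤ M ∧ ∀ v : E n, ‖vec v‖ ≤ M * ‖v‖ :=
  ⟨‖vecL (n := n)‖, ContinuousLinearMap.opNorm_nonneg _, fun v => (vecL (n := n)).le_opNorm v⟩

theorem exists_norm_conjCl_le [NeZero n] : ∃ M, 0 ≤ M ∧ ∀ a : Cl n, ‖conjCl a‖ ≤ M * ‖a‖ :=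
  ⟨‖conjL (n := n)‖, ContinuousLinearMap.opNorm_nonneg _, fun v => (conjL (n := n)).le_opNorm v⟩

theorem exists_norm_p₁_le [NeZero n] (hn : 2 ≤ n) : ∃ M, 0 ≤ M ∧ ∀ z y : E n,
    ‖p₁ z y‖ ≤ M * (‖z - y‖⁻¹ ^ (n - 1) * ‖z - conjVec y‖⁻¹ ^ (n - 2)) := by
  obtain ⟨M, hM0, hM⟩ := exists_norm_vec_le (n := n)
  refine ⟨M, hM0, fun z y => ?_⟩
  obtain ⟨q, rfl⟩ := Nat.exists_eq_add_of_le' hn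
  rw [p₁_eq hn, norm_neg, norm_smul, Real.norm_of_nonneg (by positivity)]
  simp only [Nat.add_sub_cancel, show q + 2 - 1 = q + 1 by lia]
  -- At z = y both sides are 0 by the default value of the inverse.
  rcases eq_or_ne (‖z - y‖) 0 with h0 | h0
  · rw [h0]; simp
  · calc (‖z - y‖ ^ (q + 2) * ‖z - conjVec y‖ ^ q)⁻¹ * ‖vec (z - y)‖
        ≤ (‖z - y‖ ^ (q + 2) * ‖z - conjVec y‖ ^ q)⁻¹ * (M * ‖z - y‖) := by
          gcongr; exact hM _
      _ = _ := by
          rw [mul_inv, inv_pow, inv_pow, pow_succ ‖z - y‖ (q + 1), mul_inv]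
          field_simp

theorem exists_norm_p₂_le [NeZero n] (hn : 2 ≤ n) : ∃ M, 0 ≤ M ∧ ∀ z y : E n,
    ‖p₂ z y‖ ≤ M * (‖z - conjVec y‖⁻¹ ^ (n - 1) * ‖z - y‖⁻¹ ^ (n - 2)) := by
  obtain ⟨M, hM0, hM⟩ := exists_norm_p₁_le hn
  refine ⟨M, hM0, fun z y => ?_⟩
  have := hM (conjVec z) y
  rwa [← p₂_eq_p₁_conjVec, norm_conjVec_sub, ← map_sub, LinearIsometryEquiv.norm_map] at this

theorem norm_sub_le_norm_sub_conjVec [NeZero n] {z y : E n} (h : 0 ≤ z ⊤ * y ⊤) :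
    ‖z - y‖ ≤ ‖z - conjVec y‖ := by
  refine le_of_sq_le_sq ?_ (norm_nonneg _)
  rw [norm_sub_conjVec_sq]
  nlinarith

theorem inv_norm_sub_le {z y : E n} {ρ : ℝ} (hρ : 0 < ρ) (h : ρ ≤ ‖z - y‖) :
    ‖z - y‖⁻¹ ≤ ((1 + ‖y‖) / ρ + 1) * (1 + ‖z‖)⁻¹ := by
  have h0 : 0 < ‖z - y‖ := hρ.trans_le h
  have h1 : ‖z‖ ≤ ‖z - y‖ + ‖y‖ := by simpa using norm_add_le (z - y) y
  rw [inv_eq_one_div, ← div_eq_mul_inv, div_le_div_iff₀ h0 (by positivity)]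
  have h2 : 1 + ‖y‖ ≤ (1 + ‖y‖) / ρ * ‖z - y‖ := by
    rw [div_mul_eq_mul_div, le_div_iff₀ hρ]
    gcongr
  nlinarith

/-- On the side of y the distance to y* is no smaller than that to y, so one lower bound controls
both factors. The orders n - 1 and n - 2 add up to the decay exponent 2n - 3. -/
theorem exists_norm_p_le [NeZero n] (hn : 2 ≤ n) (y : E n) {ρ : ℝ} (hρ : 0 < ρ) :
    ∃ C, 0 ≤ C ∧ ∀ z : E n, ρ ≤ ‖z - y‖ → 0 ≤ z ⊤ * y ⊤ →
      ‖p₁ z y‖ ≤ C * (1 + ‖z‖)⁻¹ ^ (2 * n - 3) ∧ ‖p₂ z y‖ ≤ C * (1 + ‖z‖)⁻¹ ^ (2 * n - 3) := by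
  obtain ⟨M₁, hM₁0, hM₁⟩ := exists_norm_p₁_le hn
  obtain ⟨M₂, hM₂0, hM₂⟩ := exists_norm_p₂_le hn
  set c := (1 + ‖y‖) / ρ + 1 with hc
  have hc0 : 0 ≤ c := by positivity
  refine ⟨max M₁ M₂ * c ^ (2 * n - 3), by positivity, fun z hz hs => ?_⟩
  have h0 : 0 < ‖z - y‖ := hρ.trans_le hz
  have hr := inv_norm_sub_le hρ hz
  have hs : ‖z - conjVec y‖⁻¹ ≤ c * (1 + ‖z‖)⁻¹ :=
    (inv_anti₀ h0 (norm_sub_le_norm_sub_conjVec hs)).trans hr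
  rw [← hc] at hr
  have key : ∀ a b M : ℝ, 0 ≤ a → 0 ≤ b → 0 ≤ M → M ≤ max M₁ M₂ → a ≤ c * (1 + ‖z‖)⁻¹ →
      b ≤ c * (1 + ‖z‖)⁻¹ → M * (a ^ (n - 1) * b ^ (n - 2))
        ≤ max M₁ M₂ * c ^ (2 * n - 3) * (1 + ‖z‖)⁻¹ ^ (2 * n - 3) := by
    intro a b M ha hb hM0 hM hac hbc
    calc M * (a ^ (n - 1) * b ^ (n - 2))
        ≤ max M₁ M₂ * ((c * (1 + ‖z‖)⁻¹) ^ (n - 1) * (c * (1 + ‖z‖)⁻¹) ^ (n - 2)) := by gcongr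
      _ = _ := by
        rw [← pow_add, show n - 1 + (n - 2) = 2 * n - 3 by lia, mul_pow, mul_assoc]
  exact ⟨(hM₁ z y).trans (key _ _ _ (by positivity) (by positivity) hM₁0 (le_max_left _ _) hr hs),
    (hM₂ z y).trans (key _ _ _ (by positivity) (by positivity) hM₂0 (le_max_right _ _) hs hr)⟩

theorem inv_one_add_norm_add_le {x v : E n} {R : ℝ} (hx : ‖x‖ ≤ R) :
    (1 + ‖x + v‖)⁻¹ ≤ (1 + R) * (1 + ‖v‖)⁻¹ := by
  have h1 : ‖v‖ ≤ ‖x + v‖ + ‖x‖ := by simpa using norm_sub_le (x + v) x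
  have h0 := norm_nonneg x
  rw [inv_eq_one_div, ← div_eq_mul_inv, div_le_div_iff₀ (by positivity) (by positivity)]
  nlinarith [norm_nonneg (x + v)]

/-- Functions that decay faster than the rank of the lattice are summable over its translates. -/
theorem summable_translates_bound (hω : LinearIndependent ℝ ω) {p : ℕ} (hp : k < p) (C R : ℝ) :
    Summable fun m : Fin k → ℤ => C * ((1 + R) * (1 + ‖latticePoint ω m‖)⁻¹) ^ p := by
  have := ((summable_inv_one_add_norm_latticePoint hω hp).mul_left (C * (1 + R) ^ p))
  refine this.congr fun m => ?_
  rw [mul_pow, mul_assoc]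

variable {X : Type*} [NormedAddCommGroup X] [NormedSpace ℝ X] [CompleteSpace X]

theorem integral_eq_integral_fundamentalCell_tsum_of_decay (hω : LinearIndependent ℝ ω)
    {μ : Measure (E n)} (hμ : ∀ v : E n, MeasurePreserving (fun x => x + v) μ μ) {A : Set (E n)}
    (hA : MeasurableSet A) (hAinv : ∀ x m, x + latticePoint ω m ∈ A ↔ x ∈ A) {g : E n → X}
    (hg : AEStronglyMeasurable g (μ.restrict A)) {p : ℕ} (hp : k < p) {C R : ℝ} (hC : 0 ≤ C)
    (hgC : ∀ z ∈ A, ‖g z‖ ≤ C * (1 + ‖z‖)⁻¹ ^ p)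
    (hAR : ∀ x ∈ A, ∃ m, ‖x + latticePoint ω m‖ ≤ R)
    (hfin : ∀ r, μ (A ∩ Metric.closedBall 0 r) < ∞) :
    IntegrableOn g A μ ∧
      IntegrableOn (fun x => ∑' m, g (x + latticePoint ω m)) (A ∩ fundamentalCell ω) μ ∧
      ∫ x in A, g x ∂μ = ∫ x in A ∩ fundamentalCell ω, ∑' m, g (x + latticePoint ω m) ∂μ := by
  obtain ⟨R₁, hR₁⟩ := exists_norm_le_of_mem_fundamentalCell hω R
  have hb : ∀ x ∈ A ∩ fundamentalCell ω, ‖x‖ ≤ R₁ := by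
    rintro x ⟨hx, hxc⟩
    obtain ⟨m, hm⟩ := hAR x hx
    exact hR₁ x hxc m hm
  refine integral_eq_integral_fundamentalCell_tsum hω hμ hA hAinv hg
    (summable_translates_bound hω hp C R₁) (fun x hx m => ?_) ?_
  · refine (hgC _ ((hAinv x m).2 hx.1)).trans ?_
    gcongr
    exact inv_one_add_norm_add_le (hb x hx)
  · refine (measure_mono ?_).trans_lt (hfin R₁)
    exact fun x hx => ⟨hx.1, by simpa using hb x hx⟩

end Decay

section Geometry

variable {n k : ℕ} {ω : Fin k → E n}

theorem exists_norm_add_latticePoint_le {C' : Set (Cylinder ω)} (hC' : IsCompact C') :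
    ∃ R, ∀ x, proj ω x ∈ C' → ∃ m, ‖x + latticePoint ω m‖ ≤ R := by
  obtain ⟨N, hN⟩ := hC'.elim_directed_cover (fun N : ℕ => proj ω '' Metric.ball 0 N)
    (fun N => isOpenMap_proj _ Metric.isOpen_ball)
    (fun x' _ => by
      obtain ⟨x, rfl⟩ := surjective_proj x'
      obtain ⟨N, hN⟩ := exists_nat_gt ‖x‖
      exact mem_iUnion.2 ⟨N, x, by simpa using hN, rfl⟩)
    (directed_of_isDirected_le fun a b hab =>
      image_mono (Metric.ball_subset_ball (by exact_mod_cast hab)))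
  refine ⟨N, fun x hx => ?_⟩
  obtain ⟨x₀, hx₀, h⟩ := hN hx
  obtain ⟨m, hm⟩ := proj_eq_iff.1 h.symm
  exact ⟨m, by rw [← hm]; exact (mem_ball_zero_iff.1 hx₀).le⟩

theorem latticePoint_apply_eq_zero {i₀ : Fin n} (h0 : ∀ i, ω i i₀ = 0) (m : Fin k → ℤ) :
    latticePoint ω m i₀ = 0 := by
  rw [latticePoint_eq]
  simp [h0]

/-- The lattice lies in the hyperplane where this coordinate vanishes, so its sign is defined on the
cylinder. The images of the two half-spaces are disjoint open sets covering K'. -/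
theorem zero_lt_mul_of_isConnected {i₀ : Fin n} (h0 : ∀ i, ω i i₀ = 0) {K' : Set (Cylinder ω)}
    (hK' : IsConnected K') (hne : ∀ x, proj ω x ∈ K' → x i₀ ≠ 0) {x y : E n}
    (hx : proj ω x ∈ K') (hy : proj ω y ∈ K') : 0 < x i₀ * y i₀ := by
  by_contra! hcon
  have hlt := lt_of_le_of_ne hcon (mul_ne_zero (hne x hx) (hne y hy))
  have hc : Continuous fun x : E n => x i₀ := by fun_prop
  have ho1 : IsOpen (proj ω '' {x | 0 < x i₀}) := isOpenMap_proj _ (isOpen_lt continuous_const hc)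
  have ho2 : IsOpen (proj ω '' {x | x i₀ < 0}) := isOpenMap_proj _ (isOpen_lt hc continuous_const)
  have hcov : K' ⊆ proj ω '' {x | 0 < x i₀} ∪ proj ω '' {x | x i₀ < 0} := by
    intro x' hx'
    obtain ⟨z, rfl⟩ := surjective_proj x'
    rcases (hne z hx').lt_or_gt with h | h
    · exact Or.inr ⟨z, h, rfl⟩
    · exact Or.inl ⟨z, h, rfl⟩
  have hmeet : (K' ∩ proj ω '' {x | 0 < x i₀}).Nonempty ∧
      (K' ∩ proj ω '' {x | x i₀ < 0}).Nonempty := by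
    rcases mul_neg_iff.1 hlt with ⟨h1, h2⟩ | ⟨h1, h2⟩
    · exact ⟨⟨_, hx, x, h1, rfl⟩, ⟨_, hy, y, h2, rfl⟩⟩
    · exact ⟨⟨_, hy, y, h2, rfl⟩, ⟨_, hx, x, h1, rfl⟩⟩
  obtain ⟨z, -, ⟨a, ha, rfl⟩, ⟨b, hb, hab⟩⟩ :=
    hK'.isPreconnected _ _ ho1 ho2 hcov hmeet.1 hmeet.2
  obtain ⟨m, rfl⟩ := proj_eq_iff.1 hab
  have : (b + latticePoint ω m) i₀ = b i₀ := by
    rw [PiLp.add_apply, latticePoint_apply_eq_zero h0, add_zero]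
  rw [mem_ofPred_eq, this] at ha
  rw [mem_ofPred_eq] at hb
  exact lt_asymm ha hb

theorem exists_norm_le_of_isSpinorSection {l : ℕ} {U' C' : Set (Cylinder ω)} {f : E n → Cl n}
    (hf : IsSpinorSection ω l U' f) (hfc : ContinuousOn f (proj ω ⁻¹' U')) (hC' : IsCompact C')
    (hC'c : IsClosed C') (hCU : C' ⊆ U') : ∃ B, 0 ≤ B ∧ ∀ x, proj ω x ∈ C' → ‖f x‖ ≤ B := by
  obtain ⟨R, hR⟩ := exists_norm_add_latticePoint_le hC'
  have hcomp : IsCompact (proj ω ⁻¹' C' ∩ Metric.closedBall 0 R) :=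
    (isCompact_closedBall _ _).inter_left (hC'c.preimage continuous_proj)
  obtain ⟨B, hB⟩ := hcomp.exists_bound_of_continuousOn
    (hfc.mono fun x hx => hCU hx.1)
  refine ⟨max B 0, le_max_right _ _, fun x hx => ?_⟩
  obtain ⟨m, hm⟩ := hR x hx
  have h1 := hB (x + latticePoint ω m)
    ⟨by rwa [mem_preimage, proj_add_latticePoint], by simpa using hm⟩
  rw [hf x (hCU hx) m, norm_smul, Real.norm_eq_abs, abs_latticeSign, one_mul] at h1
  exact h1.trans (le_max_left _ _)

theorem IsOuterNormal.add_of_invariant {K : Set (E n)} {v : E n} (hK : ∀ x, x + v ∈ K ↔ x ∈ K)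
    {x ν : E n} (h : IsOuterNormal K x ν) : IsOuterNormal K (x + v) ν := by
  refine ⟨h.1, fun ε hε => ?_⟩
  obtain ⟨δ, hδ, hz⟩ := h.2 ε hε
  refine ⟨δ, hδ, fun z hzδ => ?_⟩
  have h1 := hz (z - v)
  have h2 : z - v - x = z - (x + v) := by abel
  have h3 : z - v ∈ K ↔ z ∈ K := by rw [← hK (z - v), sub_add_cancel]
  rw [h2, h3] at h1
  exact h1 hzδ

theorem outerNormal_add {K : Set (E n)} {v : E n} (hK : ∀ x, x + v ∈ K ↔ x ∈ K) (x : E n) :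
    outerNormal K (x + v) = outerNormal K x := by
  have hK' : ∀ x, x + -v ∈ K ↔ x ∈ K := fun x => by
    rw [← hK (x + -v), neg_add_cancel_right]
  have : IsOuterNormal K (x + v) = IsOuterNormal K x := by
    ext ν
    refine ⟨fun h => ?_, IsOuterNormal.add_of_invariant hK⟩
    simpa using IsOuterNormal.add_of_invariant hK' h
  rw [outerNormal, outerNormal, this]

end Geometry

end HyperCyl
end

/-! ### Radial cutoffs. -/

noncomputable section
namespace HyperCyl
open Filter Topology
open scoped ENNReal RealInnerProductSpace

section RadialCutoff

/-- A smooth profile equal to `1` for `s ≤ 1/2` and to `0` for `s ≥ 1`. -/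
def cutoffProfile (s : ℝ) : ℝ := Real.smoothTransition (2 - 2 * s)

/-- The derivative of the profile. -/
def cutoffSlope (s : ℝ) : ℝ := -(2 * deriv Real.smoothTransition (2 - 2 * s))

theorem hasDerivAt_cutoffProfile (s : ℝ) : HasDerivAt cutoffProfile (cutoffSlope s) s := by
  have h : HasDerivAt (fun s : ℝ => 2 - 2 * s) (-2) s := by
    simpa using ((hasDerivAt_id s).const_mul 2).const_sub 2
  have := (hasDerivAt_smoothTransition (2 - 2 * s)).comp s h
  refine this.congr_deriv ?_
  rw [cutoffSlope]; ring

theorem continuous_cutoffSlope : Continuous cutoffSlope := by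
  have := continuous_deriv_smoothTransition
  unfold cutoffSlope
  fun_prop

theorem cutoffSlope_eq_zero {s : ℝ} (hs : s ∉ Icc (1 / 2 : ℝ) 1) : cutoffSlope s = 0 := by
  rw [cutoffSlope, deriv_smoothTransition_eq_zero, mul_zero, neg_zero]
  contrapose! hs
  constructor <;> linarith [hs.1, hs.2]

theorem exists_abs_cutoffSlope_le : ∃ H, 0 ≤ H ∧ ∀ s, |cutoffSlope s| ≤ H := by
  obtain ⟨H, hH⟩ := continuous_cutoffSlope.bounded_above_of_compact_support
    (HasCompactSupport.intro isCompact_Icc fun _ hs => cutoffSlope_eq_zero hs)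
  exact ⟨H, (norm_nonneg _).trans (hH 0), hH⟩

theorem cutoffProfile_eq_one {s : ℝ} (hs : s ≤ 1 / 2) : cutoffProfile s = 1 :=
  Real.smoothTransition.one_of_one_le (by linarith)

theorem cutoffProfile_eq_zero {s : ℝ} (hs : 1 ≤ s) : cutoffProfile s = 0 :=
  Real.smoothTransition.zero_of_nonpos (by linarith)

theorem cutoffProfile_nonneg (s : ℝ) : 0 ≤ cutoffProfile s := Real.smoothTransition.nonneg _

theorem cutoffProfile_le_one (s : ℝ) : cutoffProfile s ≤ 1 := Real.smoothTransition.le_one _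

variable {n : ℕ}

/-- The smooth cutoff equal to `1` near `a` and to `0` off the ball of radius `R`. -/
def radialCutoff (a : E n) (R : ℝ) (x : E n) : ℝ := cutoffProfile (‖x - a‖ ^ 2 / R ^ 2)

theorem contDiff_radialCutoff (a : E n) (R : ℝ) : ContDiff ℝ 1 (radialCutoff a R) := by
  have h1 : ContDiff ℝ 1 fun x : E n => 2 - 2 * (‖x - a‖ ^ 2 / R ^ 2) := by
    have : ContDiff ℝ 1 fun x : E n => ‖x - a‖ ^ 2 := (contDiff_id.sub contDiff_const).norm_sq ℝ
    exact contDiff_const.sub (contDiff_const.mul (this.div_const _))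
  exact (Real.smoothTransition.contDiff (n := 1)).comp h1

theorem hasFDerivAt_radialCutoff (a : E n) (R : ℝ) (x : E n) :
    HasFDerivAt (radialCutoff a R)
      ((cutoffSlope (‖x - a‖ ^ 2 / R ^ 2) * (2 / R ^ 2)) • innerSL ℝ (x - a)) x := by
  have h1 : HasFDerivAt (fun x : E n => ‖x - a‖ ^ 2 / R ^ 2)
      ((2 / R ^ 2) • innerSL ℝ (x - a)) x := by
    have h := ((hasStrictFDerivAt_norm_sq (x - a)).hasFDerivAt.comp x
      ((hasFDerivAt_id x).sub_const a)).mul_const (R ^ 2)⁻¹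
    refine h.congr_fderiv ?_
    ext v
    simp
    ring
  refine ((hasDerivAt_cutoffProfile _).comp_hasFDerivAt x h1).congr_fderiv ?_
  rw [smul_smul]

theorem sum_innerSL_smul {A : Type*} [NormedAddCommGroup A] [NormedSpace ℝ A]
    (T : E n →L[ℝ] A) (w : E n) : ∑ i, innerSL ℝ w (e i) • T (e i) = T w := by
  conv_rhs => rw [← (EuclideanSpace.basisFun (Fin n) ℝ).sum_repr w, map_sum]
  refine Finset.sum_congr rfl fun i _ => ?_
  rw [innerSL_apply_apply, inner_e, map_smul]
  simp [e]

theorem sum_fderiv_radialCutoff_smul {A : Type*} [NormedAddCommGroup A] [NormedSpace ℝ A]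
    (T : E n →L[ℝ] A) (a : E n) (R : ℝ) (x : E n) :
    ∑ i, fderiv ℝ (radialCutoff a R) x (e i) • T (e i)
      = (cutoffSlope (‖x - a‖ ^ 2 / R ^ 2) * (2 / R ^ 2)) • T (x - a) := by
  rw [(hasFDerivAt_radialCutoff a R x).fderiv]
  simp only [smul_apply, smul_assoc, ← Finset.smul_sum, sum_innerSL_smul]

theorem radialCutoff_eq_zero {a x : E n} {R : ℝ} (hR : 0 < R) (hx : R ≤ ‖x - a‖) :
    radialCutoff a R x = 0 := by
  refine cutoffProfile_eq_zero ?_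
  rw [le_div_iff₀ (by positivity), one_mul]
  gcongr

theorem radialCutoff_eq_one {a x : E n} {R : ℝ} (hR : 0 < R) (hx : ‖x - a‖ ≤ R / 2) :
    radialCutoff a R x = 1 := by
  refine cutoffProfile_eq_one ?_
  rw [div_le_iff₀ (by positivity)]
  nlinarith [norm_nonneg (x - a)]

/-- In polar coordinates in dimension d + 2 the weights r^(d+1) and r^(-d) leave the derivative of
`cutoffProfile` at r², whose total change is -1. -/
theorem integral_cutoffSlope_norm_sq (d : ℕ) :
    ∫ z : E (d + 2), 2 * cutoffSlope (‖z‖ ^ 2) * ‖z‖⁻¹ ^ d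
      = -((d + 2) * (volume (Metric.ball (0 : E (d + 2)) 1)).toReal) := by
  have h := integral_fun_norm_addHaar (volume : Measure (E (d + 2)))
    (fun r : ℝ => 2 * cutoffSlope (r ^ 2) * r⁻¹ ^ d)
  rw [h, finrank_euclideanSpace, Fintype.card_fin]
  have h1 : ∫ r in Ioi (0 : ℝ), r ^ (d + 2 - 1) • (2 * cutoffSlope (r ^ 2) * r⁻¹ ^ d)
      = ∫ r in Ioi (0 : ℝ), cutoffSlope (r ^ 2) * (2 * r) := by
    refine setIntegral_congr_fun measurableSet_Ioi fun r hr => ?_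
    have hr0 : r ≠ 0 := ne_of_gt hr
    simp only [smul_eq_mul, show d + 2 - 1 = d + 1 by lia, inv_pow]
    field_simp
    ring
  have hd : ∀ r : ℝ, HasDerivAt (fun r => cutoffProfile (r ^ 2)) (cutoffSlope (r ^ 2) * (2 * r)) r := by
    intro r
    refine ((hasDerivAt_cutoffProfile (r ^ 2)).comp r (hasDerivAt_pow 2 r)).congr_deriv ?_
    simp
  have hcs : HasCompactSupport fun r : ℝ => cutoffSlope (r ^ 2) * (2 * r) := by
    refine HasCompactSupport.intro (isCompact_Icc (a := (-1 : ℝ)) (b := 1)) fun r hr => ?_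
    rw [cutoffSlope_eq_zero, zero_mul]
    contrapose! hr
    exact abs_le.1 ((sq_le_one_iff_abs_le_one r).1 hr.2)
  have hc : Continuous fun r : ℝ => cutoffSlope (r ^ 2) * (2 * r) := by
    have := continuous_cutoffSlope
    fun_prop
  have h2 : ∫ r in Ioi (0 : ℝ), cutoffSlope (r ^ 2) * (2 * r) = -1 := by
    have := integral_Ioi_of_hasDerivAt_of_tendsto (f := fun r => cutoffProfile (r ^ 2)) (a := 0)
      (m := 0) (hd 0).continuousAt.continuousWithinAt (fun r _ => hd r)
      (hc.integrable_of_hasCompactSupport hcs).integrableOn (tendsto_const_nhds.congr' ?_)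
    · rw [this]
      simp [cutoffProfile_eq_one]
    · filter_upwards [eventually_ge_atTop (1 : ℝ)] with r hr
      exact (cutoffProfile_eq_zero (by nlinarith)).symm
  rw [h1, h2, nsmul_eq_mul, smul_eq_mul, Measure.real]
  push_cast
  ring

end RadialCutoff

end HyperCyl
end

/-! ### The contribution of the pole. -/

noncomputable section
namespace HyperCyl
open Filter Topology
open scoped ENNReal RealInnerProductSpace

section PoleLimit

variable {n : ℕ} [NeZero n]

theorem norm_sub_conjVec_self (y : E n) : ‖y - conjVec y‖ = 2 * |y ⊤| := by
  rw [conjVec_eq, sub_sub_cancel, norm_smul, norm_e, mul_one, Real.norm_eq_abs, abs_mul]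
  norm_num

theorem abs_le_norm_add_smul_sub_conjVec {y z : E n} {ε : ℝ} (hε0 : 0 ≤ ε) (hε : ε ≤ |y ⊤|)
    (hz : ‖z‖ ≤ 1) : |y ⊤| ≤ ‖y + ε • z - conjVec y‖ := by
  have h1 : y - conjVec y = (y + ε • z - conjVec y) - ε • z := by abel
  have h2 := norm_sub_le (y + ε • z - conjVec y) (ε • z)
  rw [← h1, norm_sub_conjVec_self, norm_smul, Real.norm_of_nonneg hε0] at h2
  nlinarith [norm_nonneg z]

theorem continuousAt_kernelForm (hn : 2 ≤ n) {f : E n → Cl n} {U : Set (E n)} (hU : IsOpen U)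
    (hf : DifferentiableOn ℝ f U) {x y : E n} (hx : x ∈ U) (h1 : x ≠ y) (h2 : x ≠ conjVec y) :
    ContinuousAt (kernelForm f y) x := by
  obtain ⟨D, hD, -⟩ := hasFDerivAt_kernelForm hn
    ((hf x hx).differentiableAt (hU.mem_nhds hx)) h1 h2
  exact hD.continuousAt

/-- The scaled first kernel near the pole. -/
theorem smul_p₁_mul_vec_mul (hn : 2 ≤ n) (f : E n → Cl n) {y z : E n} {ε : ℝ} (hε : 0 < ε)
    (hz : z ≠ 0) : ε ^ (n - 1) • (p₁ (y + ε • z) y * vec z * f (y + ε • z))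
      = (‖z‖⁻¹ ^ (n - 2) * ‖y + ε • z - conjVec y‖⁻¹ ^ (n - 2)) • f (y + ε • z) := by
  have hz' : ‖z‖ ≠ 0 := norm_ne_zero_iff.2 hz
  have h1 : y + ε • z - y = ε • z := by abel
  rw [p₁_eq hn, h1, vec_smul, norm_smul, Real.norm_of_nonneg hε.le, neg_mul, smul_smul,
    smul_mul_assoc, vec_mul_self', smul_smul, ← neg_smul, smul_mul_assoc, one_mul, smul_smul]
  congr 1
  obtain ⟨q, rfl⟩ := Nat.exists_eq_add_of_le' hn
  simp only [Nat.add_sub_cancel, show q + 2 - 1 = q + 1 by lia, inv_pow, mul_inv, mul_pow]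
  field_simp
  ring

/-- Near y the vector factor of p₂ is bounded, because x* - y stays away from 0. The singularity has
order only n - 2, and the scaling ε^(n-1) leaves a factor ε. -/
theorem exists_norm_smul_p₂_le (hn : 2 ≤ n) {y : E n} (hy : y ⊤ ≠ 0) (B : ℝ) :
    ∃ C, 0 ≤ C ∧ ∀ (f : E n → Cl n) (z : E n) (ε : ℝ), 0 < ε → ε ≤ |y ⊤| → 1 / 2 ≤ ‖z‖ → ‖z‖ ≤ 1 →
      ‖f (y + ε • z)‖ ≤ B →
      ‖ε ^ (n - 1) • (p₂ (y + ε • z) y * conjCl (vec z) * conjCl (f (y + ε • z)))‖ ≤ C * ε := by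
  obtain ⟨M, hM0, hM⟩ := exists_norm_p₂_le hn
  obtain ⟨Mm, hMm0, hMm⟩ := exists_norm_mul_le (n := n)
  obtain ⟨Mv, hMv0, hMv⟩ := exists_norm_vec_le (n := n)
  obtain ⟨Mc, hMc0, hMc⟩ := exists_norm_conjCl_le (n := n)
  have hy0 : 0 < |y ⊤| := abs_pos.2 hy
  refine ⟨Mm * (Mm * (M * (|y ⊤|⁻¹ ^ (n - 1) * 2 ^ (n - 2))) * (Mc * Mv)) * (Mc * |B|),
    by positivity, fun f z ε hε hεy hz hz1 hB => ?_⟩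
  have h1 : y + ε • z - y = ε • z := by abel
  have hz0 : 0 < ‖z‖ := by linarith
  have hp : ε ^ (n - 1) * ‖p₂ (y + ε • z) y‖ ≤ M * (|y ⊤|⁻¹ ^ (n - 1) * 2 ^ (n - 2)) * ε := by
    have h2 := hM (y + ε • z) y
    rw [h1, norm_smul, Real.norm_of_nonneg hε.le, mul_inv, mul_pow] at h2
    have h3 : ‖y + ε • z - conjVec y‖⁻¹ ≤ |y ⊤|⁻¹ :=
      inv_anti₀ hy0 (abs_le_norm_add_smul_sub_conjVec hε.le hεy hz1)
    have h4 : ‖z‖⁻¹ ≤ 2 := by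
      rw [inv_le_comm₀ hz0 two_pos]; linarith
    have h5 : ε ^ (n - 1) * ε⁻¹ ^ (n - 2) = ε := by
      obtain ⟨q, rfl⟩ := Nat.exists_eq_add_of_le' hn
      simp only [Nat.add_sub_cancel, show q + 2 - 1 = q + 1 by lia, inv_pow]
      field_simp
      ring
    calc ε ^ (n - 1) * ‖p₂ (y + ε • z) y‖
        ≤ ε ^ (n - 1) * (M * (|y ⊤|⁻¹ ^ (n - 1) * (ε⁻¹ ^ (n - 2) * 2 ^ (n - 2)))) := by
          refine mul_le_mul_of_nonneg_left (h2.trans ?_) (by positivity)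
          gcongr
      _ = M * (|y ⊤|⁻¹ ^ (n - 1) * 2 ^ (n - 2)) * (ε ^ (n - 1) * ε⁻¹ ^ (n - 2)) := by ring
      _ = _ := by rw [h5]
  have hv : ‖conjCl (vec z)‖ ≤ Mc * Mv := by
    refine (hMc _).trans (mul_le_mul_of_nonneg_left ?_ hMc0)
    exact (hMv z).trans (mul_le_of_le_one_right hMv0 hz1)
  have hfz : ‖conjCl (f (y + ε • z))‖ ≤ Mc * |B| :=
    (hMc _).trans (mul_le_mul_of_nonneg_left (hB.trans (le_abs_self B)) hMc0)
  rw [norm_smul, Real.norm_of_nonneg (by positivity : (0 : ℝ) ≤ ε ^ (n - 1))]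
  calc ε ^ (n - 1) * ‖p₂ (y + ε • z) y * conjCl (vec z) * conjCl (f (y + ε • z))‖
      ≤ ε ^ (n - 1) * (Mm * (Mm * ‖p₂ (y + ε • z) y‖ * (Mc * Mv)) * (Mc * |B|)) := by
        refine mul_le_mul_of_nonneg_left ?_ (by positivity)
        refine (hMm _ _).trans ?_
        refine mul_le_mul ?_ hfz (norm_nonneg _) (by positivity)
        refine mul_le_mul_of_nonneg_left ((hMm _ _).trans ?_) hMm0
        exact mul_le_mul_of_nonneg_left hv (by positivity)
    _ = Mm * (Mm * (ε ^ (n - 1) * ‖p₂ (y + ε • z) y‖) * (Mc * Mv)) * (Mc * |B|) := by ring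
    _ ≤ Mm * (Mm * (M * (|y ⊤|⁻¹ ^ (n - 1) * 2 ^ (n - 2)) * ε) * (Mc * Mv)) * (Mc * |B|) := by
        gcongr
    _ = _ := by ring

/-- Substitution x = y + εz: the Jacobian εⁿ, the factor ε⁻² of the cutoff gradient and ε from the
linear argument combine to ε^(n-1). -/
theorem integral_cutoffSlope_smul_kernelForm_eq (f : E n → Cl n) (y : E n) {ε : ℝ}
    (hε : 0 < ε) (hn : 2 ≤ n) :
    ∫ x, (cutoffSlope (‖x - y‖ ^ 2 / ε ^ 2) * (2 / ε ^ 2)) • kernelForm f y x (x - y)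
      = ∫ z, (2 * cutoffSlope (‖z‖ ^ 2)) • ε ^ (n - 1) • kernelForm f y (y + ε • z) z := by
  set F : E n → Cl n := fun x =>
    (cutoffSlope (‖x - y‖ ^ 2 / ε ^ 2) * (2 / ε ^ 2)) • kernelForm f y x (x - y) with hF
  have h1 : ∫ x, F x = ∫ x, F (y + x) := (integral_add_left_eq_self F y).symm
  have h2 := Measure.integral_comp_smul (volume : Measure (E n)) (fun x => F (y + x)) ε
  rw [finrank_euclideanSpace, Fintype.card_fin, abs_of_pos (by positivity)] at h2
  have h3 : ∫ x, F x = ε ^ n • ∫ z, F (y + ε • z) := by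
    rw [h2, ← h1, smul_smul, mul_inv_cancel₀ (by positivity), one_smul]
  rw [h3, ← integral_smul]
  refine integral_congr_ae (Eventually.of_forall fun z => ?_)
  simp only [hF]
  have h4 : y + ε • z - y = ε • z := by abel
  rw [h4, map_smul, smul_smul, smul_smul, smul_smul, norm_smul, Real.norm_of_nonneg hε.le, mul_pow,
    mul_div_cancel_left₀ _ (by positivity)]
  congr 1
  obtain ⟨q, rfl⟩ := Nat.exists_eq_add_of_le' hn
  simp only [show q + 2 - 1 = q + 1 by lia]
  field_simp
  ring

omit [NeZero n] in
theorem norm_mem_of_norm_sq_mem {z : E n} (hz : ‖z‖ ^ 2 ∈ Icc (1 / 2 : ℝ) 1) :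
    1 / 2 ≤ ‖z‖ ∧ ‖z‖ ≤ 1 := by
  have h0 := norm_nonneg z
  constructor
  · nlinarith [hz.1]
  · nlinarith [hz.2]

omit [NeZero n] in
theorem ne_zero_of_half_le_norm {z : E n} (hz : 1 / 2 ≤ ‖z‖) : z ≠ 0 := by
  rintro rfl
  rw [norm_zero] at hz
  norm_num at hz

variable {d : ℕ} [NeZero (d + 2)] {f : E (d + 2) → Cl (d + 2)} {U : Set (E (d + 2))}
  {y : E (d + 2)}

/-- Bounds uniform in ε on a fixed annulus containing the support of the cutoff slope. The first
norm bound is the majorant for dominated convergence; the second shows that p₂ drops out of the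
limit. -/
theorem exists_norm_smul_kernelForm_le (hU : IsOpen U) (hf : ContinuousAt f y) (hyU : y ∈ U)
    (hy : y ⊤ ≠ 0) :
    ∃ δ > 0, ∃ B C : ℝ, ∀ ε ∈ Ioc 0 δ, ∀ z : E (d + 2), 1 / 2 ≤ ‖z‖ → ‖z‖ ≤ 1 →
      y + ε • z ∈ U ∧ |y ⊤| ≤ ‖y + ε • z - conjVec y‖ ∧
      ‖ε ^ (d + 1) • kernelForm f y (y + ε • z) z‖ ≤ B ∧
      ‖ε ^ (d + 1) • kernelForm f y (y + ε • z) z -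
        (‖z‖⁻¹ ^ d * ‖y + ε • z - conjVec y‖⁻¹ ^ d) • f (y + ε • z)‖ ≤ C * ε := by
  have hn : 2 ≤ d + 2 := by lia
  have hy0 : 0 < |y ⊤| := abs_pos.2 hy
  obtain ⟨δ, hδ, hδB⟩ : ∃ δ > 0, ∀ x, ‖x - y‖ ≤ δ → x ∈ U ∧ ‖f x‖ ≤ ‖f y‖ + 1 := by
    have h1 : ∀ᶠ x in 𝓝 y, x ∈ U ∧ ‖f x‖ ≤ ‖f y‖ + 1 :=
      (hU.eventually_mem hyU).and ((hf.norm.eventually_lt_const (lt_add_one _)).mono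
        fun x hx => hx.le)
    obtain ⟨δ, hδ, h⟩ := Metric.eventually_nhds_iff.1 h1
    exact ⟨δ / 2, by positivity, fun x hx => h (by rw [dist_eq_norm]; linarith)⟩
  obtain ⟨C₂, hC₂0, hC₂⟩ := exists_norm_smul_p₂_le hn hy (‖f y‖ + 1)
  refine ⟨min δ |y ⊤|, lt_min hδ hy0, 2 ^ d * |y ⊤|⁻¹ ^ d * (‖f y‖ + 1) + C₂ * δ, C₂,
    fun ε hε z hz hz1 => ?_⟩
  have hεδ := hε.2.trans (min_le_left _ _)
  have hεy := hε.2.trans (min_le_right _ _)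
  have hz0 : 0 < ‖z‖ := by linarith
  have hs := abs_le_norm_add_smul_sub_conjVec hε.1.le hεy hz1
  obtain ⟨hxU, hxB⟩ := hδB (y + ε • z) (by
    rw [add_sub_cancel_left, norm_smul, Real.norm_of_nonneg hε.1.le]
    exact (mul_le_of_le_one_right hε.1.le hz1).trans hεδ)
  have hb₂ := hC₂ f z ε hε.1 hεy hz hz1 hxB
  have hsplit : ε ^ (d + 1) • kernelForm f y (y + ε • z) z
      = (‖z‖⁻¹ ^ d * ‖y + ε • z - conjVec y‖⁻¹ ^ d) • f (y + ε • z) -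
        ε ^ (d + 1) • (p₂ (y + ε • z) y * conjCl (vec z) * conjCl (f (y + ε • z))) := by
    rw [kernelForm_apply, smul_sub]
    congr 1
    exact smul_p₁_mul_vec_mul hn f hε.1 (ne_zero_of_half_le_norm hz)
  have hb₁ : ‖(‖z‖⁻¹ ^ d * ‖y + ε • z - conjVec y‖⁻¹ ^ d) • f (y + ε • z)‖
      ≤ 2 ^ d * |y ⊤|⁻¹ ^ d * (‖f y‖ + 1) := by
    rw [norm_smul, Real.norm_of_nonneg (by positivity)]
    have h4 : ‖z‖⁻¹ ≤ 2 := by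
      rw [inv_le_comm₀ hz0 two_pos]; linarith
    have h3 := inv_anti₀ hy0 hs
    gcongr
  refine ⟨hxU, hs, ?_, ?_⟩
  · rw [hsplit]
    refine (norm_sub_le _ _).trans (add_le_add hb₁ (hb₂.trans ?_))
    gcongr
  · rw [hsplit, sub_sub_cancel_left, norm_neg]
    exact hb₂

theorem tendsto_inv_pow_smul_near (hf : ContinuousAt f y) (hy : y ⊤ ≠ 0) (z : E (d + 2)) :
    Tendsto (fun ε : ℝ => (‖z‖⁻¹ ^ d * ‖y + ε • z - conjVec y‖⁻¹ ^ d) • f (y + ε • z)) (𝓝[>] 0)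
      (𝓝 ((‖z‖⁻¹ ^ d * (2 * |y ⊤|)⁻¹ ^ d) • f y)) := by
  have hyε : Tendsto (fun ε : ℝ => y + ε • z) (𝓝[>] 0) (𝓝 y) := by
    have : Tendsto (fun ε : ℝ => y + ε • z) (𝓝 0) (𝓝 (y + (0 : ℝ) • z)) :=
      (by fun_prop : Continuous fun ε : ℝ => y + ε • z).tendsto 0
    rw [zero_smul, add_zero] at this
    exact this.mono_left nhdsWithin_le_nhds
  have hs : Tendsto (fun ε : ℝ => ‖y + ε • z - conjVec y‖) (𝓝[>] 0) (𝓝 (2 * |y ⊤|)) := by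
    rw [← norm_sub_conjVec_self]
    exact (hyε.sub_const _).norm
  have hne : 2 * |y ⊤| ≠ 0 := by positivity
  have h1 : Tendsto (fun ε : ℝ => ‖z‖⁻¹ ^ d * ‖y + ε • z - conjVec y‖⁻¹ ^ d) (𝓝[>] 0)
      (𝓝 (‖z‖⁻¹ ^ d * (2 * |y ⊤|)⁻¹ ^ d)) := ((hs.inv₀ hne).pow d).const_mul _
  have h2 : Tendsto (fun ε : ℝ => f (y + ε • z)) (𝓝[>] 0) (𝓝 (f y)) := hf.tendsto.comp hyε
  exact h1.smul h2

/-- After rescaling, the integrand converges to a radial function times f(y), with (2|yₙ|)^(-d) as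
the limit of the factor in ‖x - y*‖. Continuity of f at y suffices for this limit. -/
theorem tendsto_integral_cutoffSlope_smul_kernelForm
    (hU : IsOpen U) (hf : DifferentiableOn ℝ f U) (hyU : y ∈ U) (hy : y ⊤ ≠ 0) :
    Tendsto (fun ε : ℝ => ∫ x, (cutoffSlope (‖x - y‖ ^ 2 / ε ^ 2) * (2 / ε ^ 2)) •
        kernelForm f y x (x - y)) (𝓝[>] 0)
      (𝓝 (-(((d + 2) * (volume (Metric.ball (0 : E (d + 2)) 1)).toReal) *
        (2 * |y ⊤|)⁻¹ ^ d) • f y)) := by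
  have hn : 2 ≤ d + 2 := by lia
  have hy0 : 0 < |y ⊤| := abs_pos.2 hy
  have hfy : ContinuousAt f y := (hf y hyU).continuousWithinAt.continuousAt (hU.mem_nhds hyU)
  obtain ⟨H, hH0, hH⟩ := exists_abs_cutoffSlope_le
  obtain ⟨δ, hδ, B, C, hb⟩ := exists_norm_smul_kernelForm_le hU hfy hyU hy
  have hIoc : Ioc 0 δ ∈ 𝓝[>] (0 : ℝ) := Ioc_mem_nhdsGT hδ
  have hcont : ∀ ε ∈ Ioc 0 δ, Continuous fun z : E (d + 2) =>
      (2 * cutoffSlope (‖z‖ ^ 2)) • ε ^ (d + 1) • kernelForm f y (y + ε • z) z := by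
    intro ε hε
    -- The slope vanishes off the annulus, so neither z = 0 nor the reflected pole is met where
    -- continuity must be checked.
    refine continuous_of_tsupport (s := {z | ‖z‖ ^ 2 ∈ Icc (1 / 2 : ℝ) 1})
      (isClosed_Icc.preimage (by fun_prop)) (fun z hz => ?_) fun z hz => ?_
    · rw [cutoffSlope_eq_zero hz, mul_zero, zero_smul]
    · obtain ⟨hz1, hz2⟩ := norm_mem_of_norm_sq_mem hz
      obtain ⟨hxU, hs, -, -⟩ := hb ε hε z hz1 hz2
      have hk : ContinuousAt (kernelForm f y) (y + ε • z) := by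
        refine continuousAt_kernelForm hn hU hf hxU ?_ ?_
        · simpa using ⟨hε.1.ne', ne_zero_of_half_le_norm hz1⟩
        · intro h
          rw [h, sub_self, norm_zero] at hs
          linarith
      have h0 : ContinuousAt (fun z : E (d + 2) => y + ε • z) z := by fun_prop
      have h1 : ContinuousAt (fun z : E (d + 2) => kernelForm f y (y + ε • z)) z :=
        ContinuousAt.comp (g := kernelForm f y) hk h0
      have h2 : ContinuousAt (fun z : E (d + 2) => kernelForm f y (y + ε • z) z) z :=
        h1.clm_apply continuousAt_id
      have h3 : ContinuousAt (fun z : E (d + 2) => 2 * cutoffSlope (‖z‖ ^ 2)) z := by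
        have := continuous_cutoffSlope
        exact Continuous.continuousAt (by fun_prop)
      have h4 : ContinuousAt (fun z : E (d + 2) =>
          ε ^ (d + 1) • kernelForm f y (y + ε • z) z) z := h2.const_smul (ε ^ (d + 1))
      exact Filter.Tendsto.smul h3 h4
  have hlim : ∀ z : E (d + 2), Tendsto (fun ε : ℝ =>
      (2 * cutoffSlope (‖z‖ ^ 2)) • ε ^ (d + 1) • kernelForm f y (y + ε • z) z) (𝓝[>] 0)
      (𝓝 ((2 * cutoffSlope (‖z‖ ^ 2) * ‖z‖⁻¹ ^ d * (2 * |y ⊤|)⁻¹ ^ d) • f y)) := by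
    intro z
    by_cases hz : ‖z‖ ^ 2 ∈ Icc (1 / 2 : ℝ) 1
    · obtain ⟨hz1, hz2⟩ := norm_mem_of_norm_sq_mem hz
      have ht₁ := tendsto_inv_pow_smul_near hfy hy z
      have ht₂ : Tendsto (fun ε : ℝ => ε ^ (d + 1) • kernelForm f y (y + ε • z) z -
          (‖z‖⁻¹ ^ d * ‖y + ε • z - conjVec y‖⁻¹ ^ d) • f (y + ε • z)) (𝓝[>] 0) (𝓝 0) := by
        refine squeeze_zero_norm' (a := fun ε => C * ε) ?_ ?_
        · filter_upwards [hIoc] with ε hε using (hb ε hε z hz1 hz2).2.2.2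
        · have : Tendsto (fun ε : ℝ => C * ε) (𝓝 0) (𝓝 (C * 0)) :=
            (continuous_const_mul C).tendsto 0
          rw [mul_zero] at this
          exact this.mono_left nhdsWithin_le_nhds
      have h3 := (ht₂.add ht₁).const_smul (2 * cutoffSlope (‖z‖ ^ 2))
      simp only [sub_add_cancel] at h3
      rwa [zero_add, smul_smul, ← mul_assoc] at h3
    · simp [cutoffSlope_eq_zero hz]
  have hdct := tendsto_integral_filter_of_dominated_convergence (μ := volume) (l := 𝓝[>] (0 : ℝ))
    (F := fun ε z => (2 * cutoffSlope (‖z‖ ^ 2)) • ε ^ (d + 1) • kernelForm f y (y + ε • z) z)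
    (f := fun z => (2 * cutoffSlope (‖z‖ ^ 2) * ‖z‖⁻¹ ^ d * (2 * |y ⊤|)⁻¹ ^ d) • f y)
    ((Metric.closedBall (0 : E (d + 2)) 1).indicator fun _ => 2 * H * |B|) ?_ ?_ ?_
    (Eventually.of_forall hlim)
  · rw [integral_smul_const, integral_mul_const, integral_cutoffSlope_norm_sq, neg_mul] at hdct
    refine hdct.congr' ?_
    filter_upwards [self_mem_nhdsWithin] with ε hε
    exact (integral_cutoffSlope_smul_kernelForm_eq f y hε hn).symm
  · filter_upwards [hIoc] with ε hε using (hcont ε hε).aestronglyMeasurable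
  · filter_upwards [hIoc] with ε hε
    refine Eventually.of_forall fun z => ?_
    by_cases hz : ‖z‖ ^ 2 ∈ Icc (1 / 2 : ℝ) 1
    · obtain ⟨hz1, hz2⟩ := norm_mem_of_norm_sq_mem hz
      rw [indicator_of_mem (by simpa using hz2), norm_smul, Real.norm_eq_abs, abs_mul, abs_two]
      have h1 := (hb ε hε z hz1 hz2).2.2.1.trans (le_abs_self B)
      have h5 := hH (‖z‖ ^ 2)
      exact mul_le_mul (mul_le_mul_of_nonneg_left h5 two_pos.le) h1 (norm_nonneg _) (by positivity)
    · rw [cutoffSlope_eq_zero hz, mul_zero, zero_smul, norm_zero]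
      exact indicator_nonneg (fun _ _ => by positivity) z
  · exact (integrable_indicator_iff Metric.isClosed_closedBall.measurableSet).2
      (integrableOn_const (isCompact_closedBall _ _).measure_lt_top.ne)

end PoleLimit

end HyperCyl
end

/-! ### Cauchy's formula on a possibly unbounded Lipschitz region. -/

noncomputable section
namespace HyperCyl
open Filter Topology
open scoped ENNReal RealInnerProductSpace Manifold

section CauchyFormula

theorem exists_contDiff_one_nhds_zero_nhds {n : ℕ} {Q W : Set (E n)} (hQ : IsClosed Q)
    (hW : IsOpen W) (hQW : Q ⊆ W) :
    ∃ κ : E n → ℝ, ContDiff ℝ 1 κ ∧ (∀ x ∈ Q, κ =ᶠ[𝓝 x] fun _ => 1) ∧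
      ∀ x ∉ W, κ =ᶠ[𝓝 x] fun _ => 0 := by
  obtain ⟨g, h0, h1, -⟩ := exists_contMDiffMap_zero_one_nhds_of_isClosed (n := 1) 𝓘(ℝ, E n)
    hW.isClosed_compl hQ (disjoint_compl_left_iff_subset.2 hQW)
  refine ⟨g, g.contMDiff.contDiff, fun x hx => ?_, fun x hx => ?_⟩
  · exact (eventually_nhdsSet_iff_forall.1 h1) x hx
  · exact (eventually_nhdsSet_iff_forall.1 h0) x hx

variable {d : ℕ} [NeZero (d + 1)] {K U : Set (E (d + 1))} {f : E (d + 1) → Cl (d + 1)}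
  {y : E (d + 1)}

theorem aestronglyMeasurable_kernelForm (hd : 2 ≤ d + 1) (hKo : IsOpen K) (hU : IsOpen U)
    (hf : LeftHypermonogenicOn f U) (hKU : closure K ⊆ U) (hy' : conjVec y ∉ closure K) :
    AEStronglyMeasurable (kernelForm f y) (volume.restrict K) := by
  have h1 : ContinuousOn (kernelForm f y) (K \ {y}) := fun x hx =>
    (continuousAt_kernelForm hd hU hf.1 (hKU (subset_closure hx.1)) hx.2
      (fun h => hy' (by rw [← h]; exact subset_closure hx.1))).continuousWithinAt
  have h2 := h1.aestronglyMeasurable (μ := volume) (hKo.measurableSet.diff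
    (measurableSet_singleton y))
  rwa [Measure.restrict_congr_set (sdiff_null_ae_eq_self (measure_singleton y))] at h2

/-- The cutoff is ψ = θκ. The difference θ of the two radial cutoffs vanishes near y, since R ≥
2(‖y‖ + ε), and for ‖x‖ ≥ R. The factor κ keeps the support of ψ inside U and away from y*, and is 1
near the part of the closure of K within radius R, so it leaves no trace in the formula. -/
theorem integral_radialCutoff_smul_kernelForm (hd : 2 ≤ d + 1) (hKo : IsOpen K)
    (hK : HasLipschitzBoundary K) (hU : IsOpen U) (hf : LeftHypermonogenicOn f U)
    (hU0 : ∀ x ∈ U, x ⊤ ≠ 0) (hKU : closure K ⊆ U) (hy' : conjVec y ∉ closure K)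
    {ε R : ℝ} (hε : 0 < ε) (hεK : Metric.closedBall y ε ⊆ K) (hR : ‖y‖ + ε ≤ R / 2) :
    ∫ x in frontier K, radialCutoff 0 R x • kernelForm f y x (outerNormal K x)
        ∂(Measure.euclideanHausdorffMeasure d)
      = ∫ x in K, ((cutoffSlope (‖x‖ ^ 2 / R ^ 2) * (2 / R ^ 2)) • kernelForm f y x x -
        (cutoffSlope (‖x - y‖ ^ 2 / ε ^ 2) * (2 / ε ^ 2)) • kernelForm f y x (x - y)) := by
  have hR0 : 0 < R := by linarith [norm_nonneg y]
  obtain ⟨κ, hκ, hκ1, hκ0⟩ := exists_contDiff_one_nhds_zero_nhds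
    (Q := closure K ∩ Metric.closedBall 0 R) (W := U \ {conjVec y})
    (isClosed_closure.inter Metric.isClosed_closedBall)
    (hU.sdiff isClosed_singleton)
    (fun x hx => ⟨hKU hx.1, fun h => hy' (by rw [← mem_singleton_iff.1 h]; exact hx.1)⟩)
  set θ : E (d + 1) → ℝ := fun x => radialCutoff 0 R x - radialCutoff y ε x with hθ
  have hθc : ContDiff ℝ 1 θ := (contDiff_radialCutoff 0 R).sub (contDiff_radialCutoff y ε)
  have hθR : ∀ x, R ≤ ‖x‖ → θ x = 0 := by
    intro x hx
    have h1 : ε ≤ ‖x - y‖ := by linarith [norm_sub_norm_le x y]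
    rw [hθ]
    simp only
    rw [radialCutoff_eq_zero hR0 (by simpa using hx), radialCutoff_eq_zero hε h1, sub_zero]
  have hθy : θ =ᶠ[𝓝 y] fun _ => 0 := by
    filter_upwards [Metric.closedBall_mem_nhds y (half_pos hε)] with x hx
    rw [mem_closedBall_iff_norm] at hx
    have h1 : ‖x - 0‖ ≤ R / 2 := by
      rw [sub_zero]
      linarith [norm_sub_norm_le x y]
    rw [hθ]
    simp only
    rw [radialCutoff_eq_one hR0 h1, radialCutoff_eq_one hε hx, sub_self]
  set ψ : E (d + 1) → ℝ := fun x => θ x * κ x with hψ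
  have hψc : ContDiff ℝ 1 ψ := hθc.mul hκ
  have hψs : HasCompactSupport ψ :=
    HasCompactSupport.intro (isCompact_closedBall (0 : E (d + 1)) R) fun x hx => by
      have : R ≤ ‖x‖ := by
        rw [mem_closedBall_zero_iff, not_le] at hx; exact hx.le
      rw [hψ]
      simp only
      rw [hθR x this, zero_mul]
  have hsub : tsupport ψ ⊆ U \ {y, conjVec y} := by
    intro x hx
    by_contra hcon
    refine notMem_tsupport_iff_eventuallyEq.2 ?_ hx
    by_cases hxy : x = y
    · subst hxy
      filter_upwards [hθy] with z hz
      rw [hψ]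
      simp only [Pi.zero_apply]
      rw [hz, zero_mul]
    · have hxW : x ∉ U \ {conjVec y} := fun h => hcon ⟨h.1, by
        rw [mem_insert_iff, not_or]; exact ⟨hxy, h.2⟩⟩
      filter_upwards [hκ0 x hxW] with z hz
      rw [hψ]
      simp only [Pi.zero_apply]
      rw [hz, mul_zero]
  have hψK : ∀ x ∈ K, fderiv ℝ ψ x = fderiv ℝ θ x := by
    intro x hx
    rcases le_or_gt ‖x‖ R with h | h
    · refine Filter.EventuallyEq.fderiv_eq ?_
      filter_upwards [hκ1 x ⟨subset_closure hx, by simpa using h⟩] with z hz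
      rw [hψ]
      simp only
      rw [hz, mul_one]
    · have hev : ∀ᶠ z in 𝓝 x, R ≤ ‖z‖ :=
        (continuous_norm.continuousAt.eventually_const_lt h).mono fun z hz => hz.le
      refine Filter.EventuallyEq.fderiv_eq ?_
      filter_upwards [hev] with z hz
      rw [hψ]
      simp only
      rw [hθR z hz, zero_mul]
  have h := integral_frontier_smul_kernelForm hd hKo hK hU hf hU0 hψc hψs hsub
  have hl : ∀ x ∈ frontier K, ψ x = radialCutoff 0 R x := by
    intro x hx
    have hxK : x ∉ K := by
      rw [hKo.frontier_eq] at hx; exact hx.2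
    have h1 : ε ≤ ‖x - y‖ := by
      by_contra! hcon
      exact hxK (hεK (by rw [mem_closedBall_iff_norm]; exact hcon.le))
    rw [hψ]
    simp only
    rw [hθ]
    simp only
    rw [radialCutoff_eq_zero hε h1, sub_zero]
    rcases le_or_gt ‖x‖ R with h | h
    · rw [(hκ1 x ⟨frontier_subset_closure hx, by simpa using h⟩).eq_of_nhds, mul_one]
    · rw [radialCutoff_eq_zero hR0 (by simpa using h.le), zero_mul]
  have hlm : MeasurableSet (frontier K) := isClosed_frontier.measurableSet
  rw [setIntegral_congr_fun hlm (g := fun x => radialCutoff 0 R x •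
    kernelForm f y x (outerNormal K x)) fun x hx => by simp only; rw [hl x hx]] at h
  rw [h]
  refine setIntegral_congr_fun hKo.measurableSet fun x hx => ?_
  rw [hψK x hx]
  have hdθ : fderiv ℝ θ x = fderiv ℝ (radialCutoff 0 R) x - fderiv ℝ (radialCutoff y ε) x :=
    ((hasFDerivAt_radialCutoff 0 R x).differentiableAt.hasFDerivAt.sub
      (hasFDerivAt_radialCutoff y ε x).differentiableAt.hasFDerivAt).fderiv
  rw [hdθ]
  simp only [sub_apply, sub_smul, Finset.sum_sub_distrib, sum_fderiv_radialCutoff_smul, sub_zero]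

theorem norm_cutoffSlope_smul_le {A : Type*} [NormedAddCommGroup A] [NormedSpace ℝ A] {H : ℝ}
    (hH : ∀ s, |cutoffSlope s| ≤ H) {n : ℕ} (T : E n →L[ℝ] A) (a x : E n) {R : ℝ} (hR : 0 < R) :
    ‖(cutoffSlope (‖x - a‖ ^ 2 / R ^ 2) * (2 / R ^ 2)) • T (x - a)‖
      ≤ (if R / 2 ≤ ‖x - a‖ then 2 * H / R * ‖T‖ else 0) := by
  have hH0 : 0 ≤ H := (abs_nonneg _).trans (hH 0)
  by_cases hs : ‖x - a‖ ^ 2 / R ^ 2 ∈ Icc (1 / 2 : ℝ) 1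
  · have h1 : ‖x - a‖ ≤ R := by
      have := hs.2
      rw [div_le_one (by positivity)] at this
      exact le_of_sq_le_sq this hR.le
    have h2 : R / 2 ≤ ‖x - a‖ := by
      have := hs.1
      rw [le_div_iff₀ (by positivity)] at this
      refine le_of_sq_le_sq ?_ (norm_nonneg _)
      nlinarith
    rw [if_pos h2, norm_smul, Real.norm_eq_abs, abs_mul, abs_of_nonneg (by positivity : 0 ≤ 2 / R ^ 2)]
    calc |cutoffSlope (‖x - a‖ ^ 2 / R ^ 2)| * (2 / R ^ 2) * ‖T (x - a)‖
        ≤ H * (2 / R ^ 2) * (‖T‖ * R) := by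
          gcongr
          · exact hH _
          · exact (T.le_opNorm _).trans (by gcongr)
      _ = 2 * H / R * ‖T‖ := by field_simp
  · rw [cutoffSlope_eq_zero hs, zero_mul, zero_smul, norm_zero]
    split_ifs
    · positivity
    · exact le_rfl

/-- The outer cutoff is sent to infinity on both sides by dominated convergence. What remains says
that the flux through the frontier equals the averaged flux through a shell about y, for every small
ε. -/
theorem integral_kernelForm_outerNormal (hd : 2 ≤ d + 1) (hKo : IsOpen K)
    (hK : HasLipschitzBoundary K) (hU : IsOpen U) (hf : LeftHypermonogenicOn f U)
    (hU0 : ∀ x ∈ U, x ⊤ ≠ 0) (hKU : closure K ⊆ U) (hy' : conjVec y ∉ closure K)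
    (hiS : IntegrableOn (fun x => kernelForm f y x (outerNormal K x)) (frontier K)
      (Measure.euclideanHausdorffMeasure d))
    (hiK : ∀ ρ > 0, IntegrableOn (kernelForm f y) (K \ Metric.ball y ρ))
    {ε : ℝ} (hε : 0 < ε) (hεK : Metric.closedBall y ε ⊆ K) :
    ∫ x in frontier K, kernelForm f y x (outerNormal K x) ∂(Measure.euclideanHausdorffMeasure d)
      = -∫ x, (cutoffSlope (‖x - y‖ ^ 2 / ε ^ 2) * (2 / ε ^ 2)) • kernelForm f y x (x - y) := by
  obtain ⟨H, hH0, hH⟩ := exists_abs_cutoffSlope_le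
  have hRlim : Tendsto (fun N : ℕ => (N : ℝ)) atTop atTop := tendsto_natCast_atTop_atTop
  have hev : ∀ᶠ N : ℕ in atTop, 1 ≤ (N : ℝ) ∧ ‖y‖ + ε ≤ (N : ℝ) / 2 := by
    filter_upwards [hRlim.eventually_ge_atTop (max 1 (2 * (‖y‖ + ε)))] with N hN
    exact ⟨(le_max_left _ _).trans hN, by linarith [(le_max_right _ _).trans hN]⟩
  -- Within ε/2 of y both slopes vanish, the outer one because N/2 ≥ ‖y‖ + ε. The majorant can
  -- therefore omit the pole.
  have hiK2 : IntegrableOn (fun x => (2 * H + 2 * H / ε) *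
      (K \ Metric.ball y (ε / 2)).indicator (fun x => ‖kernelForm f y x‖) x) K := by
    have h1 := ((integrable_indicator_iff
      (hKo.measurableSet.diff Metric.isOpen_ball.measurableSet)).2 (hiK _ (half_pos hε)).norm)
    exact (h1.const_mul _).integrableOn
  have hmeasV : AEStronglyMeasurable (kernelForm f y) (volume.restrict K) :=
    aestronglyMeasurable_kernelForm hd hKo hU hf hKU hy'
  have hb : ∀ (N : ℝ), 1 ≤ N → ‖y‖ + ε ≤ N / 2 → ∀ x ∈ K,
      ‖(cutoffSlope (‖x‖ ^ 2 / N ^ 2) * (2 / N ^ 2)) • kernelForm f y x x -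
        (cutoffSlope (‖x - y‖ ^ 2 / ε ^ 2) * (2 / ε ^ 2)) • kernelForm f y x (x - y)‖ ≤
      (2 * H + 2 * H / ε) *
        (K \ Metric.ball y (ε / 2)).indicator (fun x => ‖kernelForm f y x‖) x := by
    intro N hN hNy x hx
    have h1 := norm_cutoffSlope_smul_le hH (kernelForm f y x) 0 x (by linarith : 0 < N)
    have h2 := norm_cutoffSlope_smul_le hH (kernelForm f y x) y x hε
    rw [sub_zero] at h1
    by_cases hxy : ε / 2 ≤ ‖x - y‖
    · rw [indicator_of_mem (show x ∈ K \ Metric.ball y (ε / 2) from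
        ⟨hx, by rwa [mem_ball_iff_norm, not_lt]⟩), add_mul]
      rw [if_pos hxy] at h2
      refine (norm_sub_le _ _).trans (add_le_add (h1.trans ?_) h2)
      split_ifs
      · gcongr
        exact div_le_self (by positivity) hN
      · positivity
    · rw [if_neg hxy] at h2
      rw [not_le] at hxy
      have h3 : ¬ N / 2 ≤ ‖x‖ := by
        have := norm_sub_norm_le x y
        intro h
        linarith
      rw [if_neg h3] at h1
      have h4 := (norm_sub_le _ _).trans (add_le_add h1 h2)
      rw [add_zero] at h4
      exact h4.trans (mul_nonneg (by positivity) (indicator_nonneg (fun _ _ => norm_nonneg _) _))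
  have hlimK := tendsto_integral_filter_of_dominated_convergence (μ := volume.restrict K)
    (l := (atTop : Filter ℕ))
    (F := fun N x => (cutoffSlope (‖x‖ ^ 2 / (N : ℝ) ^ 2) * (2 / (N : ℝ) ^ 2)) • kernelForm f y x x -
        (cutoffSlope (‖x - y‖ ^ 2 / ε ^ 2) * (2 / ε ^ 2)) • kernelForm f y x (x - y))
    (f := fun x => -((cutoffSlope (‖x - y‖ ^ 2 / ε ^ 2) * (2 / ε ^ 2)) • kernelForm f y x (x - y)))
    (fun x => (2 * H + 2 * H / ε) *
      (K \ Metric.ball y (ε / 2)).indicator (fun x => ‖kernelForm f y x‖) x) ?_ ?_ hiK2 ?_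
  · have hlimS := tendsto_integral_filter_of_dominated_convergence
      (μ := (Measure.euclideanHausdorffMeasure d).restrict (frontier K)) (l := (atTop : Filter ℕ))
      (F := fun N x => radialCutoff 0 (N : ℝ) x • kernelForm f y x (outerNormal K x))
      (f := fun x => kernelForm f y x (outerNormal K x))
      (fun x => ‖kernelForm f y x (outerNormal K x)‖) ?_ ?_ hiS.norm ?_
    · have heq := hlimS.congr' (hev.mono fun N hN =>
        integral_radialCutoff_smul_kernelForm hd hKo hK hU hf hU0 hKU hy' hε hεK hN.2)
      rw [tendsto_nhds_unique heq hlimK, integral_neg]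
      congr 1
      refine setIntegral_eq_integral_of_forall_compl_eq_zero fun x hx => ?_
      rw [cutoffSlope_eq_zero, zero_mul, zero_smul]
      intro h
      refine hx (hεK ?_)
      rw [mem_closedBall_iff_norm]
      have := h.2
      rw [div_le_one (by positivity)] at this
      exact le_of_sq_le_sq this hε.le
    · exact Eventually.of_forall fun N =>
        ((contDiff_radialCutoff 0 (N : ℝ)).continuous.aestronglyMeasurable).smul
          hiS.aestronglyMeasurable
    · refine Eventually.of_forall fun N => Eventually.of_forall fun x => ?_
      have h0 : 0 ≤ radialCutoff 0 (N : ℝ) x := cutoffProfile_nonneg _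
      rw [norm_smul, Real.norm_of_nonneg h0]
      exact mul_le_of_le_one_left (norm_nonneg _) (cutoffProfile_le_one _)
    · refine Eventually.of_forall fun x => tendsto_const_nhds.congr' ?_
      filter_upwards [hRlim.eventually_ge_atTop (max 1 (2 * ‖x‖))] with N hN
      have h1 := (le_max_left _ _).trans hN
      have h2 := (le_max_right _ _).trans hN
      rw [radialCutoff_eq_one (by linarith) (by rw [sub_zero]; linarith), one_smul]
  · have hc := continuous_cutoffSlope
    refine Eventually.of_forall fun N => ?_
    have m1 : ∀ a : E (d + 1), AEStronglyMeasurable (fun x => kernelForm f y x (x - a))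
        (volume.restrict K) := fun a =>
      (ContinuousLinearMap.id ℝ (E (d + 1) →L[ℝ] Cl (d + 1))).aestronglyMeasurable_comp₂ hmeasV
        (by fun_prop : Continuous fun x : E (d + 1) => x - a).aestronglyMeasurable
    have m2 : ∀ (a : E (d + 1)) (r : ℝ), AEStronglyMeasurable
        (fun x => cutoffSlope (‖x - a‖ ^ 2 / r ^ 2) * (2 / r ^ 2)) (volume.restrict K) :=
      fun a r => (by fun_prop : Continuous fun x : E (d + 1) =>
        cutoffSlope (‖x - a‖ ^ 2 / r ^ 2) * (2 / r ^ 2)).aestronglyMeasurable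
    have m3 := (m2 0 N).smul (m1 0)
    have m4 := (m2 y ε).smul (m1 y)
    simp only [sub_zero] at m3
    exact m3.sub m4
  · filter_upwards [hev] with N hN
    exact (ae_restrict_iff' hKo.measurableSet).2 (Eventually.of_forall (hb N hN.1 hN.2))
  · refine Eventually.of_forall fun x => ?_
    refine tendsto_const_nhds.congr' ?_
    -- For a fixed x the outer shell has moved past x once N > 2‖x‖.
    filter_upwards [hRlim.eventually_ge_atTop (max 1 (2 * ‖x‖ + 1))] with N hN
    have h1 := (le_max_left _ _).trans hN
    have h2 := (le_max_right _ _).trans hN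
    have h3 := norm_cutoffSlope_smul_le hH (kernelForm f y x) 0 x (by linarith : (0 : ℝ) < N)
    rw [sub_zero, if_neg (by intro h; linarith), norm_le_zero_iff] at h3
    rw [h3, zero_sub]

theorem sphereArea_pos (d : ℕ) : 0 < sphereArea (d + 1) := by
  rw [sphereArea_eq]
  have : 0 < (volume (Metric.ball (0 : E (d + 1)) 1)).toReal :=
    ENNReal.toReal_pos (Metric.measure_ball_pos _ _ one_pos).ne' measure_ball_lt_top.ne
  positivity

/-- The Cauchy integral formula on a region with Lipschitz boundary. -/
theorem integral_kernelForm_outerNormal_eq {d : ℕ} [NeZero (d + 2)] {K U : Set (E (d + 2))}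
    {f : E (d + 2) → Cl (d + 2)} {y : E (d + 2)} (hKo : IsOpen K)
    (hK : HasLipschitzBoundary K) (hU : IsOpen U) (hf : LeftHypermonogenicOn f U)
    (hU0 : ∀ x ∈ U, x ⊤ ≠ 0) (hKU : closure K ⊆ U) (hy : y ∈ K) (hy' : conjVec y ∉ closure K)
    (hiS : IntegrableOn (fun x => kernelForm f y x (outerNormal K x)) (frontier K)
      (Measure.euclideanHausdorffMeasure (d + 1)))
    (hiK : ∀ ρ > 0, IntegrableOn (kernelForm f y) (K \ Metric.ball y ρ)) :
    ∫ x in frontier K, kernelForm f y x (outerNormal K x)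
        ∂(Measure.euclideanHausdorffMeasure (d + 1))
      = (sphereArea (d + 2) * (2 * |y ⊤|)⁻¹ ^ d) • f y := by
  have hyU := hKU (subset_closure hy)
  have hlim := (tendsto_integral_cutoffSlope_smul_kernelForm hU hf.1 hyU (hU0 y hyU)).neg
  obtain ⟨δ, hδ, hδK⟩ := Metric.isOpen_iff.1 hKo y hy
  have hev : ∀ᶠ ε : ℝ in 𝓝[>] 0, ∫ x in frontier K, kernelForm f y x (outerNormal K x)
      ∂(Measure.euclideanHausdorffMeasure (d + 1)) =
      -∫ x, (cutoffSlope (‖x - y‖ ^ 2 / ε ^ 2) * (2 / ε ^ 2)) • kernelForm f y x (x - y) := by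
    filter_upwards [Ioo_mem_nhdsGT hδ] with ε hε
    exact integral_kernelForm_outerNormal (by lia) hKo hK hU hf hU0 hKU hy' hiS hiK hε.1
      ((Metric.closedBall_subset_ball hε.2).trans hδK)
  rw [tendsto_nhds_unique (tendsto_const_nhds.congr' hev) hlim, ← neg_smul, neg_neg,
    sphereArea_eq]
  push_cast
  congr 3
  ring

end CauchyFormula

end HyperCyl
end

/-! ### Periodised kernels and integrability over the periodic region. -/

noncomputable section
namespace HyperCyl
open Filter Topology
open scoped ENNReal RealInnerProductSpace

section Periodization

variable {n k : ℕ} {ω : Fin k → E n}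

/-- Shift of the summation index; the sign is a character with values ±1, hence its own inverse. The
kernel series thus transforms like a section of the bundle. -/
theorem tsum_latticeSign_smul_add (l : ℕ) (p : E n → Cl n) (x : E n) (m : Fin k → ℤ) :
    ∑' m', latticeSign l m' • p (x + latticePoint ω m + latticePoint ω m')
      = latticeSign l m • ∑' m', latticeSign l m' • p (x + latticePoint ω m') := by
  rw [← tsum_const_smul'' (latticeSign l m), ← (Equiv.addLeft m).tsum_eq
    (fun m' => latticeSign l m • latticeSign l m' • p (x + latticePoint ω m'))]
  refine tsum_congr fun m' => ?_
  rw [Equiv.coe_addLeft, smul_smul, latticeSign_add, ← mul_assoc, latticeSign_mul_self, one_mul,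
    latticePoint_add, add_assoc]

theorem summable_latticeSign_smul (hω : LinearIndependent ℝ ω) (l : ℕ) {S : Set (E n)}
    (hS : ∀ x m, x + latticePoint ω m ∈ S ↔ x ∈ S) {p : E n → Cl n} {q : ℕ} (hq : k < q) {C : ℝ}
    (hC : 0 ≤ C) (hpC : ∀ z ∈ S, ‖p z‖ ≤ C * (1 + ‖z‖)⁻¹ ^ q) {x : E n} (hx : x ∈ S) :
    Summable fun m => latticeSign l m • p (x + latticePoint ω m) := by
  refine (summable_translates_bound hω hq C ‖x‖).of_norm_bounded fun m => ?_
  rw [norm_smul, Real.norm_eq_abs, abs_latticeSign, one_mul]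
  refine (hpC _ ((hS x m).2 hx)).trans ?_
  gcongr
  exact inv_one_add_norm_add_le le_rfl

theorem measurePreserving_add_euclideanHausdorffMeasure (d : ℕ) (v : E n) :
    MeasurePreserving (fun x : E n => x + v) (Measure.euclideanHausdorffMeasure d)
      (Measure.euclideanHausdorffMeasure d) :=
  (IsometryEquiv.addRight v).measurePreserving_euclideanHausdorffMeasure d

/-- Integrals over the cylinder of a product of a periodised kernel with a section unfold to
integrals over the universal cover. -/
theorem integral_periodized_mul (hω : LinearIndependent ℝ ω) (l : ℕ) {S' : Set (Cylinder ω)}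
    (hS'c : IsClosed S') (hS' : IsCompact S') {p w : E n → Cl n}
    (hp : ContinuousOn p (proj ω ⁻¹' S')) {q : ℕ} (hq : k < q) {C B : ℝ} (hC : 0 ≤ C)
    (hB : 0 ≤ B) (hpC : ∀ z, proj ω z ∈ S' → ‖p z‖ ≤ C * (1 + ‖z‖)⁻¹ ^ q)
    (hw : AEStronglyMeasurable w
      ((Measure.euclideanHausdorffMeasure (n - 1)).restrict (proj ω ⁻¹' S')))
    (hwB : ∀ z, proj ω z ∈ S' → ‖w z‖ ≤ B)
    (hwinv : ∀ z, proj ω z ∈ S' → ∀ m, w (z + latticePoint ω m) = latticeSign l m • w z)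
    (hfin : ∀ r, (Measure.euclideanHausdorffMeasure (n - 1) : Measure (E n))
      (proj ω ⁻¹' S' ∩ Metric.closedBall 0 r) < ∞) :
    IntegrableOn (fun x => p x * w x) (proj ω ⁻¹' S')
        (Measure.euclideanHausdorffMeasure (n - 1)) ∧
      IntegrableOn (fun x' : Cylinder ω =>
        (∑' m, latticeSign l m • p (x'.out + latticePoint ω m)) * w x'.out) S'
          (surfaceMeasure ω) ∧
      ∫ x' in S', (∑' m, latticeSign l m • p (Quotient.out x' + latticePoint ω m)) *
          w (Quotient.out x') ∂(surfaceMeasure ω)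
        = ∫ x in proj ω ⁻¹' S', p x * w x ∂(Measure.euclideanHausdorffMeasure (n - 1)) := by
  have hSc : IsClosed (proj ω ⁻¹' S') := hS'c.preimage continuous_proj
  have hSinv : ∀ x m, x + latticePoint ω m ∈ proj ω ⁻¹' S' ↔ x ∈ proj ω ⁻¹' S' := by
    intro x m
    rw [mem_preimage, proj_add_latticePoint, mem_preimage]
  obtain ⟨R, hR⟩ := exists_norm_add_latticePoint_le hS'
  obtain ⟨M, hM0, hM⟩ := exists_norm_mul_le (n := n)
  have hG : AEStronglyMeasurable (fun x => p x * w x)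
      ((Measure.euclideanHausdorffMeasure (n - 1)).restrict (proj ω ⁻¹' S')) :=
    (mulL (n := n)).aestronglyMeasurable_comp₂ (hp.aestronglyMeasurable hSc.measurableSet) hw
  have hGb : ∀ z ∈ proj ω ⁻¹' S', ‖p z * w z‖ ≤ M * C * B * (1 + ‖z‖)⁻¹ ^ q := by
    intro z hz
    calc ‖p z * w z‖ ≤ M * ‖p z‖ * ‖w z‖ := hM _ _
      _ ≤ M * (C * (1 + ‖z‖)⁻¹ ^ q) * B := by
        gcongr
        · exact hpC z hz
        · exact hwB z hz
      _ = _ := by ring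
  obtain ⟨h1, h2, h3⟩ := integral_eq_integral_fundamentalCell_tsum_of_decay hω
    (measurePreserving_add_euclideanHausdorffMeasure (n - 1)) hSc.measurableSet hSinv hG hq
    (by positivity) hGb hR hfin
  -- The sign acquired by w under translation is exactly the sign in the kernel series, so the
  -- signed series times w is the plain sum over translates of pw.
  have hterm : ∀ x, proj ω x ∈ S' → ∑' m, p (x + latticePoint ω m) * w (x + latticePoint ω m)
      = (∑' m, latticeSign l m • p (x + latticePoint ω m)) * w x := by
    intro x hx
    have hs := summable_latticeSign_smul hω l hSinv hq hC hpC (x := x) hx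
    have h4 := ((mulL (n := n)).flip (w x)).map_tsum hs
    simp only [ContinuousLinearMap.flip_apply, mulL_apply] at h4
    rw [h4]
    refine tsum_congr fun m => ?_
    rw [hwinv x hx m, mul_smul_comm, smul_mul_assoc]
  -- Independence of the representative: both factors change by the same sign, whose square is 1.
  have hout : ∀ x, proj ω x ∈ S' →
      (∑' m, latticeSign l m • p (Quotient.out (proj ω x) + latticePoint ω m)) *
        w (Quotient.out (proj ω x)) = ∑' m, p (x + latticePoint ω m) * w (x + latticePoint ω m) := by
    intro x hx
    obtain ⟨m, hm⟩ := proj_eq_iff.1 (proj_out (proj ω x)).symm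
    rw [hterm x hx, hm, tsum_latticeSign_smul_add, hwinv x hx, smul_mul_smul_comm,
      latticeSign_mul_self, one_smul]
  obtain ⟨h5, h6⟩ := integrable_and_integral_surfaceMeasure hω
    (measurableSet_quotient.2 hSc.measurableSet) h2
    (G' := fun x' : Cylinder ω =>
      (∑' m, latticeSign l m • p (Quotient.out x' + latticePoint ω m)) * w (Quotient.out x')) hout
  exact ⟨h1, h5, h6.trans h3.symm⟩

end Periodization

section CylinderFormula

theorem exists_norm_kernelForm_le {n : ℕ} [NeZero n] : ∃ M, 0 ≤ M ∧
    ∀ (f : E n → Cl n) (y x : E n), ‖kernelForm f y x‖ ≤ M * (‖p₁ x y‖ + ‖p₂ x y‖) * ‖f x‖ := by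
  obtain ⟨Mc, hMc0, hMc⟩ := exists_norm_conjCl_le (n := n)
  obtain ⟨Mm, hMm0, hMm⟩ := exists_norm_mul_le (n := n)
  obtain ⟨Mv, hMv0, hMv⟩ := exists_norm_vec_le (n := n)
  have htriple : ∀ a b c : Cl n, ‖a * b * c‖ ≤ Mm * (Mm * ‖a‖ * ‖b‖) * ‖c‖ := fun a b c =>
    (hMm _ _).trans (by gcongr; exact hMm _ _)
  refine ⟨Mm * Mm * Mv * (1 + Mc * Mc), by positivity, fun f y x => ?_⟩
  refine ContinuousLinearMap.opNorm_le_bound _ (by positivity) fun v => ?_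
  rw [kernelForm_apply]
  have h1 : ‖p₁ x y * vec v * f x‖ ≤ Mm * (Mm * ‖p₁ x y‖ * (Mv * ‖v‖)) * ‖f x‖ :=
    (htriple _ _ _).trans (by gcongr; exact hMv v)
  have h2 : ‖p₂ x y * conjCl (vec v) * conjCl (f x)‖
      ≤ Mm * (Mm * ‖p₂ x y‖ * (Mc * (Mv * ‖v‖))) * (Mc * ‖f x‖) := by
    refine (htriple _ _ _).trans ?_
    gcongr
    · exact (hMc _).trans (by gcongr; exact hMv v)
    · exact hMc _
  refine (norm_sub_le _ _).trans ((add_le_add h1 h2).trans ?_)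
  have h3 : 0 ≤ Mm * Mm * Mv * ‖p₂ x y‖ * ‖f x‖ * ‖v‖ := by positivity
  have h4 : 0 ≤ Mm * Mm * Mv * (Mc * Mc) * ‖p₁ x y‖ * ‖f x‖ * ‖v‖ := by positivity
  linarith

variable {d k : ℕ} [NeZero (d + 2)] {ω : Fin k → E (d + 2)} {U' K' : Set (Cylinder ω)}
  {f : E (d + 2) → Cl (d + 2)} {y : E (d + 2)}

/-- The decay and unfolding used on the boundary, now for Lebesgue measure on the region itself. -/
theorem integrableOn_kernelForm_diff_ball (hd : 1 ≤ d) (hω : LinearIndependent ℝ ω)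
    (hk : k < d + 2) (hK'_open : IsOpen K')
    (hU' : IsOpen U') (hK'_compact : IsCompact (closure K')) (hK'U' : closure K' ⊆ U')
    (hf : LeftHypermonogenicOn f (proj ω ⁻¹' U'))
    (hsign : ∀ x, proj ω x ∈ closure K' → 0 ≤ x ⊤ * y ⊤)
    (hy' : conjVec y ∉ closure (proj ω ⁻¹' K'))
    {B : ℝ} (hB0 : 0 ≤ B) (hB : ∀ x, proj ω x ∈ closure K' → ‖f x‖ ≤ B) {ρ : ℝ} (hρ : 0 < ρ) :
    IntegrableOn (kernelForm f y) (proj ω ⁻¹' K' \ Metric.ball y ρ) := by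
  have hKo : IsOpen (proj ω ⁻¹' K') := hK'_open.preimage continuous_proj
  have hbm : MeasurableSet (Metric.ball y ρ)ᶜ := Metric.isOpen_ball.measurableSet.compl
  have hKU : closure (proj ω ⁻¹' K') ⊆ proj ω ⁻¹' U' := by
    rw [← preimage_proj_closure]; exact preimage_mono hK'U'
  obtain ⟨C, hC0, hC⟩ := exists_norm_p_le (n := d + 2) (by lia) y hρ
  obtain ⟨M, hM0, hM⟩ := exists_norm_kernelForm_le (n := d + 2)
  obtain ⟨R, hR⟩ := exists_norm_add_latticePoint_le hK'_compact
  have h := (integral_eq_integral_fundamentalCell_tsum_of_decay hω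
    (μ := (volume : Measure (E (d + 2)))) (A := proj ω ⁻¹' K')
    -- The region without the ball is not lattice invariant, so the ball is removed from the
    -- integrand instead of the set.
    (g := (Metric.ball y ρ)ᶜ.indicator (kernelForm f y)) (p := 2 * (d + 2) - 3)
    (C := M * (2 * C) * B) (R := R)
    (fun v => measurePreserving_add_right volume v) hKo.measurableSet
    (fun x m => by rw [mem_preimage, proj_add_latticePoint, mem_preimage])
    ((aestronglyMeasurable_kernelForm (by lia) hKo (hU'.preimage continuous_proj) hf hKU
      hy').indicator hbm) (by lia) (by positivity) (fun z hz => ?_)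
    (fun x hx => hR x (subset_closure hx))
    (fun r => (measure_mono inter_subset_right).trans_lt
      (isCompact_closedBall _ _).measure_lt_top)).1
  · rw [IntegrableOn, integrable_indicator_iff hbm, IntegrableOn, Measure.restrict_restrict hbm,
      inter_comm, ← sdiff_eq] at h
    exact h
  · by_cases hzb : z ∈ (Metric.ball y ρ)ᶜ
    · rw [indicator_of_mem hzb]
      have hz1 : ρ ≤ ‖z - y‖ := by
        rwa [mem_compl_iff, mem_ball_iff_norm, not_lt] at hzb
      obtain ⟨h1, h2⟩ := hC z hz1 (hsign z (subset_closure hz))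
      have h3 := hB z (subset_closure hz)
      calc ‖kernelForm f y z‖ ≤ M * (‖p₁ z y‖ + ‖p₂ z y‖) * ‖f z‖ := hM f y z
        _ ≤ M * (C * (1 + ‖z‖)⁻¹ ^ (2 * (d + 2) - 3) + C * (1 + ‖z‖)⁻¹ ^ (2 * (d + 2) - 3)) * B := by
          gcongr
        _ = _ := by ring
    · rw [indicator_of_notMem hzb, norm_zero]
      positivity

end CylinderFormula

end HyperCyl
end

/-! ### Assembly on the cylinder. -/

noncomputable section
namespace HyperCyl
open Filter Topology
open scoped ENNReal RealInnerProductSpace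

section SpinorIntegrands

variable {n k : ℕ} [NeZero n] {ω : Fin k → E n} {U' K' : Set (Cylinder ω)} {f : E n → Cl n}

theorem continuousOn_p₁ (hn : 2 ≤ n) {y : E n} {S : Set (E n)} (hy : y ∉ S)
    (hy' : conjVec y ∉ S) : ContinuousOn (fun x => p₁ x y) S := fun x hx =>
  (hasFDerivAt_p₁ hn (fun h : x = y => hy (h ▸ hx))
    (fun h : x = conjVec y => hy' (h ▸ hx))).continuousAt.continuousWithinAt

theorem continuousOn_p₂ (hn : 2 ≤ n) {y : E n} {S : Set (E n)} (hy : y ∉ S)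
    (hy' : conjVec y ∉ S) : ContinuousOn (fun x => p₂ x y) S := fun x hx =>
  (hasFDerivAt_p₂ hn (fun h : x = y => hy (h ▸ hx))
    (fun h : x = conjVec y => hy' (h ▸ hx))).continuousAt.continuousWithinAt

omit [NeZero n] in
theorem outerNormal_add_latticePoint (K' : Set (Cylinder ω)) (x : E n) (m : Fin k → ℤ) :
    outerNormal (proj ω ⁻¹' K') (x + latticePoint ω m) = outerNormal (proj ω ⁻¹' K') x :=
  outerNormal_add (fun z => by rw [mem_preimage, proj_add_latticePoint, mem_preimage]) x

omit [NeZero n] in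
theorem exists_norm_vec_outerNormal_mul_le {B : ℝ} (hB0 : 0 ≤ B) : ∃ B', 0 ≤ B' ∧
    ∀ (K : Set (E n)) (x : E n), ‖f x‖ ≤ B → ‖vec (outerNormal K x) * f x‖ ≤ B' := by
  obtain ⟨M, hM0, hM⟩ := exists_norm_mul_le (n := n)
  obtain ⟨Mv, hMv0, hMv⟩ := exists_norm_vec_le (n := n)
  refine ⟨M * Mv * B, by positivity, fun K x hx => ?_⟩
  have h1 : ‖vec (outerNormal K x)‖ ≤ Mv :=
    (hMv _).trans (mul_le_of_le_one_right hMv0 (norm_outerNormal_le K x))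
  exact (hM _ _).trans (by gcongr)

end SpinorIntegrands

section Representation

variable {d k : ℕ} [NeZero (d + 2)] {ω : Fin k → E (d + 2)} {U' K' : Set (Cylinder ω)}
  {f : E (d + 2) → Cl (d + 2)} {y : E (d + 2)}

/-- The Cauchy formula for spinor sections on the cylinder, with the constant on the other side. -/
theorem cauchy_formula_cylinder (hd : 1 ≤ d) (hω : LinearIndependent ℝ ω)
    (hω_last : ∀ i, ω i ⊤ = 0) (l : ℕ) (hU' : IsOpen U')
    (hU'_ne : ∀ x, proj ω x ∈ U' → x ⊤ ≠ 0) (hK'_open : IsOpen K') (hK'_conn : IsConnected K')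
    (hK'_compact : IsCompact (closure K')) (hK'U' : closure K' ⊆ U')
    (hK'_lip : HasLipschitzBoundary (proj ω ⁻¹' K')) (hf_sec : IsSpinorSection ω l U' f)
    (hf : LeftHypermonogenicOn f (proj ω ⁻¹' U')) (hy : proj ω y ∈ K') :
    (∀ x, proj ω x ∈ frontier K' → Summable (c₁Term ω l x y) ∧ Summable (c₂Term ω l x y)) ∧
    IntegrableOn (integrand₁ ω l K' f y) (frontier K') (surfaceMeasure ω) ∧
    IntegrableOn (integrand₂ ω l K' f y) (frontier K') (surfaceMeasure ω) ∧
    (∫ x' in frontier K', integrand₁ ω l K' f y x' ∂(surfaceMeasure ω)) -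
        ∫ x' in frontier K', integrand₂ ω l K' f y x' ∂(surfaceMeasure ω)
      = (sphereArea (d + 2) * (2 * |y ⊤|)⁻¹ ^ d) • f y := by
  have hk := lt_of_linearIndependent_of_apply_eq_zero hω hω_last
  have hKo : IsOpen (proj ω ⁻¹' K') := hK'_open.preimage continuous_proj
  have hfr := preimage_proj_frontier K'
  have hKU : closure (proj ω ⁻¹' K') ⊆ proj ω ⁻¹' U' := by
    rw [← preimage_proj_closure]; exact preimage_mono hK'U'
  have hy0 : y ⊤ ≠ 0 := hU'_ne y (hK'U' (subset_closure hy))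
  -- Connectedness gives a strict sign on K', which passes weakly to the closure. It yields both the
  -- kernel decay and the absence of y* from the closure.
  have hsign : ∀ x, proj ω x ∈ closure K' → 0 ≤ x ⊤ * y ⊤ := by
    have h1 : closure (proj ω ⁻¹' K') ⊆ {x | 0 ≤ x ⊤ * y ⊤} :=
      closure_minimal (fun x hx => (zero_lt_mul_of_isConnected hω_last hK'_conn
        (fun z hz => hU'_ne z (hK'U' (subset_closure hz))) hx hy).le)
        (isClosed_le continuous_const (by fun_prop))
    rw [← preimage_proj_closure] at h1
    exact fun x hx => h1 hx
  have hy' : conjVec y ∉ closure (proj ω ⁻¹' K') := by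
    rw [← preimage_proj_closure]
    intro h
    have := hsign _ h
    rw [conjVec_apply_top] at this
    have := mul_self_pos.2 hy0
    linarith
  have hfc : ContinuousOn f (proj ω ⁻¹' U') := hf.1.continuousOn
  obtain ⟨B, hB0, hB⟩ :=
    exists_norm_le_of_isSpinorSection hf_sec hfc hK'_compact isClosed_closure hK'U'
  obtain ⟨ρ, hρ, hρK⟩ := Metric.isOpen_iff.1 hKo y hy
  obtain ⟨C, hC0, hC⟩ := exists_norm_p_le (n := d + 2) (by lia) y hρ
  have hSK : ∀ z, proj ω z ∈ frontier K' → proj ω z ∈ closure K' := fun z hz =>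
    frontier_subset_closure hz
  have hSnot : ∀ z, proj ω z ∈ frontier K' → z ∉ proj ω ⁻¹' K' := by
    intro z hz
    rw [hK'_open.frontier_eq] at hz
    exact hz.2
  have hSρ : ∀ z, proj ω z ∈ frontier K' → ρ ≤ ‖z - y‖ := by
    intro z hz
    by_contra! hcon
    exact hSnot z hz (hρK (mem_ball_iff_norm.2 hcon))
  have hCS : ∀ z, proj ω z ∈ frontier K' →
      ‖p₁ z y‖ ≤ C * (1 + ‖z‖)⁻¹ ^ (2 * (d + 2) - 3) ∧
        ‖p₂ z y‖ ≤ C * (1 + ‖z‖)⁻¹ ^ (2 * (d + 2) - 3) := fun z hz =>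
    hC z (hSρ z hz) (hsign z (hSK z hz))
  -- With n = d + 2 this is k ≤ n - 1 < 2n - 3; here n ≥ 3 is essential.
  have hq : k < 2 * (d + 2) - 3 := by lia
  have hSy : y ∉ proj ω ⁻¹' frontier K' := fun h => hSnot y h hy
  have hSy' : conjVec y ∉ proj ω ⁻¹' frontier K' := by
    rw [hfr]
    exact fun h => hy' (frontier_subset_closure h)
  have hSinv : ∀ x m, x + latticePoint ω m ∈ proj ω ⁻¹' frontier K'
      ↔ x ∈ proj ω ⁻¹' frontier K' := by
    intro x m
    rw [mem_preimage, proj_add_latticePoint, mem_preimage]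
  have hScl : IsClosed (frontier K') := isClosed_frontier
  have hScomp : IsCompact (frontier K') :=
    hK'_compact.of_isClosed_subset isClosed_frontier frontier_subset_closure
  -- The section data of the first integral. Since conjugation is multiplicative, w* = n*f* serves
  -- the second one, and both inherit the bundle's sign rule because the normal is periodic.
  set w : E (d + 2) → Cl (d + 2) := fun x => vec (outerNormal (proj ω ⁻¹' K') x) * f x with hw
  have hwm : AEStronglyMeasurable w
      ((Measure.euclideanHausdorffMeasure (d + 2 - 1)).restrict (proj ω ⁻¹' frontier K')) := by
    have h1 := vecL.continuous.comp_aestronglyMeasurable (aestronglyMeasurable_outerNormal hK'_lip)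
    rw [← hfr] at h1
    have h2 := (hfc.mono fun x hx => hK'U' (hSK x hx)).aestronglyMeasurable
      (μ := Measure.euclideanHausdorffMeasure (d + 2 - 1))
      (hScl.preimage continuous_proj).measurableSet
    exact (mulL (n := d + 2)).aestronglyMeasurable_comp₂ h1 h2
  have hwm' : AEStronglyMeasurable (fun x => conjCl (w x))
      ((Measure.euclideanHausdorffMeasure (d + 2 - 1)).restrict (proj ω ⁻¹' frontier K')) :=
    conjL.continuous.comp_aestronglyMeasurable hwm
  obtain ⟨B₁, hB₁0, hB₁⟩ := exists_norm_vec_outerNormal_mul_le (f := f) hB0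
  obtain ⟨Mc, hMc0, hMc⟩ := exists_norm_conjCl_le (n := d + 2)
  have hwB : ∀ z, proj ω z ∈ frontier K' → ‖w z‖ ≤ B₁ := fun z hz => hB₁ _ z (hB z (hSK z hz))
  have hwB' : ∀ z, proj ω z ∈ frontier K' → ‖conjCl (w z)‖ ≤ Mc * B₁ := fun z hz =>
    (hMc _).trans (mul_le_mul_of_nonneg_left (hwB z hz) hMc0)
  have hwinv : ∀ z, proj ω z ∈ frontier K' → ∀ m,
      w (z + latticePoint ω m) = latticeSign l m • w z := by
    intro z hz m
    simp only [hw]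
    rw [outerNormal_add_latticePoint, hf_sec z (hK'U' (hSK z hz)) m, mul_smul_comm]
  have hwinv' : ∀ z, proj ω z ∈ frontier K' → ∀ m,
      conjCl (w (z + latticePoint ω m)) = latticeSign l m • conjCl (w z) := by
    intro z hz m
    rw [hwinv z hz m, map_smul]
  have hfin : ∀ r, (Measure.euclideanHausdorffMeasure (d + 2 - 1) : Measure (E (d + 2)))
      (proj ω ⁻¹' frontier K' ∩ Metric.closedBall 0 r) < ∞ := by
    intro r
    rw [hfr]
    exact measure_frontier_inter_lt_top hK'_lip (isCompact_closedBall 0 r)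
  obtain ⟨a1, a2, a3⟩ := integral_periodized_mul hω l hScl hScomp
    (continuousOn_p₁ (by lia) hSy hSy') hq hC0 hB₁0 (fun z hz => (hCS z hz).1) hwm hwB hwinv hfin
  obtain ⟨b1, b2, b3⟩ := integral_periodized_mul hω l hScl hScomp
    (continuousOn_p₂ (by lia) hSy hSy') hq hC0 (by positivity) (fun z hz => (hCS z hz).2)
    hwm' hwB' hwinv' hfin
  have e1 : integrand₁ ω l K' f y = fun x' : Cylinder ω =>
      (∑' m, latticeSign l m • p₁ (x'.out + latticePoint ω m) y) * w x'.out := by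
    ext1 x'
    rw [integrand₁, mul_assoc]
    rfl
  have e2 : integrand₂ ω l K' f y = fun x' : Cylinder ω =>
      (∑' m, latticeSign l m • p₂ (x'.out + latticePoint ω m) y) * conjCl (w x'.out) := by
    ext1 x'
    rw [integrand₂, mul_assoc, ← map_mul]
    rfl
  have hV : ∀ x, kernelForm f y x (outerNormal (proj ω ⁻¹' K') x)
      = p₁ x y * w x - p₂ x y * conjCl (w x) := by
    intro x
    rw [kernelForm_apply, hw]
    simp only [map_mul, mul_assoc]
  refine ⟨fun x hx => ⟨?_, ?_⟩, by rw [e1]; exact a2, by rw [e2]; exact b2, ?_⟩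
  · exact summable_latticeSign_smul hω l hSinv (p := fun x => p₁ x y) hq hC0
      (fun z hz => (hCS z hz).1) hx
  · exact summable_latticeSign_smul hω l hSinv (p := fun x => p₂ x y) hq hC0
      (fun z hz => (hCS z hz).2) hx
  · rw [e1, e2, a3, b3, ← integral_sub a1 b1]
    have hiS : IntegrableOn (fun x => kernelForm f y x (outerNormal (proj ω ⁻¹' K') x))
        (frontier (proj ω ⁻¹' K')) (Measure.euclideanHausdorffMeasure (d + 1)) := by
      simp only [hV]
      rw [← hfr]
      exact a1.sub b1
    have hmain := integral_kernelForm_outerNormal_eq hKo hK'_lip (hU'.preimage continuous_proj) hf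
      (fun x hx => hU'_ne x hx) hKU hy hy' hiS fun ρ' hρ' =>
        integrableOn_kernelForm_diff_ball hd hω hk hK'_open hU' hK'_compact hK'U' hf hsign hy'
          hB0 hB hρ'
    rw [← hmain, ← hfr]
    simp only [hV]
    rfl

end Representation

end HyperCyl
end

theorem theorem5 (n : ℕ) [NeZero n] (hn : 3 ≤ n) (k : ℕ) (ω : Fin k → E n)
    (hω : LinearIndependent ℝ ω) (hω_last : ∀ i, ω i ⊤ = 0)
    (l : ℕ) (hl : l ≤ k)
    (U' : Set (Cylinder ω)) (hU' : IsOpen U')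
    (hU'_ne : ∀ x : E n, proj ω x ∈ U' → x ⊤ ≠ 0)
    (K' : Set (Cylinder ω)) (hK'_open : IsOpen K') (hK'_conn : IsConnected K')
    (hK'_compact : IsCompact (closure K')) (hK'U' : closure K' ⊆ U')
    (hK'_lip : HasLipschitzBoundary (proj ω ⁻¹' K'))
    (f : E n → Cl n) (hf_sec : IsSpinorSection ω l U' f)
    (hf : LeftHypermonogenicOn f (proj ω ⁻¹' U'))
    (y : E n) (hy : proj ω y ∈ K') :
    (∀ x : E n, proj ω x ∈ frontier K' →
      Summable (c₁Term ω l x y) ∧ Summable (c₂Term ω l x y)) ∧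
    IntegrableOn (integrand₁ ω l K' f y) (frontier K') (surfaceMeasure ω) ∧
    IntegrableOn (integrand₂ ω l K' f y) (frontier K') (surfaceMeasure ω) ∧
    f y = (2 ^ (n - 2) * |y ⊤| ^ (n - 2) / sphereArea n) •
      ((∫ x' in frontier K', integrand₁ ω l K' f y x' ∂(surfaceMeasure ω)) -
        ∫ x' in frontier K', integrand₂ ω l K' f y x' ∂(surfaceMeasure ω)) := by
  -- Writing n = d + 2 turns the truncated exponent n - 2 into d; the formula is then solved for
  -- f(y).
  obtain ⟨d, rfl⟩ := Nat.exists_eq_add_of_le' (show 2 ≤ n by lia)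
  obtain ⟨h1, h2, h3, h4⟩ := cauchy_formula_cylinder (by lia) hω hω_last l hU' hU'_ne hK'_open
    hK'_conn hK'_compact hK'U' hK'_lip hf_sec hf hy
  refine ⟨h1, h2, h3, ?_⟩
  have hy0 : y ⊤ ≠ 0 := hU'_ne y (hK'U' (subset_closure hy))
  have hA := sphereArea_pos (d + 1)
  have hy1 : 2 * |y ⊤| ≠ 0 := by positivity
  rw [h4, smul_smul, Nat.add_sub_cancel, ← mul_pow]
  have : (2 * |y ⊤|) ^ d / sphereArea (d + 2) * (sphereArea (d + 2) * (2 * |y ⊤|)⁻¹ ^ d) = 1 := by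
    rw [inv_pow]
    have hA' : sphereArea (d + 2) ≠ 0 := hA.ne'
    field_simp
  rw [this, one_smul]
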